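/- Let $(S,h)$ be a closed oriented hyperbolic surface, $\widetilde S\cong\mathbb H^2$ its universal cover, on which $\pi_1(S)$ acts by deck transformations, so that $S=\pi_1(S)\backslash\mathbb H^2$. For a smooth ($C^\infty$) map $f$ from $(S,h)$ to a hyperbolic manifold $(M,g)$, or a smooth $\rho$-equivariant map $f$ from $\widetilde S$ to $\mathbb H^2$ or $\mathbb H^3$ (with $g$ the hyperbolic metric), let $b$ be the unique non-negative $h$-self-adjoint operator with $f^*g(\cdot,\cdot)=h(b\,\cdot,b\,\cdot)$, and put $F(f)=\int_S \operatorname{tr}(b)\,\omega_h$, where $\omega_h$ is the area form of $h$. A *minimal Lagrangian map* from $(S,h)$ to a hyperbolic surface $(S^\star,h^\star)$ is a smooth diffeomorphism which preserves the area measures (orientation may be preserved or reversed) and whose graph is a minimal surface in $(S\times S^\star,h\oplus h^\star)$, i.e. the immersion $p\mapsto(p,f(p))$ is a critical point of the area under smooth variations. (1) Let $\rho:\pi_1(S)\to \mathrm{PSL}_2(\mathbb R)\subset \mathrm{PSL}_2(\mathbb C)$ be a Fuchsian (discrete and faithful) representation, and let $\tilde f:\widetilde S\to\mathbb H^2$ be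 a smooth $\rho$-equivariant local diffeomorphism. Identify $\mathbb H^2$ with the totally geodesic plane of $\mathbb H^3$ preserved by $\mathrm{PSL}_2(\mathbb R)$. Then $\tilde f$ minimizes $F$ among all smooth $\rho$-equivariant maps $\widetilde S\to\mathbb H^3$ if and only if $\tilde f$ is minimal Lagrangian, i.e. is the lift of a minimal Lagrangian map $S\to\mathbb H^2/\rho(\pi_1(S))$. (2) Let $f:(S,h)\to(S^\star,h^\star)$ be a smooth diffeomorphism between closed oriented hyperbolic surfaces. Then $f$ is minimal Lagrangian if and only if it is a critical point of $F$ on $C^\infty(S,S^\star)$, i.e. $\frac{d}{dt}F(f_t)|_{t=0}=0$ for every smooth family $(f_t)_{t\in(-\varepsilon,\varepsilon)}$ of smooth maps $S\to S^\star$ with $f_0=f$. -/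

import Mathlib

open UpperHalfPlane MeasureTheory
open scoped ContDiff MatrixGroups ComplexConjugate

noncomputable section

namespace MinLag

/-! ### Hyperbolic plane, hyperbolic space and the actions of `PSL(2, ℝ)`

The hyperbolic plane is Mathlib's upper half-plane `ℍ`, with the metric `|dw|² / (im w)²` and its
area measure `volume = dx dy / y²`. -/

/-- Upper half-space model of hyperbolic 3-space: points `(z, t)` with `z` complex and `t > 0`,
carrying the metric `(|dz|² + dt²) / t²`. -/
@[ext]
structure H3 where
  z : ℂ
  t : ℝ
  t_pos : 0 < t

/-- The denominator `|c z + d|² + |c|² t²` of the Poincaré extension. -/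
def H3.den (g : SL(2, ℂ)) (x : H3) : ℝ :=
  Complex.normSq (g 1 0 * x.z + g 1 1) + Complex.normSq (g 1 0) * x.t ^ 2

lemma H3.den_pos (g : SL(2, ℂ)) (x : H3) : 0 < H3.den g x := by
  unfold H3.den
  by_cases hc : g 1 0 = 0
  · have hdet := Matrix.SpecialLinearGroup.det_coe g
    rw [Matrix.det_fin_two] at hdet
    have hd : g 1 1 ≠ 0 := by
      intro hd
      rw [hc, hd] at hdet
      simp at hdet
    have := Complex.normSq_pos.2 hd
    simpa [hc] using this
  · have h1 := Complex.normSq_pos.2 hc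
    have h2 := Complex.normSq_nonneg (g 1 0 * x.z + g 1 1)
    have h3 := x.t_pos
    positivity

/-- The isometric action of `SL(2, ℂ)` on hyperbolic 3-space (Poincaré extension of Möbius
transformations). -/
def H3.act (g : SL(2, ℂ)) (x : H3) : H3 where
  z := ((g 0 0 * x.z + g 0 1) * conj (g 1 0 * x.z + g 1 1) + g 0 0 * conj (g 1 0) * (x.t : ℂ) ^ 2)
    / (H3.den g x : ℂ)
  t := x.t / H3.den g x
  t_pos := div_pos x.t_pos (H3.den_pos g x)

/-- The inclusion of `SL(2, ℝ)` in `SL(2, ℂ)`. -/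
def toSL2C : SL(2, ℝ) →* SL(2, ℂ) := Matrix.SpecialLinearGroup.map Complex.ofRealHom

/-- Elements of `SL(2, ℝ)` with the same class in `PSL(2, ℝ)` agree up to sign. -/
lemma eq_or_eq_neg_of_rel {g k : SL(2, ℝ)}
    (h : QuotientGroup.leftRel (Subgroup.center SL(2, ℝ)) g k) : k = g ∨ k = -g := by
  rw [QuotientGroup.leftRel_apply, Matrix.SpecialLinearGroup.mem_center_iff] at h
  obtain ⟨r, hr, hs⟩ := h
  have hr' : r = 1 ∨ r = -1 := by
    have : r ^ 2 = 1 := by simpa using hr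
    simpa using this
  have hk : k = g * (g⁻¹ * k) := by group
  rcases hr' with rfl | rfl
  · left
    have h1 : g⁻¹ * k = 1 := by
      ext i j
      rw [← hs]
      simp
    rw [hk, h1, mul_one]
  · right
    have h1 : g⁻¹ * k = -1 := by
      ext i j
      rw [← hs]
      by_cases hij : i = j <;> simp [hij]
    rw [hk, h1, mul_neg, mul_one]

/-- The action of `PSL(2, ℝ)` on the hyperbolic plane by Möbius transformations. -/
instance : MulAction PSL(2, ℝ) ℍ where
  smul g p := Quotient.liftOn' g (fun k : SL(2, ℝ) => k • p) (by
    intro g k h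
    rcases eq_or_eq_neg_of_rel h with rfl | rfl
    · rfl
    · ext
      rw [UpperHalfPlane.coe_specialLinearGroup_apply, UpperHalfPlane.coe_specialLinearGroup_apply]
      have e : ∀ i j, (-g) i j = -(g i j) := fun i j => rfl
      simp only [e, map_neg, Complex.ofReal_neg, neg_mul, ← neg_add, neg_div_neg_eq])
  one_smul p := one_smul SL(2, ℝ) p
  mul_smul g k p := by
    induction g using QuotientGroup.induction_on with
    | H g =>
      induction k using QuotientGroup.induction_on with
      | H k => exact mul_smul g k p

lemma mk_smul (g : SL(2, ℝ)) (p : ℍ) : ((g : PSL(2, ℝ)) • p) = g • p := rfl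

/-- The action of `PSL(2, ℝ)`, as a subgroup of `PSL(2, ℂ)`, on hyperbolic 3-space. -/
instance : SMul PSL(2, ℝ) H3 where
  smul g x := Quotient.liftOn' g (fun k : SL(2, ℝ) => H3.act (toSL2C k) x) (by
    intro g k h
    rcases eq_or_eq_neg_of_rel h with rfl | rfl
    · rfl
    · have hd : H3.den (toSL2C (-g)) x = H3.den (toSL2C g) x := by
        simp [H3.den, toSL2C]
        rw [← neg_add, Complex.normSq_neg]
      ext
      · simp only [H3.act, hd]
        simp only [toSL2C, Matrix.SpecialLinearGroup.map_apply_coe, RingHom.mapMatrix_apply,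
          Matrix.map_apply, Matrix.SpecialLinearGroup.coe_neg, Matrix.neg_apply, map_neg, map_add,
          map_mul]
        ring
      · simp [H3.act, hd])

lemma mk_smul_H3 (g : SL(2, ℝ)) (x : H3) : ((g : PSL(2, ℝ)) • x) = H3.act (toSL2C g) x := rfl

/-- The totally geodesic embedding of the hyperbolic plane in hyperbolic 3-space as the plane
stabilized by `PSL(2, ℝ)`. -/
def toH3 (p : ℍ) : H3 := ⟨(p.re : ℂ), p.im, p.im_pos⟩

lemma toH3_smul (g : PSL(2, ℝ)) (p : ℍ) : toH3 (g • p) = g • toH3 p := by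
  induction g using QuotientGroup.induction_on with
  | H g =>
    have hp := UpperHalfPlane.coe_specialLinearGroup_apply g p
    simp only [Algebra.algebraMap_self, RingHom.id_apply] at hp
    have hdet := Matrix.SpecialLinearGroup.det_coe g
    rw [Matrix.det_fin_two] at hdet
    rw [mk_smul, mk_smul_H3]
    ext
    · rw [toH3, ← UpperHalfPlane.coe_re, hp]
      simp [H3.act, toH3, H3.den, toSL2C, Complex.div_re, Complex.normSq_apply]
      norm_cast
      ring
    · change (g • p).im = _
      rw [← UpperHalfPlane.coe_im, hp]
      simp [H3.act, toH3, H3.den, toSL2C, Complex.div_im, Complex.normSq_apply]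
      rw [← sub_div]
      congr 1
      · linear_combination p.im * hdet
      · ring

/-! ### Smooth maps defined on the hyperbolic plane -/

/-- Smoothness (`C^∞` in the real sense) of a map from the hyperbolic plane to a normed space. -/
def IsSmooth {E : Type*} [NormedAddCommGroup E] [NormedSpace ℝ E] (u : ℍ → E) : Prop :=
  ContDiffOn ℝ ∞ (fun w : ℂ => u (ofComplex w)) {w : ℂ | 0 < w.im}

/-- The real differential at `p`, with the tangent plane at `p` identified with `ℂ`. -/
def diff {E : Type*} [NormedAddCommGroup E] [NormedSpace ℝ E] (u : ℍ → E) (p : ℍ) : ℂ →L[ℝ] E :=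
  fderiv ℝ (fun w : ℂ => u (ofComplex w)) (p : ℂ)

/-- Smoothness in `(t, p)`, for `-ε < t < ε`, of a one-parameter family of maps. -/
def IsSmoothFamily {E : Type*} [NormedAddCommGroup E] [NormedSpace ℝ E] (ε : ℝ)
    (u : ℝ → ℍ → E) : Prop :=
  ContDiffOn ℝ ∞ (fun q : ℝ × ℂ => u q.1 (ofComplex q.2))
    (Set.Ioo (-ε) ε ×ˢ {w : ℂ | 0 < w.im})

/-- Smooth maps `ℍ² → ℍ²`. -/
def IsSmoothH2 (f : ℍ → ℍ) : Prop := IsSmooth fun p => (f p : ℂ)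

/-- Smooth maps `ℍ² → ℍ³`. -/
def IsSmoothH3 (f : ℍ → H3) : Prop := IsSmooth (fun p => (f p).z) ∧ IsSmooth (fun p => (f p).t)

/-- Smooth one-parameter families of maps `ℍ² → ℍ²`. -/
def IsSmoothFamilyH2 (ε : ℝ) (f : ℝ → ℍ → ℍ) : Prop := IsSmoothFamily ε fun t p => (f t p : ℂ)

/-- The differential at `p` of a map `ℍ² → ℍ²`. -/
def diffH2 (f : ℍ → ℍ) (p : ℍ) : ℂ →L[ℝ] ℂ := diff (fun q => (f q : ℂ)) p

/-! ### Pull-back of the hyperbolic metrics -/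

/-- Bilinear forms on the tangent plane of the hyperbolic plane at a point. -/
abbrev Form := ℂ →ₗ[ℝ] ℂ →ₗ[ℝ] ℝ

/-- `⟨L v, L w⟩`, the pull-back of a scalar product under a linear map. -/
def pullInner {E : Type*} [NormedAddCommGroup E] [InnerProductSpace ℝ E] (L : ℂ →L[ℝ] E) : Form :=
  (innerₗ E).compl₁₂ (L : ℂ →ₗ[ℝ] E) (L : ℂ →ₗ[ℝ] E)

/-- The hyperbolic metric of `ℍ²` at `p`. -/
def hypMetric (p : ℍ) : Form := (1 / p.im ^ 2) • innerₗ ℂ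

/-- The pull-back under `f : ℍ² → ℍ²` of the hyperbolic metric, at `p`. -/
def pullH2 (f : ℍ → ℍ) (p : ℍ) : Form := (1 / (f p).im ^ 2) • pullInner (diffH2 f p)

/-- The pull-back under `f : ℍ² → ℍ³` of the hyperbolic metric, at `p`. -/
def pullH3 (f : ℍ → H3) (p : ℍ) : Form :=
  (1 / (f p).t ^ 2) •
    (pullInner (diff (fun q => (f q).z) p) + pullInner (diff (fun q => (f q).t) p))

/-! ### The operator `b`, and densities with respect to the hyperbolic metric -/

/-- `b` is the non-negative operator on the tangent plane at `p`, self-adjoint for the hyperbolic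
metric `h`, such that `G(v, w) = h(b v, b w)`. -/
structure IsRoot (p : ℍ) (G : Form) (b : ℂ →ₗ[ℝ] ℂ) : Prop where
  selfAdjoint : ∀ v w, hypMetric p (b v) w = hypMetric p v (b w)
  nonneg : ∀ v, 0 ≤ hypMetric p (b v) v
  root : ∀ v w, G v w = hypMetric p (b v) (b w)

open Classical in
/-- `tr b`, where `b` is the non-negative self-adjoint operator with `G = h(b ·, b ·)`; it exists
and is unique as soon as `G` is symmetric and non-negative. -/
def traceRoot (p : ℍ) (G : Form) : ℝ :=
  if H : ∃ b, IsRoot p G b then LinearMap.trace ℝ ℂ H.choose else 0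

lemma hypMetric_apply (p : ℍ) (v w : ℂ) :
    hypMetric p v w = (v.re * w.re + v.im * w.im) / p.im ^ 2 := by
  simp [hypMetric, innerₗ_apply_apply, Complex.inner]
  ring

lemma trace_eq (b : ℂ →ₗ[ℝ] ℂ) :
    LinearMap.trace ℝ ℂ b = (b 1).re + (b Complex.I).im := by
  rw [LinearMap.trace_eq_matrix_trace ℝ Complex.basisOneI, Matrix.trace_fin_two]
  simp [LinearMap.toMatrix_apply]

lemma apply_eq (b : ℂ →ₗ[ℝ] ℂ) (v : ℂ) : b v = v.re • b 1 + v.im • b Complex.I := by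
  rw [← map_smul, ← map_smul, ← map_add]
  congr 1
  apply Complex.ext <;> simp

/-- The trace of `b` is determined by `G`. -/
lemma IsRoot.trace_eq_sqrt {p : ℍ} {G : Form} {b : ℂ →ₗ[ℝ] ℂ} (hb : IsRoot p G b) :
    LinearMap.trace ℝ ℂ b = √(p.im ^ 2 * (G 1 1 + G Complex.I Complex.I +
      2 * √(G 1 1 * G Complex.I Complex.I - G 1 Complex.I * G Complex.I 1))) := by
  have hy : 0 < p.im := p.im_pos
  have hs := hb.selfAdjoint 1 Complex.I
  have h1 := hb.nonneg 1
  have h2 := hb.nonneg Complex.I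
  have h3 := hb.nonneg ((b Complex.I).im - (b 1).im * Complex.I)
  have h4 := hb.nonneg ((b 1).re * Complex.I - (b 1).im)
  have h5 := hb.nonneg (1 + Complex.I)
  have h6 := hb.nonneg (1 - Complex.I)
  have r11 := hb.root 1 1
  have r12 := hb.root 1 Complex.I
  have r21 := hb.root Complex.I 1
  have r22 := hb.root Complex.I Complex.I
  rw [apply_eq b] at h3 h4 h5 h6
  simp only [hypMetric_apply] at *
  rw [trace_eq, r11, r12, r21, r22]
  simp at hs h1 h2 h3 h4 h5 h6
  rw [div_left_inj' (by positivity)] at hs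
  rw [le_div_iff₀ (by positivity), zero_mul] at h1 h2 h3 h4 h5 h6
  rw [← hs] at h3 h4 h5 h6 ⊢
  generalize (b 1).re = a at *
  generalize (b 1).im = m at *
  generalize (b Complex.I).im = c at *
  have hd : 0 ≤ a * c - m ^ 2 := by
    rcases h1.eq_or_lt with ha | ha
    · rcases h2.eq_or_lt with hc | hc
      · subst ha hc
        have : m = 0 := by linarith
        simp [this]
      · refine le_of_mul_le_mul_left ?_ hc
        linarith
    · refine le_of_mul_le_mul_left ?_ ha
      linarith
  have e : (a * a + m * m) / p.im ^ 2 * ((m * m + c * c) / p.im ^ 2) -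
      (a * m + m * c) / p.im ^ 2 * ((m * a + c * m) / p.im ^ 2) =
      ((a * c - m ^ 2) / p.im ^ 2) ^ 2 := by
    field_simp
    ring
  rw [e, Real.sqrt_sq (div_nonneg hd (by positivity))]
  have e2 : p.im ^ 2 * ((a * a + m * m) / p.im ^ 2 + (m * m + c * c) / p.im ^ 2 +
      2 * ((a * c - m ^ 2) / p.im ^ 2)) = (a + c) ^ 2 := by
    field_simp
    ring
  rw [e2, Real.sqrt_sq (add_nonneg h1 h2)]

lemma traceRoot_eq {p : ℍ} {G : Form} {b : ℂ →ₗ[ℝ] ℂ} (hb : IsRoot p G b) :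
    traceRoot p G = LinearMap.trace ℝ ℂ b := by
  have H : ∃ b, IsRoot p G b := ⟨b, hb⟩
  rw [traceRoot, dif_pos H, H.choose_spec.trace_eq_sqrt, hb.trace_eq_sqrt]

/-- The operator `b` exists. -/
lemma exists_isRoot (p : ℍ) (G : Form) (hsymm : ∀ v w, G v w = G w v) (hnn : ∀ v, 0 ≤ G v v) :
    ∃ b, IsRoot p G b := by
  have hy : 0 < p.im := p.im_pos
  have hG : ∀ v w, G v w = v.re * w.re * G 1 1 + (v.re * w.im + v.im * w.re) * G 1 Complex.I +
      v.im * w.im * G Complex.I Complex.I := by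
    intro v w
    have hv : v = v.re • (1 : ℂ) + v.im • Complex.I := by apply Complex.ext <;> simp
    have hw : w = w.re • (1 : ℂ) + w.im • Complex.I := by apply Complex.ext <;> simp
    conv_lhs => rw [hv, hw]
    simp only [map_add, map_smul, LinearMap.add_apply, LinearMap.smul_apply, smul_eq_mul,
      hsymm Complex.I 1]
    ring
  have hA := hnn 1
  have hC := hnn Complex.I
  have h3 := hnn (G Complex.I Complex.I - G 1 Complex.I * Complex.I)
  have h4 := hnn (G 1 1 * Complex.I - G 1 Complex.I)
  have h5 := hnn (1 + Complex.I)
  have h6 := hnn (1 - Complex.I)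
  rw [hG] at h3 h4 h5 h6
  simp at h3 h4 h5 h6
  generalize G 1 1 = A at *
  generalize G 1 Complex.I = M at *
  generalize G Complex.I Complex.I = C at *
  have hd : 0 ≤ A * C - M ^ 2 := by
    rcases hA.eq_or_lt with ha | ha
    · rcases hC.eq_or_lt with hc | hc
      · subst ha hc
        have : M = 0 := by linarith
        simp [this]
      · refine le_of_mul_le_mul_left ?_ hc
        linarith
    · refine le_of_mul_le_mul_left ?_ ha
      linarith
  obtain ⟨s, hs0, hs⟩ : ∃ s : ℝ, 0 ≤ s ∧ s ^ 2 = A * C - M ^ 2 :=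
    ⟨√(A * C - M ^ 2), Real.sqrt_nonneg _, Real.sq_sqrt hd⟩
  obtain ⟨r, hr0, hr⟩ : ∃ r : ℝ, 0 ≤ r ∧ r ^ 2 = A + C + 2 * s :=
    ⟨√(A + C + 2 * s), Real.sqrt_nonneg _, Real.sq_sqrt (by positivity)⟩
  rcases hr0.eq_or_lt with h0 | hpos
  · have hA0 : A = 0 := by rw [← h0] at hr; linarith
    have hC0 : C = 0 := by rw [← h0] at hr; linarith
    have hM0 : M = 0 := by subst hA0 hC0; linarith
    refine ⟨0, ⟨by simp, by simp, fun v w => ?_⟩⟩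
    rw [hG, hA0, hC0, hM0]
    simp
  · let b : ℂ →ₗ[ℝ] ℂ := (p.im / r) •
      ((Complex.reLm.smulRight ((A + s : ℝ) + M * Complex.I : ℂ)) +
        Complex.imLm.smulRight (M + (C + s : ℝ) * Complex.I : ℂ))
    have hre : ∀ v, (b v).re = p.im / r * (v.re * (A + s) + v.im * M) := by
      intro v; simp [b]; ring
    have him : ∀ v, (b v).im = p.im / r * (v.re * M + v.im * (C + s)) := by
      intro v; simp [b]; ring
    refine ⟨b, ⟨fun v w => ?_, fun v => ?_, fun v w => ?_⟩⟩
    · simp only [hypMetric_apply, hre, him]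
      ring
    · have hv := hnn v
      rw [hG] at hv
      rw [hypMetric_apply, hre, him]
      have : (p.im / r * (v.re * (A + s) + v.im * M) * v.re +
          p.im / r * (v.re * M + v.im * (C + s)) * v.im) = p.im / r *
          ((v.re * v.re * A + (v.re * v.im + v.im * v.re) * M + v.im * v.im * C) +
            s * (v.re ^ 2 + v.im ^ 2)) := by ring
      rw [this]
      positivity
    · rw [hG, hypMetric_apply, hre, him, hre, him]
      field_simp
      rw [hr]
      linear_combination (v.re * w.re + v.im * w.im) * (-hs)

/-- The density of the area form of `G` with respect to that of the hyperbolic metric: the square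
root of the Gram determinant of `G` in the orthonormal basis `(y, y i)` at `p = x + y i`. -/
def areaDensity (p : ℍ) (G : Form) : ℝ :=
  let e₁ : ℂ := p.im
  let e₂ : ℂ := p.im * Complex.I
  √(G e₁ e₁ * G e₂ e₂ - G e₁ e₂ * G e₂ e₁)

/-! ### Hyperbolic surfaces -/

/-- `Γ` is the deck group of the universal cover `ℍ² → S` of a closed oriented hyperbolic surface
`S = Γ \ ℍ²`: it acts freely, properly discontinuously and cocompactly. -/
structure IsSurfaceGroup (Γ : Subgroup PSL(2, ℝ)) : Prop where
  properlyDiscontinuous : ∀ K L : Set ℍ, IsCompact K → IsCompact L →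
    {γ : PSL(2, ℝ) | γ ∈ Γ ∧ (((fun p : ℍ => γ • p) '' K) ∩ L).Nonempty}.Finite
  free : ∀ γ ∈ Γ, ∀ p : ℍ, γ • p = p → γ = 1
  cocompact : ∃ K : Set ℍ, IsCompact K ∧ ∀ p : ℍ, ∃ γ ∈ Γ, γ • p ∈ K

/-- Discrete and faithful representations in `PSL(2, ℝ)`. -/
def IsFuchsian {Γ : Subgroup PSL(2, ℝ)} (ρ : Γ →* PSL(2, ℝ)) : Prop :=
  Function.Injective ρ ∧ DiscreteTopology ρ.range

/-- `f` is the lift of a map `Γ \ ℍ² → Γ' \ ℍ²`. -/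
def Descends (Γ Γ' : Subgroup PSL(2, ℝ)) (f : ℍ → ℍ) : Prop :=
  ∀ γ ∈ Γ, ∀ p : ℍ, ∃ γ' ∈ Γ', f (γ • p) = γ' • f p

/-- `f` is the lift of a smooth diffeomorphism `Γ \ ℍ² → Γ' \ ℍ²`. -/
def IsLiftOfDiffeo (Γ Γ' : Subgroup PSL(2, ℝ)) (f : ℍ → ℍ) : Prop :=
  IsSmoothH2 f ∧ Descends Γ Γ' f ∧
    ∃ g : ℍ → ℍ, IsSmoothH2 g ∧ Descends Γ' Γ g ∧ Function.LeftInverse g f ∧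
      Function.RightInverse g f

/-! ### The functional `F`

Integrals over `S = Γ \ ℍ²` of functions on `S` are integrals over a fundamental domain `D`. -/

/-- `F(f) = ∫_S tr(b) ω_h`, for a map with values in the hyperbolic plane. -/
def energyH2 (D : Set ℍ) (f : ℍ → ℍ) : ℝ := ∫ p in D, traceRoot p (pullH2 f p)

/-- `F(f) = ∫_S tr(b) ω_h`, for a map with values in hyperbolic 3-space. -/
def energyH3 (D : Set ℍ) (f : ℍ → H3) : ℝ := ∫ p in D, traceRoot p (pullH3 f p)

/-- Smooth `ρ`-equivariant maps `ℍ² → ℍ³`. -/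
def MapRho {Γ : Subgroup PSL(2, ℝ)} (ρ : Γ →* PSL(2, ℝ)) : Set (ℍ → H3) :=
  {f | IsSmoothH3 f ∧ ∀ (γ : Γ) (p : ℍ), f ((γ : PSL(2, ℝ)) • p) = ρ γ • f p}

/-- `f` realizes the minimum of `F` among the smooth `ρ`-equivariant maps `ℍ² → ℍ³`. -/
def IsMinimizing {Γ : Subgroup PSL(2, ℝ)} (D : Set ℍ) (ρ : Γ →* PSL(2, ℝ)) (f : ℍ → H3) : Prop :=
  f ∈ MapRho ρ ∧ ∀ g ∈ MapRho ρ, energyH3 D f ≤ energyH3 D g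

/-- The map `S → S'` with lift `f` is a critical point of `F` on the smooth maps `S → S'`, where
`S = Γ \ ℍ²` and `S' = Γ' \ ℍ²`. -/
def IsCritical (Γ Γ' : Subgroup PSL(2, ℝ)) (D : Set ℍ) (f : ℍ → ℍ) : Prop :=
  ∀ ε > 0, ∀ u : ℝ → ℍ → ℍ, IsSmoothFamilyH2 ε u →
    (∀ t ∈ Set.Ioo (-ε) ε, Descends Γ Γ' (u t)) → u 0 = f →
    HasDerivAt (fun t => energyH2 D (u t)) 0 0

/-! ### Minimal Lagrangian maps -/

/-- The area of the map `S → S × S'` with lift `(u, v)`, for the product metric. -/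
def areaProd (D : Set ℍ) (u v : ℍ → ℍ) : ℝ := ∫ p in D, areaDensity p (pullH2 u p + pullH2 v p)

/-- The graph of the map `S → S'` with lift `f` is a minimal surface in `S × S'`: the immersion
`p ↦ (p, f p)` is a critical point of the area, for all smooth variations. -/
def IsMinimalGraph (Γ Γ' : Subgroup PSL(2, ℝ)) (D : Set ℍ) (f : ℍ → ℍ) : Prop :=
  ∀ ε > 0, ∀ u v : ℝ → ℍ → ℍ, IsSmoothFamilyH2 ε u → IsSmoothFamilyH2 ε v →
    (∀ t ∈ Set.Ioo (-ε) ε, Descends Γ Γ (u t) ∧ Descends Γ Γ' (v t)) →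
    u 0 = id → v 0 = f → HasDerivAt (fun t => areaProd D (u t) (v t)) 0 0

/-- `f` is the lift of a minimal Lagrangian map `S → S'`: an area-preserving diffeomorphism whose
graph is minimal. -/
def IsMinimalLagrangian (Γ Γ' : Subgroup PSL(2, ℝ)) (D : Set ℍ) (f : ℍ → ℍ) : Prop :=
  IsLiftOfDiffeo Γ Γ' f ∧ (∀ p, areaDensity p (pullH2 f p) = 1) ∧ IsMinimalGraph Γ Γ' D f

end MinLag

end

/-!
In orthonormal frames the differential of a map `f` of the hyperbolic plane is `h ↦ α h + β h̄`, with
`α = al`, `β = be`, its singular values are `||α| ± |β||`, and `tr b = 2 max |α| |β|`. A local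
diffeomorphism has `|α| ≠ |β|` everywhere, so after a reflection of the target `|α| > |β|`
(`exists_pos`), and then `F(f) = 2 ∫ |α|` is differentiable along every variation of `f`. Its first
variation at a variation with velocity `X` is `2 ∫ Re (el · σ̄ X)` (`hasDerivAt_energyH2`), where
`σ = α / |α|` is the rotation in the polar decomposition `df = σ b` and `el` compares the connection
that `σ` pulls back from the target with that of the source. Both parts of the theorem follow from
the equivalence of `el = 0` with each of the properties in question.

*Minimal, or critical, implies `el = 0`.* Since `el` has all the symmetries of `f`, there is an
equivariant variation with velocity `σ · conj el` (`exists_el_variation`), and along it the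
derivative of `F` is `2 ∫ |el| ^ 2`. Hence `el = 0` (`el_eq_zero_of_integral`).

*`el = 0` and minimal Lagrangian maps.* If `el = 0`, the rotation `σ` intertwines the two
connections. Comparing their curvatures gives `|α| ^ 2 - |β| ^ 2 = 1`, so that `f` preserves areas
(`det_eq_one`), and the symmetry of the second derivatives of `f` becomes the Codazzi equation for
`b` (`codazzi`). For any `f` with `|α| ^ 2 - |β| ^ 2 = 1`, the area of the graph of `f` varies like
`F` as far as the component in the target is concerned, plus a term which is linear in the variation
of the source (`hasDerivAt_areaProd`); by the Codazzi equation the latter is the integral of a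
divergence (`integral_source_eq_zero`). So `el = 0` makes the graph minimal, and a minimal graph has
`el = 0` by the variation above.

*`el = 0` implies minimizing.* Let `g` be another map with the same equivariance. The inverse
exponential map gives an equivariant vector field `X` along `f` which points to `g` (`logField`).
The pointwise inequality `calibration` bounds `|α_f|` plus the first variation density at `X` by
`max |α_g| |β_g|`; integration gives `F(f) ≤ F(g)` (`energyH2_le`), without any assumption on the
Jacobian of `g`. A map to hyperbolic 3-space is first replaced by its nearest-point projection to
the invariant plane, which does not increase `F` (`pullH3_eq`, `energyH2_proj_le`).

Two global facts connect maps of the half-plane and maps of surfaces: an equivariant local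
diffeomorphism has local sections over balls of a uniform radius, so it lifts paths and is bijective
(`IsSurfaceGroup.bijective`), and the lift of a map of surfaces is equivariant because an isometry in
a discrete group acting freely cannot vary continuously (`IsSurfaceGroup.exists_const`). Integrals
over the surface are written as integrals over the half-plane against a cutoff function whose
translates sum to one (`IsCutoff`); this gives Stokes' theorem for equivariant fields
(`IsCutoff.integral_div_eq_zero`) and differentiation under the integral sign.
-/


open UpperHalfPlane MeasureTheory
open scoped ContDiff MatrixGroups ComplexConjugate

noncomputable section

namespace MinLag

/-! ### Wirtinger calculus -/

/-- The open upper half-plane, as a subset of `ℂ`. -/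
def U : Set ℂ := {w : ℂ | 0 < w.im}

lemma isOpen_U : IsOpen U := isOpen_lt continuous_const Complex.continuous_im

lemma coe_mem_U (p : ℍ) : (p : ℂ) ∈ U := p.im_pos

lemma coe_ofComplex {w : ℂ} (hw : w ∈ U) : (ofComplex w : ℂ) = w := by
  rw [ofComplex_apply_of_im_pos hw]

lemma U_mem_nhds {w : ℂ} (hw : w ∈ U) : U ∈ nhds w := isOpen_U.mem_nhds hw

/-- The real-linear map `h ↦ a h + b h̄`. -/
def wirt (a b : ℂ) : ℂ →L[ℝ] ℂ :=
  a • (ContinuousLinearMap.id ℝ ℂ) + b • (Complex.conjCLE : ℂ →L[ℝ] ℂ)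

@[simp] lemma wirt_apply (a b h : ℂ) : wirt a b h = a * h + b * conj h := by
  simp [wirt]

/-- `F` is real-differentiable at `w`, with `∂F = a` and `∂̄F = b`. -/
def HasWirt (F : ℂ → ℂ) (a b w : ℂ) : Prop := HasFDerivAt F (wirt a b) w

/-- The Wirtinger derivative `∂F`. -/
def dz (F : ℂ → ℂ) (w : ℂ) : ℂ := (fderiv ℝ F w 1 - Complex.I * fderiv ℝ F w Complex.I) / 2

/-- The Wirtinger derivative `∂̄F`. -/
def dzb (F : ℂ → ℂ) (w : ℂ) : ℂ := (fderiv ℝ F w 1 + Complex.I * fderiv ℝ F w Complex.I) / 2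

lemma ofReal_im_eq (z : ℂ) : ((z.im : ℝ) : ℂ) = (z - conj z) / (2 * Complex.I) := by
  rw [Complex.sub_conj]
  field_simp
  push_cast; ring

lemma ofReal_re_eq (z : ℂ) : ((z.re : ℝ) : ℂ) = (z + conj z) / 2 := by
  rw [Complex.add_conj]
  push_cast; ring

lemma clm_eq_wirt (L : ℂ →L[ℝ] ℂ) :
    L = wirt ((L 1 - Complex.I * L Complex.I) / 2) ((L 1 + Complex.I * L Complex.I) / 2) := by
  refine ContinuousLinearMap.ext fun x => ?_
  have hx : L x = x.re * L 1 + x.im * L Complex.I := by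
    conv_lhs => rw [show x = x.re • (1 : ℂ) + x.im • Complex.I by apply Complex.ext <;> simp]
    rw [map_add, map_smul, map_smul]
    simp
  rw [hx, wirt_apply, ofReal_re_eq, ofReal_im_eq]
  field_simp
  linear_combination ((x - conj x) * L Complex.I) * Complex.I_mul_I

lemma wirt_inj {a b a' b' : ℂ} (h : wirt a b = wirt a' b') : a = a' ∧ b = b' := by
  have h1 := congrArg (fun L : ℂ →L[ℝ] ℂ => L 1) h
  have h2 := congrArg (fun L : ℂ →L[ℝ] ℂ => L Complex.I) h
  simp at h1 h2
  have h3 : a - b = a' - b' := by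
    have := Complex.I_ne_zero
    refine mul_right_cancel₀ this ?_
    linear_combination h2
  constructor
  · linear_combination (h1 + h3) / 2
  · linear_combination (h1 - h3) / 2

lemma fderiv_eq_wirt (F : ℂ → ℂ) (w : ℂ) : fderiv ℝ F w = wirt (dz F w) (dzb F w) :=
  clm_eq_wirt _

lemma hasWirt_of_differentiableAt {F : ℂ → ℂ} {w : ℂ} (h : DifferentiableAt ℝ F w) :
    HasWirt F (dz F w) (dzb F w) w := by
  rw [HasWirt, ← fderiv_eq_wirt]
  exact h.hasFDerivAt

lemma HasWirt.dz_eq {F : ℂ → ℂ} {a b w : ℂ} (h : HasWirt F a b w) : dz F w = a := by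
  have := HasFDerivAt.fderiv h
  rw [fderiv_eq_wirt] at this
  exact (wirt_inj this).1

lemma HasWirt.dzb_eq {F : ℂ → ℂ} {a b w : ℂ} (h : HasWirt F a b w) : dzb F w = b := by
  have := HasFDerivAt.fderiv h
  rw [fderiv_eq_wirt] at this
  exact (wirt_inj this).2

lemma HasWirt.congr_deriv {F : ℂ → ℂ} {a b a' b' w : ℂ} (h : HasWirt F a b w) (ha : a = a')
    (hb : b = b') : HasWirt F a' b' w := by
  subst ha hb; exact h

lemma HasWirt.congr_of_eventuallyEq {F G : ℂ → ℂ} {a b w : ℂ} (h : HasWirt F a b w)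
    (hG : G =ᶠ[nhds w] F) : HasWirt G a b w := HasFDerivAt.congr_of_eventuallyEq h hG

lemma HasWirt.differentiableAt {F : ℂ → ℂ} {a b w : ℂ} (h : HasWirt F a b w) :
    DifferentiableAt ℝ F w := HasFDerivAt.differentiableAt h

lemma hasWirt_const (c w : ℂ) : HasWirt (fun _ => c) 0 0 w := by
  have : wirt 0 0 = 0 := by ext; simp
  rw [HasWirt, this]
  exact hasFDerivAt_const c w

lemma hasWirt_id (w : ℂ) : HasWirt (fun w => w) 1 0 w := by
  have : wirt 1 0 = ContinuousLinearMap.id ℝ ℂ := by ext; simp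
  rw [HasWirt, this]
  exact hasFDerivAt_id w

lemma HasWirt.add {F G : ℂ → ℂ} {a b c d w : ℂ} (hF : HasWirt F a b w) (hG : HasWirt G c d w) :
    HasWirt (fun w => F w + G w) (a + c) (b + d) w := by
  have : wirt (a + c) (b + d) = wirt a b + wirt c d := by ext; simp; ring
  rw [HasWirt, this]
  exact HasFDerivAt.add hF hG

lemma HasWirt.sub {F G : ℂ → ℂ} {a b c d w : ℂ} (hF : HasWirt F a b w) (hG : HasWirt G c d w) :
    HasWirt (fun w => F w - G w) (a - c) (b - d) w := by
  have : wirt (a - c) (b - d) = wirt a b - wirt c d := by ext; simp; ring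
  rw [HasWirt, this]
  exact HasFDerivAt.sub hF hG

lemma HasWirt.mul {F G : ℂ → ℂ} {a b c d w : ℂ} (hF : HasWirt F a b w) (hG : HasWirt G c d w) :
    HasWirt (fun w => F w * G w) (a * G w + F w * c) (b * G w + F w * d) w := by
  have : wirt (a * G w + F w * c) (b * G w + F w * d) = F w • wirt c d + G w • wirt a b := by
    ext; simp; ring
  rw [HasWirt, this]
  exact HasFDerivAt.mul hF hG

lemma HasWirt.conj {F : ℂ → ℂ} {a b w : ℂ} (hF : HasWirt F a b w) :
    HasWirt (fun w => conj (F w)) (conj b) (conj a) w := by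
  have : wirt (conj b) (conj a) = (Complex.conjCLE : ℂ →L[ℝ] ℂ).comp (wirt a b) := by
    ext; simp; ring
  rw [HasWirt, this]
  exact (Complex.conjCLE : ℂ →L[ℝ] ℂ).hasFDerivAt.comp w hF

/-- Chain rule for a holomorphic function after a real-differentiable one. -/
lemma HasWirt.holo_comp {F g : ℂ → ℂ} {a b w g' : ℂ} (hg : HasDerivAt g g' (F w))
    (hF : HasWirt F a b w) : HasWirt (fun w => g (F w)) (g' * a) (g' * b) w := by
  have h := (hg.hasFDerivAt.restrictScalars ℝ).comp w hF
  refine HasFDerivAt.congr_fderiv h ?_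
  ext; simp; ring

/-- Chain rule for a real-differentiable function after a holomorphic one. -/
lemma HasWirt.comp_holo {F g : ℂ → ℂ} {a b w g' : ℂ} (hF : HasWirt F a b (g w))
    (hg : HasDerivAt g g' w) : HasWirt (fun w => F (g w)) (a * g') (b * conj g') w := by
  have h := HasFDerivAt.comp w hF (hg.hasFDerivAt.restrictScalars ℝ)
  refine HasFDerivAt.congr_fderiv h ?_
  ext; simp; ring

lemma HasWirt.inv {F : ℂ → ℂ} {a b w : ℂ} (hF : HasWirt F a b w) (h0 : F w ≠ 0) :
    HasWirt (fun w => (F w)⁻¹) (-a / F w ^ 2) (-b / F w ^ 2) w := by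
  refine (HasWirt.holo_comp (hasDerivAt_inv h0) hF).congr_deriv ?_ ?_ <;> field_simp

lemma HasWirt.div {F G : ℂ → ℂ} {a b c d w : ℂ} (hF : HasWirt F a b w) (hG : HasWirt G c d w)
    (h0 : G w ≠ 0) : HasWirt (fun w => F w / G w) ((a * G w - F w * c) / G w ^ 2)
      ((b * G w - F w * d) / G w ^ 2) w := by
  simp only [div_eq_mul_inv (F _)]
  refine (hF.mul (hG.inv h0)).congr_deriv ?_ ?_ <;> field_simp <;> ring

lemma HasWirt.const_mul {F : ℂ → ℂ} {a b w : ℂ} (c : ℂ) (hF : HasWirt F a b w) :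
    HasWirt (fun w => c * F w) (c * a) (c * b) w :=
  ((hasWirt_const c w).mul hF).congr_deriv (by ring) (by ring)

lemma HasWirt.neg {F : ℂ → ℂ} {a b w : ℂ} (hF : HasWirt F a b w) :
    HasWirt (fun w => -F w) (-a) (-b) w := by
  simpa using hF.const_mul (-1)

lemma HasWirt.im {F : ℂ → ℂ} {a b w : ℂ} (hF : HasWirt F a b w) :
    HasWirt (fun w => ((F w).im : ℂ)) ((a - conj b) / (2 * Complex.I))
      ((b - conj a) / (2 * Complex.I)) w := by
  simp only [ofReal_im_eq]
  refine ((hF.sub hF.conj).const_mul (1 / (2 * Complex.I))).congr_deriv ?_ ?_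
      |>.congr_of_eventuallyEq
    (Filter.Eventually.of_forall fun z => ?_)
  · ring
  · ring
  · dsimp only; ring

/-- Chain rule for a real function of the real part. -/
lemma HasWirt.comp_re {F : ℂ → ℂ} {a b w : ℂ} {S : ℝ → ℝ} {S' : ℝ} (hF : HasWirt F a b w)
    (hS : HasDerivAt S S' (F w).re) :
    HasWirt (fun w => (S (F w).re : ℂ)) (S' * ((a + conj b) / 2)) (S' * ((b + conj a) / 2)) w := by
  have h1 : HasFDerivAt (fun w => (F w).re) (Complex.reCLM.comp (wirt a b)) w :=
    Complex.reCLM.hasFDerivAt.comp w hF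
  have h2 := Complex.ofRealCLM.hasFDerivAt.comp w (hS.hasFDerivAt.comp w h1)
  refine HasFDerivAt.congr_fderiv h2 ?_
  refine ContinuousLinearMap.ext fun h => ?_
  simp only [ContinuousLinearMap.comp_apply, wirt_apply, Complex.reCLM_apply,
    Complex.ofRealCLM_apply, ContinuousLinearMap.toSpanSingleton_apply, smul_eq_mul]
  rw [Complex.ofReal_mul, ofReal_re_eq]
  simp only [map_add, map_mul, Complex.conj_conj]
  ring

lemma hasWirt_im (w : ℂ) :
    HasWirt (fun w => (w.im : ℂ)) (-Complex.I / 2) (Complex.I / 2) w := by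
  refine (hasWirt_id w).im.congr_deriv ?_ ?_
  · field_simp; simp
  · field_simp; simp

lemma contDiffOn_dz {F : ℂ → ℂ} {s : Set ℂ} {m n : WithTop ℕ∞} (hs : IsOpen s)
    (hF : ContDiffOn ℝ n F s) (hmn : m + 1 ≤ n) : ContDiffOn ℝ m (dz F) s := by
  have h := hF.fderiv_of_isOpen hs hmn
  have h1 := h.clm_apply (contDiffOn_const (c := (1 : ℂ)))
  have h2 := h.clm_apply (contDiffOn_const (c := Complex.I))
  exact (h1.sub (contDiffOn_const.mul h2)).div_const 2

lemma contDiffOn_dzb {F : ℂ → ℂ} {s : Set ℂ} {m n : WithTop ℕ∞} (hs : IsOpen s)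
    (hF : ContDiffOn ℝ n F s) (hmn : m + 1 ≤ n) : ContDiffOn ℝ m (dzb F) s := by
  have h := hF.fderiv_of_isOpen hs hmn
  have h1 := h.clm_apply (contDiffOn_const (c := (1 : ℂ)))
  have h2 := h.clm_apply (contDiffOn_const (c := Complex.I))
  exact (h1.add (contDiffOn_const.mul h2)).div_const 2

lemma dz_congr {F G : ℂ → ℂ} {w : ℂ} (h : F =ᶠ[nhds w] G) : dz F w = dz G w := by
  simp only [dz, h.fderiv_eq]

lemma dzb_congr {F G : ℂ → ℂ} {w : ℂ} (h : F =ᶠ[nhds w] G) : dzb F w = dzb G w := by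
  simp only [dzb, h.fderiv_eq]

/-- `∂` and `∂̄` commute. -/
lemma dz_dzb_comm {F : ℂ → ℂ} {w : ℂ} (hF : ContDiffAt ℝ 2 F w) :
    dz (dzb F) w = dzb (dz F) w := by
  have hs : IsSymmSndFDerivAt ℝ F w := hF.isSymmSndFDerivAt (by simp)
  have hd : DifferentiableAt ℝ (fderiv ℝ F) w :=
    (hF.fderiv_right (m := 1) (by norm_num)).differentiableAt (by norm_num)
  have key : ∀ v, HasFDerivAt (fun z => fderiv ℝ F z v)
      ((fderiv ℝ (fderiv ℝ F) w).flip v) w := fun v => by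
    have := hd.hasFDerivAt.clm_apply (hasFDerivAt_const v w)
    refine this.congr_fderiv ?_
    ext; simp
  have h1 : HasFDerivAt (dzb F) ((1 / 2 : ℂ) • ((fderiv ℝ (fderiv ℝ F) w).flip 1 +
      Complex.I • (fderiv ℝ (fderiv ℝ F) w).flip Complex.I)) w := by
    refine (((key 1).add ((key Complex.I).const_mul Complex.I)).const_mul
        (1 / 2 : ℂ)).congr_of_eventuallyEq
      (Filter.Eventually.of_forall fun z => ?_)
    simp only [dzb]; simp; ring
  have h2 : HasFDerivAt (dz F) ((1 / 2 : ℂ) • ((fderiv ℝ (fderiv ℝ F) w).flip 1 -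
      Complex.I • (fderiv ℝ (fderiv ℝ F) w).flip Complex.I)) w := by
    refine (((key 1).sub ((key Complex.I).const_mul Complex.I)).const_mul
        (1 / 2 : ℂ)).congr_of_eventuallyEq
      (Filter.Eventually.of_forall fun z => ?_)
    simp only [dz]; simp; ring
  rw [dz, h1.fderiv, dzb, h2.fderiv]
  have := hs 1 Complex.I
  simp only [one_div, smul_apply, add_apply,
    sub_apply, ContinuousLinearMap.flip_apply, smul_eq_mul, this]
  ring

/-! ### Möbius transformations -/

/-- The denominator `c w + d` of the Möbius transformation given by `g`. -/
def den (g : SL(2, ℝ)) (w : ℂ) : ℂ := (g 1 0 : ℂ) * w + (g 1 1 : ℂ)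

/-- The unit complex number `g'(w) / |g'(w)|`. -/
def rot (g : SL(2, ℝ)) (w : ℂ) : ℂ := conj (den g w) / den g w

lemma coe_smul_eq (g : SL(2, ℝ)) (p : ℍ) :
    ((g • p : ℍ) : ℂ) = ((g 0 0 : ℂ) * p + (g 0 1 : ℂ)) / den g p := by
  rw [UpperHalfPlane.coe_specialLinearGroup_apply]
  simp [den]

lemma det_eq (g : SL(2, ℝ)) : (g 0 0 : ℂ) * (g 1 1 : ℂ) - (g 0 1 : ℂ) * (g 1 0 : ℂ) = 1 := by
  have h := Matrix.SpecialLinearGroup.det_coe g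
  rw [Matrix.det_fin_two] at h
  exact_mod_cast h

lemma den_ne_zero (g : SL(2, ℝ)) {w : ℂ} (hw : w ∈ U) : den g w ≠ 0 := by
  intro h
  have him := congrArg Complex.im h
  have hre := congrArg Complex.re h
  have hy : 0 < w.im := hw
  simp [den] at him hre
  rcases him with h0 | h0
  · have := det_eq g
    rw [h0] at hre
    simp at hre
    rw [h0, hre] at this
    simp at this
  · exact hy.ne' h0

lemma im_smul_eq (g : SL(2, ℝ)) (p : ℍ) :
    (((g • p : ℍ) : ℂ).im : ℂ) = (p : ℂ).im / (den g p * conj (den g p)) := by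
  have hd := den_ne_zero g (coe_mem_U p)
  have hd' : conj (den g p) ≠ 0 := by simpa using hd
  have hdet := det_eq g
  rw [ofReal_im_eq, ofReal_im_eq, coe_smul_eq, map_div₀]
  field_simp
  simp only [den, map_add, map_mul, Complex.conj_ofReal]
  linear_combination ((p : ℂ) - conj (p : ℂ)) * hdet

lemma rot_mul_conj (g : SL(2, ℝ)) {w : ℂ} (hw : w ∈ U) : rot g w * conj (rot g w) = 1 := by
  have hd := den_ne_zero g hw
  have hd' : conj (den g w) ≠ 0 := by simpa using hd
  simp only [rot, map_div₀, Complex.conj_conj]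
  field_simp

lemma norm_rot (g : SL(2, ℝ)) {w : ℂ} (hw : w ∈ U) : ‖rot g w‖ = 1 := by
  have hd := den_ne_zero g hw
  rw [rot, norm_div, Complex.norm_conj, div_self (by simpa using hd)]

lemma hasDerivAt_smul (g : SL(2, ℝ)) {w : ℂ} (hw : w ∈ U) :
    HasDerivAt (fun w : ℂ => ((g • ofComplex w : ℍ) : ℂ)) (1 / den g w ^ 2) w := by
  have hd := den_ne_zero g hw
  have h1 : HasDerivAt (fun w : ℂ => ((g 0 0 : ℂ) * w + (g 0 1 : ℂ)) / den g w)
      (1 / den g w ^ 2) w := by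
    have hn : HasDerivAt (fun w : ℂ => (g 0 0 : ℂ) * w + (g 0 1 : ℂ)) (g 0 0 : ℂ) w := by
      simpa using ((hasDerivAt_id w).const_mul (g 0 0 : ℂ)).add_const (g 0 1 : ℂ)
    have hdn : HasDerivAt (den g) (g 1 0 : ℂ) w := by
      exact (((hasDerivAt_id w).const_mul (g 1 0 : ℂ)).add_const (g 1 1 : ℂ)).congr_deriv
          (mul_one _)
    refine (hn.div hdn hd).congr_deriv ?_
    congr 1
    simp only [den]
    linear_combination det_eq g
  refine h1.congr_of_eventuallyEq ?_
  filter_upwards [U_mem_nhds hw] with z hz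
  rw [coe_smul_eq, coe_ofComplex hz]

lemma contDiffOn_div {E : Type*} [NormedAddCommGroup E] [NormedSpace ℝ E] {n : WithTop ℕ∞}
    {F G : E → ℂ} {s : Set E} (hF : ContDiffOn ℝ n F s) (hG : ContDiffOn ℝ n G s)
    (h0 : ∀ w ∈ s, G w ≠ 0) : ContDiffOn ℝ n (fun w => F w / G w) s := by
  simp only [div_eq_mul_inv]
  exact hF.mul (hG.inv h0)

lemma contDiffOn_smul (g : SL(2, ℝ)) :
    ContDiffOn ℝ ∞ (fun w : ℂ => ((g • ofComplex w : ℍ) : ℂ)) U := by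
  have hd : ContDiff ℝ ∞ (den g) := (contDiff_const.mul contDiff_id).add contDiff_const
  have hn : ContDiff ℝ ∞ (fun w : ℂ => (g 0 0 : ℂ) * w + (g 0 1 : ℂ)) :=
    (contDiff_const.mul contDiff_id).add contDiff_const
  refine (contDiffOn_div hn.contDiffOn hd.contDiffOn fun w hw =>
      den_ne_zero g hw).congr fun w hw => ?_
  rw [coe_smul_eq, coe_ofComplex hw]

lemma exists_rep (γ : PSL(2, ℝ)) : ∃ g : SL(2, ℝ), (g : PSL(2, ℝ)) = γ :=
  QuotientGroup.mk_surjective γ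

instance : ContinuousConstSMul PSL(2, ℝ) ℍ :=
  ⟨fun γ => by obtain ⟨g, rfl⟩ := exists_rep γ; exact continuous_const_smul g⟩

instance : SMulInvariantMeasure PSL(2, ℝ) ℍ volume :=
  ⟨fun γ s hs => by
    obtain ⟨g, rfl⟩ := exists_rep γ
    exact SMulInvariantMeasure.measure_preimage_smul (g : GL (Fin 2) ℝ) hs⟩

instance (Γ : Subgroup PSL(2, ℝ)) : SMulInvariantMeasure Γ ℍ volume :=
  ⟨fun γ _ hs => SMulInvariantMeasure.measure_preimage_smul (γ : PSL(2, ℝ)) hs⟩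

lemma IsSurfaceGroup.countable {Γ : Subgroup PSL(2, ℝ)} (hΓ : IsSurfaceGroup Γ) :
    Countable Γ := by
  have hc : (Γ : Set PSL(2, ℝ)).Countable := by
    refine Set.Countable.mono ?_ (Set.countable_iUnion fun n =>
      (hΓ.properlyDiscontinuous {UpperHalfPlane.I} (compactCovering ℍ n) isCompact_singleton
        (isCompact_compactCovering ℍ n)).countable)
    intro γ hγ
    obtain ⟨n, hn⟩ := exists_mem_compactCovering (γ • UpperHalfPlane.I)
    exact Set.mem_iUnion.2 ⟨n, hγ, _, ⟨_, rfl, rfl⟩, hn⟩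
  exact hc.to_subtype

/-! ### Integration over a closed surface -/

/-- Unfolding: the integral over the plane is the integral over a fundamental domain of the sum
over the group. -/
lemma integral_eq_setIntegral_tsum {Γ : Subgroup PSL(2, ℝ)} [Countable Γ] {D : Set ℍ}
    (hD : IsFundamentalDomain Γ D (volume : Measure ℍ)) {h : ℍ → ℝ} (hint : Integrable h) :
    ∫ p, h p = ∫ p in D, ∑' γ : Γ, h (γ • p) := by
  rw [hD.integral_eq_tsum'' h hint]
  have hi : ∀ γ : Γ, Integrable (fun p => h (γ • p)) (volume.restrict D) := fun γ =>
    ((measurePreserving_smul γ (volume : Measure ℍ)).integrable_comp_of_integrable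
        hint).integrableOn
  refine integral_tsum_of_summable_integral_norm hi ?_
  have hfin : ∑' γ : Γ, ∫⁻ p in D, ‖h (γ • p)‖ₑ ≠ ⊤ := by
    rw [← hD.lintegral_eq_tsum'' (fun p => ‖h p‖ₑ)]
    exact hint.2.ne
  refine (ENNReal.summable_toReal hfin).congr fun γ => ?_
  rw [integral_norm_eq_lintegral_enorm (hi γ).1]

/-- A smooth function `φ` on the plane, with compact support in the open upper half-plane, whose
translates under `Γ` form a partition of unity. -/
structure IsCutoff (Γ : Subgroup PSL(2, ℝ)) (φ : ℂ → ℝ) : Prop where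
  smooth : ContDiff ℝ ∞ φ
  compact : HasCompactSupport φ
  supp : tsupport φ ⊆ U
  nonneg : ∀ w, 0 ≤ φ w
  sum : ∀ p : ℍ, ∑' γ : Γ, φ ((γ • p : ℍ) : ℂ) = 1

/-- Near a given point only finitely many translates meet a compact set. This makes sums over `Γ`
of translates of compactly supported functions locally finite. -/
lemma IsSurfaceGroup.locally_finite {Γ : Subgroup PSL(2, ℝ)} (hΓ : IsSurfaceGroup Γ) {K : Set ℂ}
    (hK : IsCompact K) (hKU : K ⊆ U) (p : ℍ) :
    ∃ N ∈ nhds p, ∃ s : Finset Γ, ∀ γ ∉ s, ∀ q ∈ N, ((γ • q : ℍ) : ℂ) ∉ K := by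
  obtain ⟨N, hN, hp⟩ := exists_compact_mem_nhds p
  have hK' : IsCompact (UpperHalfPlane.coe ⁻¹' K) :=
    isOpenEmbedding_coe.isInducing.isCompact_preimage' (f := UpperHalfPlane.coe) hK
      (by rw [range_coe]; exact hKU)
  have hf := hΓ.properlyDiscontinuous N _ hN hK'
  refine ⟨N, hp, (hf.preimage (f := ((↑) : Γ → PSL(2, ℝ))) Subtype.val_injective.injOn).toFinset,
      ?_⟩
  intro γ hγ q hq hmem
  apply hγ
  rw [Set.Finite.mem_toFinset]
  exact ⟨γ.2, _, ⟨q, hq, rfl⟩, hmem⟩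

lemma ofComplex_tendsto {w : ℂ} (hw : w ∈ U) :
    Filter.Tendsto ofComplex (nhds w) (nhds (ofComplex w)) := by
  rw [isOpenEmbedding_coe.isInducing.tendsto_nhds_iff, coe_ofComplex hw]
  refine Filter.Tendsto.congr' ?_ Filter.tendsto_id
  filter_upwards [U_mem_nhds hw] with z hz
  exact (coe_ofComplex hz).symm

lemma contDiffOn_comp_smul {φ : ℂ → ℝ} (hφ : ContDiff ℝ ∞ φ) (g : PSL(2, ℝ)) :
    ContDiffOn ℝ ∞ (fun w : ℂ => φ ((g • ofComplex w : ℍ) : ℂ)) U := by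
  obtain ⟨g, rfl⟩ := exists_rep g
  exact hφ.comp_contDiffOn (contDiffOn_smul g)

/-- A locally finite sum of translates of a compactly supported function coincides near each
point with a finite sum. -/
lemma IsSurfaceGroup.exists_finset_tsum {Γ : Subgroup PSL(2, ℝ)} (hΓ : IsSurfaceGroup Γ)
    {φ : ℂ → ℝ} (hc : HasCompactSupport φ) (hs : tsupport φ ⊆ U) {w : ℂ} (hw : w ∈ U) :
    ∃ s : Finset Γ, (∀ᶠ z in nhds w, ∀ γ ∉ s, φ ((γ • ofComplex z : ℍ) : ℂ) = 0) ∧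
      (fun z => ∑' γ : Γ, φ ((γ • ofComplex z : ℍ) : ℂ)) =ᶠ[nhds w]
        fun z => ∑ γ ∈ s, φ ((γ • ofComplex z : ℍ) : ℂ) := by
  obtain ⟨N, hN, s, h⟩ := hΓ.locally_finite hc.isCompact hs (ofComplex w)
  have h0 : ∀ᶠ z in nhds w, ∀ γ ∉ s, φ ((γ • ofComplex z : ℍ) : ℂ) = 0 := by
    filter_upwards [ofComplex_tendsto hw hN] with z hz γ hγ
    exact image_eq_zero_of_notMem_tsupport (h γ hγ _ hz)
  refine ⟨s, h0, ?_⟩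
  filter_upwards [h0] with z hz
  exact tsum_eq_sum fun γ hγ => hz γ hγ

/-- A bump function which is positive on a compact set meeting all orbits, divided by the sum of
its translates. -/
lemma IsSurfaceGroup.exists_isCutoff {Γ : Subgroup PSL(2, ℝ)} (hΓ : IsSurfaceGroup Γ) :
    ∃ φ : ℂ → ℝ, IsCutoff Γ φ := by
  obtain ⟨K, hK, hKΓ⟩ := hΓ.cocompact
  obtain ⟨L, hL, hKL, hLU⟩ := exists_compact_between (hK.image UpperHalfPlane.continuous_coe)
    isOpen_U (by rintro _ ⟨p, -, rfl⟩; exact coe_mem_U p)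
  obtain ⟨φ, hsupp, hsm, hr⟩ :=
    (isOpen_interior (s := L)).exists_contDiff_support_eq (n := ⊤)
  have hnn : ∀ w, 0 ≤ φ w := fun w => (hr ⟨w, rfl⟩).1
  have hts : tsupport φ ⊆ L := by
    rw [tsupport, hsupp]
    exact closure_minimal interior_subset hL.isClosed
  have hc : HasCompactSupport φ := hL.of_isClosed_subset (isClosed_tsupport φ) hts
  have htU : tsupport φ ⊆ U := hts.trans hLU
  have hpos : ∀ p ∈ K, 0 < φ (p : ℂ) := fun p hp => by
    have : (p : ℂ) ∈ Function.support φ := by rw [hsupp]; exact hKL ⟨p, hp, rfl⟩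
    exact lt_of_le_of_ne (hnn _) (Ne.symm this)
  let ψ : ℍ → ℝ := fun p => ∑' γ : Γ, φ ((γ • p : ℍ) : ℂ)
  have hsumm : ∀ p : ℍ, Summable fun γ : Γ => φ ((γ • p : ℍ) : ℂ) := fun p => by
    obtain ⟨s, hs, -⟩ := hΓ.exists_finset_tsum hc htU (coe_mem_U p)
    have := hs.self_of_nhds
    rw [ofComplex_apply] at this
    exact summable_of_ne_finset_zero this
  have hψpos : ∀ p, 0 < ψ p := fun p => by
    obtain ⟨γ, hγ, hp⟩ := hKΓ p
    exact (hsumm p).tsum_pos (fun _ => hnn _) ⟨γ, hγ⟩ (hpos _ hp)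
  have hψinv : ∀ (γ : Γ) p, ψ (γ • p) = ψ p := fun γ p => by
    simp only [ψ, smul_smul]
    exact (Equiv.mulRight γ).tsum_eq fun k : Γ => φ ((k • p : ℍ) : ℂ)
  have hψsm : ∀ w ∈ U, ContDiffAt ℝ ∞ (fun w => ψ (ofComplex w)) w := fun w hw => by
    obtain ⟨s, -, hs⟩ := hΓ.exists_finset_tsum hc htU hw
    refine ContDiffAt.congr_of_eventuallyEq ?_ hs
    exact ContDiffAt.sum fun γ _ => (contDiffOn_comp_smul hsm (γ : PSL(2, ℝ))).contDiffAt
      (U_mem_nhds hw)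
  have hsub : tsupport (fun w => φ w / ψ (ofComplex w)) ⊆ tsupport φ := by
    refine closure_mono fun w hw h0 => hw ?_
    simp [h0]
  refine ⟨fun w => φ w / ψ (ofComplex w), ?_, ?_, hsub.trans htU, ?_, ?_⟩
  · rw [contDiff_iff_contDiffAt]
    intro w
    by_cases hw : w ∈ tsupport φ
    · exact hsm.contDiffAt.div (hψsm w (htU hw)) (hψpos _).ne'
    · have : (fun w => φ w / ψ (ofComplex w)) =ᶠ[nhds w] fun _ => 0 := by
        filter_upwards [(isClosed_tsupport φ).isOpen_compl.mem_nhds hw] with z hz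
        rw [image_eq_zero_of_notMem_tsupport hz, zero_div]
      exact contDiffAt_const.congr_of_eventuallyEq this
  · exact hc.isCompact.of_isClosed_subset (isClosed_tsupport _) hsub
  · exact fun w => div_nonneg (hnn w) (hψpos _).le
  · intro p
    simp only [ofComplex_apply, hψinv]
    rw [tsum_div_const]
    exact div_self (hψpos p).ne'

variable {Γ : Subgroup PSL(2, ℝ)} {φ : ℂ → ℝ}

lemma IsCutoff.integrable_mul (hφ : IsCutoff Γ φ) {h : ℂ → ℝ} (hh : ContinuousOn h U) :
    Integrable (fun w => φ w * h w) := by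
  have hc : Continuous (fun w => φ w * h w) := by
    rw [continuous_iff_continuousAt]
    intro w
    by_cases hw : w ∈ tsupport φ
    · exact hφ.smooth.continuous.continuousAt.mul (hh.continuousAt (U_mem_nhds (hφ.supp hw)))
    · have : (fun w => φ w * h w) =ᶠ[nhds w] fun _ => 0 := by
        filter_upwards [(isClosed_tsupport φ).isOpen_compl.mem_nhds hw] with z hz
        rw [image_eq_zero_of_notMem_tsupport hz, zero_mul]
      exact continuousAt_const.congr this.symm
  exact hc.integrable_of_hasCompactSupport hφ.compact.mul_right

/-- The hyperbolic area measure in the coordinate of `ℂ`. -/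
lemma integral_eq_integral_U (h : ℍ → ℝ) :
    ∫ p, h p = ∫ w in U, h (ofComplex w) / w.im ^ 2 := by
  have h1 : ∫ p, h p = ∫ p, (h p / p.im ^ 2) ∂((volume : Measure ℂ).comap UpperHalfPlane.coe) := by
    rw [volume_def, integral_withDensity_eq_integral_smul]
    · refine integral_congr_ae (Filter.Eventually.of_forall fun p => ?_)
      simp only [NNReal.smul_def, smul_eq_mul]
      simp
      ring
    · refine (Continuous.measurable ?_)
      refine .pow (.div₀ continuous_const ?_ ?_) _
      · exact continuous_im.subtype_mk _
      · exact fun x ↦ NNReal.ne_iff.mp x.im_ne_zero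
  have h2 : ∀ p : ℍ, h p / p.im ^ 2 =
      (fun w : ℂ => h (ofComplex w) / w.im ^ 2) (p : ℂ) := fun p => by
    simp
  rw [h1]
  simp_rw [h2]
  rw [← measurableEmbedding_coe.integral_map (g := fun w : ℂ => h (ofComplex w) / w.im ^ 2),
    measurableEmbedding_coe.map_comap, range_coe]
  rfl

lemma continuousOn_ofComplex {h : ℍ → ℝ} (hh : Continuous h) :
    ContinuousOn (fun w => h (ofComplex w)) U := fun _ hw =>
  (hh.continuousAt.tendsto.comp (ofComplex_tendsto hw)).mono_left nhdsWithin_le_nhds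

lemma IsCutoff.integrable (hφ : IsCutoff Γ φ) {h : ℍ → ℝ} (hh : Continuous h) :
    Integrable (fun p : ℍ => φ p * h p) := by
  have hc : Continuous (fun p : ℍ => φ p * h p) :=
    (hφ.smooth.continuous.comp UpperHalfPlane.continuous_coe).mul hh
  refine hc.integrable_of_hasCompactSupport ?_
  have hK : IsCompact (UpperHalfPlane.coe ⁻¹' tsupport φ) :=
    isOpenEmbedding_coe.isInducing.isCompact_preimage' hφ.compact.isCompact
      (by rw [range_coe]; exact hφ.supp)
  refine HasCompactSupport.intro hK fun p hp => ?_
  rw [image_eq_zero_of_notMem_tsupport hp, zero_mul]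

/-- The integral over the surface of an invariant function, as an integral over the half-plane. -/
lemma IsCutoff.setIntegral_eq (hφ : IsCutoff Γ φ) [Countable Γ] {D : Set ℍ}
    (hD : IsFundamentalDomain Γ D (volume : Measure ℍ)) {h : ℍ → ℝ} (hh : Continuous h)
    (hinv : ∀ (γ : Γ) p, h (γ • p) = h p) :
    ∫ p in D, h p = ∫ w in U, φ w * (h (ofComplex w) / w.im ^ 2) := by
  have h1 := integral_eq_setIntegral_tsum hD (hφ.integrable hh)
  rw [integral_eq_integral_U] at h1
  have h2 : ∀ p, ∑' γ : Γ, φ ((γ • p : ℍ) : ℂ) * h (γ • p) = h p := fun p => by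
    simp only [hinv]
    rw [tsum_mul_right, hφ.sum, one_mul]
  simp only [h2] at h1
  rw [← h1]
  refine setIntegral_congr_fun isOpen_U.measurableSet fun w hw => ?_
  simp only [coe_ofComplex hw]
  ring

lemma IsCutoff.setIntegral_U (hφ : IsCutoff Γ φ) (h : ℂ → ℝ) :
    ∫ w in U, φ w * h w = ∫ w, φ w * h w :=
  setIntegral_eq_integral_of_forall_compl_eq_zero fun w hw => by
    rw [image_eq_zero_of_notMem_tsupport fun h' => hw (hφ.supp h'), zero_mul]

lemma IsCutoff.continuous_fderiv_apply (hφ : IsCutoff Γ φ) {X : ℂ → ℂ} (hX : ContinuousOn X U) :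
    Continuous (fun w => fderiv ℝ φ w (X w)) ∧
      HasCompactSupport (fun w => fderiv ℝ φ w (X w)) := by
  have hφ' : Continuous (fderiv ℝ φ) := hφ.smooth.continuous_fderiv (by simp)
  have h0 : ∀ w ∉ tsupport φ, fderiv ℝ φ w (X w) = 0 := fun w hw => by
    have : fderiv ℝ φ w = 0 := image_eq_zero_of_notMem_tsupport fun h' =>
      hw (tsupport_fderiv_subset ℝ h')
    simp [this]
  refine ⟨?_, HasCompactSupport.intro hφ.compact.isCompact h0⟩
  rw [continuous_iff_continuousAt]
  intro w
  by_cases hw : w ∈ tsupport φ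
  · exact hφ'.continuousAt.clm_apply (hX.continuousAt (U_mem_nhds (hφ.supp hw)))
  · have : (fun w => fderiv ℝ φ w (X w)) =ᶠ[nhds w] fun _ => 0 := by
      filter_upwards [(isClosed_tsupport φ).isOpen_compl.mem_nhds hw] with z hz using h0 z hz
    exact continuousAt_const.congr this.symm

lemma IsCutoff.integrable_fderiv_mul (hφ : IsCutoff Γ φ) {F : ℂ → ℝ} (hF : ContinuousOn F U)
    (v : ℂ) : Integrable (fun w => fderiv ℝ φ w v * F w) := by
  obtain ⟨h1, h2⟩ := hφ.continuous_fderiv_apply (X := fun w => (F w : ℂ) * v)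
    ((Complex.continuous_ofReal.comp_continuousOn hF).mul continuousOn_const)
  refine (h1.integrable_of_hasCompactSupport h2).congr (Filter.Eventually.of_forall fun w => ?_)
  have : (F w : ℂ) * v = F w • v := by simp
  simp only [this, map_smul, smul_eq_mul]
  ring

lemma IsCutoff.integral_mul_fderiv (hφ : IsCutoff Γ φ) {F : ℂ → ℝ} (hF : ContDiffOn ℝ 1 F U)
    (v : ℂ) : ∫ w, φ w * fderiv ℝ F w v = -∫ w, fderiv ℝ φ w v * F w := by
  refine integral_mul_fderiv_eq_neg_fderiv_mul_of_integrable ?_ ?_ ?_ ?_ ?_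
  · exact hφ.integrable_fderiv_mul hF.continuousOn v
  · exact hφ.integrable_mul ((hF.continuousOn_fderiv_of_isOpen isOpen_U le_rfl).clm_apply
      continuousOn_const)
  · exact hφ.integrable_mul hF.continuousOn
  · exact fun w _ => hφ.smooth.differentiable (by simp) w
  · exact fun w hw => (hF.differentiableOn one_ne_zero).differentiableAt (U_mem_nhds (hφ.supp hw))

/-- The divergence theorem on a closed surface. The vector field has components `X` in the
orthonormal frame `(y ∂ₓ, y ∂_y)`; its divergence is `y² · 2 Re ∂(X / y)`. -/
theorem IsCutoff.integral_div_eq_zero (hφ : IsCutoff Γ φ) (hΓ : IsSurfaceGroup Γ) {D : Set ℍ}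
    (hD : IsFundamentalDomain Γ D (volume : Measure ℍ)) {X : ℂ → ℂ} (hX : ContDiffOn ℝ 1 X U)
    (hinv : ∀ g : SL(2, ℝ), (g : PSL(2, ℝ)) ∈ Γ → ∀ p : ℍ,
      X ((g • p : ℍ) : ℂ) = rot g p * X p) :
    ∫ w in U, φ w * (2 * (dz (fun z => X z / z.im) w).re) = 0 := by
  have := hΓ.countable
  have him : ContDiffOn ℝ 1 (fun z : ℂ => (z.im : ℂ)) U :=
    (Complex.ofRealCLM.contDiff.comp Complex.imCLM.contDiff).contDiffOn
  have hY : ContDiffOn ℝ 1 (fun z => X z / z.im) U :=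
    contDiffOn_div hX him fun w hw => by exact_mod_cast (show 0 < w.im from hw).ne'
  set Y : ℂ → ℂ := fun z => X z / z.im with hYdef
  have hre : ContDiffOn ℝ 1 (fun z => (Y z).re) U := Complex.reCLM.contDiff.comp_contDiffOn hY
  have himY : ContDiffOn ℝ 1 (fun z => (Y z).im) U := Complex.imCLM.contDiff.comp_contDiffOn hY
  have e1 : ∀ w ∈ U, 2 * (dz Y w).re =
      fderiv ℝ (fun z => (Y z).re) w 1 + fderiv ℝ (fun z => (Y z).im) w Complex.I := fun w hw => by
    have hd := (hY.differentiableOn one_ne_zero).differentiableAt (U_mem_nhds hw)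
    have h1 : fderiv ℝ (fun z => (Y z).re) w = Complex.reCLM.comp (fderiv ℝ Y w) :=
      (Complex.reCLM.hasFDerivAt.comp w hd.hasFDerivAt).fderiv
    have h2 : fderiv ℝ (fun z => (Y z).im) w = Complex.imCLM.comp (fderiv ℝ Y w) :=
      (Complex.imCLM.hasFDerivAt.comp w hd.hasFDerivAt).fderiv
    rw [h1, h2, dz]
    simp
    ring
  have e2 : ∫ w in U, φ w * (2 * (dz Y w).re) = -∫ w, fderiv ℝ φ w (Y w) := by
    rw [setIntegral_congr_fun isOpen_U.measurableSet fun w hw => by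
      simp only [e1 w hw]; rfl]
    rw [hφ.setIntegral_U]
    simp only [mul_add]
    have i1 := hφ.integrable_mul (h := fun w => fderiv ℝ (fun z => (Y z).re) w 1)
      ((hre.continuousOn_fderiv_of_isOpen isOpen_U le_rfl).clm_apply continuousOn_const)
    have i2 := hφ.integrable_mul (h := fun w => fderiv ℝ (fun z => (Y z).im) w Complex.I)
      ((himY.continuousOn_fderiv_of_isOpen isOpen_U le_rfl).clm_apply continuousOn_const)
    have hsplit : ∀ w, fderiv ℝ φ w (Y w) =
        fderiv ℝ φ w 1 * (Y w).re + fderiv ℝ φ w Complex.I * (Y w).im := fun w => by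
      have h : Y w = (Y w).re • (1 : ℂ) + (Y w).im • Complex.I := by
        apply Complex.ext <;> simp
      conv_lhs => rw [h]
      rw [map_add, map_smul, map_smul]
      simp only [smul_eq_mul]
      ring
    rw [integral_add i1 i2, hφ.integral_mul_fderiv hre, hφ.integral_mul_fderiv himY]
    simp only [hsplit]
    rw [integral_add (hφ.integrable_fderiv_mul hre.continuousOn _)
      (hφ.integrable_fderiv_mul himY.continuousOn _)]
    ring
  rw [e2, neg_eq_zero]
  -- the integrand is `h / y²` for the function `h = dφ(y X)` on the hyperbolic plane
  let h : ℍ → ℝ := fun p => fderiv ℝ φ p (p.im * X p)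
  have hXc : ContinuousOn (fun w : ℂ => (w.im : ℂ) * X w) U := him.continuousOn.mul hX.continuousOn
  obtain ⟨c1, c2⟩ := hφ.continuous_fderiv_apply hXc
  have hint : Integrable h := by
    refine Continuous.integrable_of_hasCompactSupport (c1.comp UpperHalfPlane.continuous_coe) ?_
    have hK : IsCompact (UpperHalfPlane.coe ⁻¹' tsupport φ) :=
      isOpenEmbedding_coe.isInducing.isCompact_preimage' hφ.compact.isCompact
        (by rw [range_coe]; exact hφ.supp)
    refine HasCompactSupport.intro hK fun p hp => ?_
    have : fderiv ℝ φ p = 0 := image_eq_zero_of_notMem_tsupport fun h' =>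
      hp (tsupport_fderiv_subset ℝ h')
    simp [h, this]
  have e3 : ∫ w, fderiv ℝ φ w (Y w) = ∫ p, h p := by
    rw [integral_eq_integral_U, ← setIntegral_eq_integral_of_forall_compl_eq_zero (s := U)]
    · refine setIntegral_congr_fun isOpen_U.measurableSet fun w hw => ?_
      have hy : (w.im : ℝ) ≠ 0 := (show 0 < w.im from hw).ne'
      have hz : ((w.im : ℝ) : ℂ) * X w = (w.im ^ 2 : ℝ) • Y w := by
        have : (w.im : ℂ) ≠ 0 := by exact_mod_cast hy
        simp only [Y, Complex.real_smul]
        push_cast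
        field_simp
      simp only [h, ← UpperHalfPlane.coe_im, coe_ofComplex hw]
      rw [hz, map_smul, smul_eq_mul]
      field_simp
    · intro w hw
      have : fderiv ℝ φ w = 0 := image_eq_zero_of_notMem_tsupport fun h' =>
        hw (hφ.supp (tsupport_fderiv_subset ℝ h'))
      simp [this]
  rw [e3, integral_eq_setIntegral_tsum hD hint]
  -- `h` at `γ p` is the derivative of `φ ∘ γ` along the vector field at `p`
  have hγ : ∀ (γ : Γ) (p : ℍ), h (γ • p) =
      fderiv ℝ (fun w : ℂ => φ ((γ • ofComplex w : ℍ) : ℂ)) p (p.im * X p) := fun γ p => by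
    obtain ⟨g, hg⟩ := exists_rep (γ : PSL(2, ℝ))
    have hgΓ : (g : PSL(2, ℝ)) ∈ Γ := by rw [hg]; exact γ.2
    have hs : ∀ q : ℍ, γ • q = g • q := fun q => by
      change (γ : PSL(2, ℝ)) • q = _
      rw [← hg, mk_smul]
    simp only [hs]
    have hp := coe_mem_U p
    have hd := den_ne_zero g hp
    have hd' : conj (den g p) ≠ 0 := by simpa using hd
    have hg' := (hasDerivAt_smul g hp).hasFDerivAt.restrictScalars ℝ
    have hφ' : HasFDerivAt φ (fderiv ℝ φ ((g • ofComplex (p : ℂ) : ℍ) : ℂ))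
        ((g • ofComplex (p : ℂ) : ℍ) : ℂ) :=
      (hφ.smooth.differentiable (by simp) _).hasFDerivAt
    have hcomp := (hφ'.comp (p : ℂ) hg').fderiv
    simp only [Function.comp_def] at hcomp
    rw [hcomp]
    simp only [h, ofComplex_apply, ContinuousLinearMap.comp_apply,
      ContinuousLinearMap.coe_restrictScalars', ContinuousLinearMap.toSpanSingleton_apply,
      smul_eq_mul, hinv g hgΓ]
    congr 1
    rw [← UpperHalfPlane.coe_im, im_smul_eq, rot, UpperHalfPlane.coe_im]
    field_simp
  have hzero : ∀ p : ℍ, ∑' γ : Γ, h (γ • p) = 0 := fun p => by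
    obtain ⟨s, h0, h1⟩ := hΓ.exists_finset_tsum hφ.compact hφ.supp (coe_mem_U p)
    have hout : ∀ γ ∉ s, h (γ • p) = 0 := fun γ hγs => by
      have : (fun w : ℂ => φ ((γ • ofComplex w : ℍ) : ℂ)) =ᶠ[nhds (p : ℂ)] fun _ => 0 := by
        filter_upwards [h0] with z hz using hz γ hγs
      rw [hγ, this.fderiv_eq]
      simp
    rw [tsum_eq_sum hout]
    simp only [hγ]
    have hsum : fderiv ℝ (fun w : ℂ => ∑ γ ∈ s, φ ((γ • ofComplex w : ℍ) : ℂ)) p =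
        ∑ γ ∈ s, fderiv ℝ (fun w : ℂ => φ ((γ • ofComplex w : ℍ) : ℂ)) p :=
      fderiv_fun_sum fun γ _ => ((contDiffOn_comp_smul hφ.smooth (γ : PSL(2, ℝ))).differentiableOn
        (by simp)).differentiableAt (U_mem_nhds (coe_mem_U p))
    rw [← sum_apply, ← hsum]
    have : (fun w : ℂ => ∑ γ ∈ s, φ ((γ • ofComplex w : ℍ) : ℂ)) =ᶠ[nhds (p : ℂ)] fun _ => 1 := by
      filter_upwards [h1] with z hz
      rw [← hz, hφ.sum]
    rw [this.fderiv_eq]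
    simp
  simp [hzero]

/-! ### The differential in orthonormal frames -/

/-- A map of the hyperbolic plane as a complex function on the open upper half-plane. -/
def hat (f : ℍ → ℍ) (w : ℂ) : ℂ := f (ofComplex w)

/-- The complex-linear part of the differential of `F`, in the frames `y ∂` of the hyperbolic
plane. -/
def al (F : ℂ → ℂ) (w : ℂ) : ℂ := w.im * dz F w / (F w).im

/-- The complex-antilinear part of the differential of `F`, in the frames `y ∂` of the hyperbolic
plane. -/
def be (F : ℂ → ℂ) (w : ℂ) : ℂ := w.im * dzb F w / (F w).im

lemma hat_coe (f : ℍ → ℍ) (p : ℍ) : hat f p = f p := by simp [hat]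

lemma hat_im_pos (f : ℍ → ℍ) (w : ℂ) : 0 < (hat f w).im := (f _).im_pos

lemma hat_mem_U (f : ℍ → ℍ) (w : ℂ) : hat f w ∈ U := hat_im_pos f w

lemma hat_im_ne (f : ℍ → ℍ) (w : ℂ) : ((hat f w).im : ℂ) ≠ 0 := by
  exact_mod_cast (hat_im_pos f w).ne'

lemma im_ne {w : ℂ} (hw : w ∈ U) : (w.im : ℂ) ≠ 0 := by
  exact_mod_cast (show 0 < w.im from hw).ne'

lemma diffH2_eq (f : ℍ → ℍ) (p : ℍ) : diffH2 f p = wirt (dz (hat f) p) (dzb (hat f) p) :=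
  fderiv_eq_wirt _ _

lemma pullH2_apply (f : ℍ → ℍ) (p : ℍ) (h k : ℂ) :
    pullH2 f p h k = (diffH2 f p h * conj (diffH2 f p k)).re / (f p).im ^ 2 := by
  simp [pullH2, pullInner, innerₗ_apply_apply, Complex.inner]
  ring

lemma pullH2_symm (f : ℍ → ℍ) (p : ℍ) (h k : ℂ) : pullH2 f p h k = pullH2 f p k h := by
  rw [pullH2_apply, pullH2_apply]
  simp only [Complex.mul_re, Complex.conj_re, Complex.conj_im]
  ring

lemma pullH2_nonneg (f : ℍ → ℍ) (p : ℍ) (h : ℂ) : 0 ≤ pullH2 f p h h := by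
  rw [pullH2_apply, Complex.mul_conj, Complex.ofReal_re]
  have := Complex.normSq_nonneg (diffH2 f p h)
  positivity

/-- The pull-back of the metric in the frame `y ∂` of the source. -/
lemma pullH2_frame (f : ℍ → ℍ) (p : ℍ) (h k : ℂ) :
    pullH2 f p (p.im * h) (p.im * k) =
      ((al (hat f) p * h + be (hat f) p * conj h) *
        conj (al (hat f) p * k + be (hat f) p * conj k)).re := by
  have hv : ((f p).im : ℝ) ≠ 0 := (f p).im_pos.ne'
  have hv' : ((f p).im : ℂ) ≠ 0 := by exact_mod_cast hv
  have key : ∀ h : ℂ, diffH2 f p (p.im * h) =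
      (f p).im * (al (hat f) p * h + be (hat f) p * conj h) := fun h => by
    rw [diffH2_eq, wirt_apply]
    simp only [al, be, hat_coe, UpperHalfPlane.coe_im, map_mul, Complex.conj_ofReal]
    field_simp
  rw [pullH2_apply, key, key, map_mul, Complex.conj_ofReal]
  have : ∀ (a b : ℂ) (r : ℝ), (r * a * (r * b)).re = r ^ 2 * (a * b).re := fun a b r => by
    rw [show (r * a * (r * b) : ℂ) = ((r ^ 2 : ℝ) : ℂ) * (a * b) by push_cast; ring,
      Complex.re_ofReal_mul]
  rw [this]
  field_simp

lemma form_one_one (p : ℍ) (G : Form) (a b : ℂ) :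
    p.im ^ 2 * G a b = G (p.im * a) (p.im * b) := by
  have h1 : ∀ a : ℂ, (p.im : ℂ) * a = p.im • a := fun a => by simp
  rw [h1, h1, map_smul, map_smul, LinearMap.smul_apply, smul_eq_mul, smul_eq_mul]
  ring

/-- The trace of the root as a function of the entries of the form. -/
lemma traceRoot_eq_sqrt (p : ℍ) (G : Form) (hsymm : ∀ v w, G v w = G w v)
    (hnn : ∀ v, 0 ≤ G v v) :
    traceRoot p G = √(p.im ^ 2 * (G 1 1 + G Complex.I Complex.I +
      2 * √(G 1 1 * G Complex.I Complex.I - G 1 Complex.I * G Complex.I 1))) := by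
  obtain ⟨b, hb⟩ := exists_isRoot p G hsymm hnn
  rw [traceRoot_eq hb, hb.trace_eq_sqrt]

lemma norm_sq_eq (z : ℂ) : ‖z‖ ^ 2 = z.re ^ 2 + z.im ^ 2 := by
  rw [Complex.sq_norm, Complex.normSq_apply]; ring

/-- The singular values of `h ↦ α h + β h̄` are `|α| + |β|` and `||α| - |β||`; their sum is the
trace of `b`. -/
lemma traceRoot_pullH2 (f : ℍ → ℍ) (p : ℍ) :
    traceRoot p (pullH2 f p) = 2 * max ‖al (hat f) p‖ ‖be (hat f) p‖ := by
  have hy : 0 < p.im := p.im_pos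
  rw [traceRoot_eq_sqrt p _ (pullH2_symm f p) (pullH2_nonneg f p)]
  have e1 := form_one_one p (pullH2 f p) 1 1
  have e2 := form_one_one p (pullH2 f p) Complex.I Complex.I
  have e3 := form_one_one p (pullH2 f p) 1 Complex.I
  have e4 := form_one_one p (pullH2 f p) Complex.I 1
  rw [pullH2_frame] at e1 e2 e3 e4
  generalize al (hat f) p = α at *
  generalize be (hat f) p = β at *
  have hα := norm_sq_eq α
  have hβ := norm_sq_eq β
  have hA : pullH2 f p 1 1 = ((α.re + β.re) ^ 2 + (α.im + β.im) ^ 2) / p.im ^ 2 := by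
    rw [eq_div_iff (by positivity), mul_comm, e1]; simp; ring
  have hC : pullH2 f p Complex.I Complex.I =
      ((α.re - β.re) ^ 2 + (α.im - β.im) ^ 2) / p.im ^ 2 := by
    rw [eq_div_iff (by positivity), mul_comm, e2]; simp; ring
  have hB : pullH2 f p 1 Complex.I =
      (2 * (α.re * β.im - α.im * β.re)) / p.im ^ 2 := by
    rw [eq_div_iff (by positivity), mul_comm, e3]; simp; ring
  have hB' : pullH2 f p Complex.I 1 =
      (2 * (α.re * β.im - α.im * β.re)) / p.im ^ 2 := by
    rw [pullH2_symm, hB]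
  have hdet : pullH2 f p 1 1 * pullH2 f p Complex.I Complex.I -
      pullH2 f p 1 Complex.I * pullH2 f p Complex.I 1 =
      ((‖α‖ ^ 2 - ‖β‖ ^ 2) / p.im ^ 2) ^ 2 := by
    rw [hA, hC, hB, hB', hα, hβ]
    field_simp
    ring
  rw [hdet, Real.sqrt_sq_eq_abs, abs_div, abs_of_pos (show 0 < p.im ^ 2 by positivity)]
  have hsum : p.im ^ 2 * (pullH2 f p 1 1 + pullH2 f p Complex.I Complex.I +
      2 * (|‖α‖ ^ 2 - ‖β‖ ^ 2| / p.im ^ 2)) =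
      2 * (‖α‖ ^ 2 + ‖β‖ ^ 2) + 2 * |‖α‖ ^ 2 - ‖β‖ ^ 2| := by
    rw [hA, hC, hα, hβ]
    field_simp
    ring
  rw [hsum]
  have n1 := norm_nonneg α
  have n2 := norm_nonneg β
  rcases le_total ‖α‖ ‖β‖ with hle | hle
  · rw [max_eq_right hle, abs_of_nonpos (by nlinarith)]
    rw [show 2 * (‖α‖ ^ 2 + ‖β‖ ^ 2) + 2 * -(‖α‖ ^ 2 - ‖β‖ ^ 2) = (2 * ‖β‖) ^ 2 by ring]
    exact Real.sqrt_sq (by positivity)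
  · rw [max_eq_left hle, abs_of_nonneg (by nlinarith)]
    rw [show 2 * (‖α‖ ^ 2 + ‖β‖ ^ 2) + 2 * (‖α‖ ^ 2 - ‖β‖ ^ 2) = (2 * ‖α‖) ^ 2 by ring]
    exact Real.sqrt_sq (by positivity)

lemma areaDensity_pullH2 (f : ℍ → ℍ) (p : ℍ) :
    areaDensity p (pullH2 f p) = |‖al (hat f) p‖ ^ 2 - ‖be (hat f) p‖ ^ 2| := by
  have e := pullH2_frame f p
  have h1 : (p.im : ℂ) = p.im * 1 := by ring
  simp only [areaDensity]
  rw [← Real.sqrt_sq_eq_abs]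
  congr 1
  rw [h1, mul_assoc, one_mul, e, e, e, e, norm_sq_eq, norm_sq_eq]
  simp
  ring

lemma areaDensity_add (f g : ℍ → ℍ) (p : ℍ) :
    areaDensity p (pullH2 f p + pullH2 g p) =
      √((‖al (hat f) p‖ ^ 2 + ‖be (hat f) p‖ ^ 2 + ‖al (hat g) p‖ ^ 2 + ‖be (hat g) p‖ ^ 2) ^ 2 -
        4 * ‖conj (al (hat f) p) * be (hat f) p + conj (al (hat g) p) * be (hat g) p‖ ^ 2) := by
  have e := pullH2_frame f p
  have e' := pullH2_frame g p
  have h1 : (p.im : ℂ) = p.im * 1 := by ring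
  simp only [areaDensity]
  congr 1
  rw [h1, mul_assoc, one_mul]
  simp only [LinearMap.add_apply]
  rw [e, e, e, e, e', e', e', e']
  simp only [norm_sq_eq]
  simp
  ring

/-! ### Equivariance -/

/-- `f` is equivariant under `Γ` acting on the source, for some isometries of the target. -/
def Equivariant (Γ : Subgroup PSL(2, ℝ)) (f : ℍ → ℍ) : Prop :=
  ∀ γ : SL(2, ℝ), (γ : PSL(2, ℝ)) ∈ Γ → ∃ k : SL(2, ℝ), ∀ p, f (γ • p) = k • f p

section

variable {f : ℍ → ℍ} {γ k : SL(2, ℝ)} (hf : IsSmoothH2 f) (hk : ∀ p, f (γ • p) = k • f p)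
include hf

lemma contDiffOn_hat : ContDiffOn ℝ ∞ (hat f) U := hf

lemma hasWirt_hat {w : ℂ} (hw : w ∈ U) : HasWirt (hat f) (dz (hat f) w) (dzb (hat f) w) w :=
  hasWirt_of_differentiableAt
    (((contDiffOn_hat hf).differentiableOn (by simp)).differentiableAt (U_mem_nhds hw))

include hk

lemma dz_hat_smul (p : ℍ) : dz (hat f) ((γ • p : ℍ) : ℂ) / den γ p ^ 2 =
      dz (hat f) p / den k (f p) ^ 2 ∧
    dzb (hat f) ((γ • p : ℍ) : ℂ) / conj (den γ p) ^ 2 = dzb (hat f) p / den k (f p) ^ 2 := by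
  have hp := coe_mem_U p
  have h1 : HasWirt (hat f) _ _ ((γ • ofComplex (p : ℂ) : ℍ) : ℂ) :=
    hasWirt_hat hf (coe_mem_U _)
  have h2 := HasWirt.comp_holo (g := fun w => ((γ • ofComplex w : ℍ) : ℂ)) h1 (hasDerivAt_smul γ hp)
  have h3 := HasWirt.holo_comp (g := fun w => ((k • ofComplex w : ℍ) : ℂ))
    (hasDerivAt_smul k (hat_mem_U f p)) (hasWirt_hat hf hp)
  have he : (fun w => hat f ((γ • ofComplex w : ℍ) : ℂ)) =
      fun w => ((k • ofComplex (hat f w) : ℍ) : ℂ) := by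
    funext w
    simp [hat, hk]
  rw [he] at h2
  have i1 := h2.dz_eq.symm.trans h3.dz_eq
  have i2 := h2.dzb_eq.symm.trans h3.dzb_eq
  simp only [ofComplex_apply, hat_coe, map_div₀, map_one, map_pow] at i1 i2
  constructor
  · rw [div_eq_mul_one_div, i1]; ring
  · rw [div_eq_mul_one_div, i2]; ring

/-- If `f ∘ γ = k ∘ f`, the frame components of the differential at `γ p` and at `p` differ by the
rotations through which `γ` and `k` act on frames. -/
lemma al_smul (p : ℍ) :
    al (hat f) ((γ • p : ℍ) : ℂ) = rot k (f p) * conj (rot γ p) * al (hat f) p := by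
  have h := (dz_hat_smul hf hk p).1
  have d1 := den_ne_zero γ (coe_mem_U p)
  have d2 := den_ne_zero k (coe_mem_U (f p))
  have d1' : conj (den γ p) ≠ 0 := by simpa using d1
  have d2' : conj (den k (f p)) ≠ 0 := by simpa using d2
  have y1 := im_ne (coe_mem_U p)
  have y2 := im_ne (coe_mem_U (f p))
  rw [div_eq_iff (pow_ne_zero 2 d1)] at h
  simp only [al]
  rw [hat_coe, hk, im_smul_eq, im_smul_eq, h, hat_coe, rot, rot, map_div₀, Complex.conj_conj]
  field_simp

lemma be_smul (p : ℍ) :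
    be (hat f) ((γ • p : ℍ) : ℂ) = rot k (f p) * rot γ p * be (hat f) p := by
  have h := (dz_hat_smul hf hk p).2
  have d1 := den_ne_zero γ (coe_mem_U p)
  have d2 := den_ne_zero k (coe_mem_U (f p))
  have d1' : conj (den γ p) ≠ 0 := by simpa using d1
  have d2' : conj (den k (f p)) ≠ 0 := by simpa using d2
  have y1 := im_ne (coe_mem_U p)
  have y2 := im_ne (coe_mem_U (f p))
  rw [div_eq_iff (pow_ne_zero 2 d1')] at h
  simp only [be]
  rw [hat_coe, hk, im_smul_eq, im_smul_eq, h, hat_coe, rot, rot]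
  field_simp

lemma norm_al_smul (p : ℍ) : ‖al (hat f) ((γ • p : ℍ) : ℂ)‖ = ‖al (hat f) p‖ := by
  rw [al_smul hf hk, norm_mul, norm_mul, Complex.norm_conj, norm_rot _ (coe_mem_U _),
    norm_rot _ (coe_mem_U _), one_mul, one_mul]

lemma norm_be_smul (p : ℍ) : ‖be (hat f) ((γ • p : ℍ) : ℂ)‖ = ‖be (hat f) p‖ := by
  rw [be_smul hf hk, norm_mul, norm_mul, norm_rot _ (coe_mem_U _),
    norm_rot _ (coe_mem_U _), one_mul, one_mul]

end

lemma contDiffOn_im {F : ℂ → ℂ} {n : WithTop ℕ∞} {s : Set ℂ} (hF : ContDiffOn ℝ n F s) :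
    ContDiffOn ℝ n (fun z => ((F z).im : ℂ)) s :=
  (Complex.ofRealCLM.contDiff.comp Complex.imCLM.contDiff).comp_contDiffOn hF

lemma contDiffOn_al {f : ℍ → ℍ} (hf : IsSmoothH2 f) : ContDiffOn ℝ ∞ (al (hat f)) U :=
  contDiffOn_div ((contDiffOn_im contDiffOn_id).mul
    (contDiffOn_dz isOpen_U (contDiffOn_hat hf) (by simp))) (contDiffOn_im (contDiffOn_hat hf))
    fun w _ => hat_im_ne f w

lemma contDiffOn_be {f : ℍ → ℍ} (hf : IsSmoothH2 f) : ContDiffOn ℝ ∞ (be (hat f)) U :=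
  contDiffOn_div ((contDiffOn_im contDiffOn_id).mul
    (contDiffOn_dzb isOpen_U (contDiffOn_hat hf) (by simp))) (contDiffOn_im (contDiffOn_hat hf))
    fun w _ => hat_im_ne f w

/-! ### Differentiation under the integral sign -/

lemma IsCutoff.setIntegral_K {Γ : Subgroup PSL(2, ℝ)} {φ : ℂ → ℝ} (hφ : IsCutoff Γ φ)
    (h : ℂ → ℝ) : ∫ w in U, φ w * h w = ∫ w in tsupport φ, φ w * h w := by
  rw [hφ.setIntegral_U]
  exact (setIntegral_eq_integral_of_forall_compl_eq_zero fun w hw => by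
    rw [image_eq_zero_of_notMem_tsupport hw, zero_mul]).symm

lemma hasDerivAt_slice {E : Type*} [NormedAddCommGroup E] [NormedSpace ℝ E] {J : ℝ × ℂ → E}
    {t : ℝ} {w : ℂ} (h : DifferentiableAt ℝ J (t, w)) :
    HasDerivAt (fun s => J (s, w)) (fderiv ℝ J (t, w) (1, 0)) t := by
  have h1 : HasDerivAt (fun s : ℝ => (s, w)) ((1 : ℝ), (0 : ℂ)) t :=
    (hasDerivAt_id t).prodMk (hasDerivAt_const t w)
  exact HasFDerivAt.comp_hasDerivAt (f := fun s : ℝ => (s, w)) t h.hasFDerivAt h1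

lemma hasFDerivAt_slice {E : Type*} [NormedAddCommGroup E] [NormedSpace ℝ E] {J : ℝ × ℂ → E}
    {t : ℝ} {w : ℂ} (h : DifferentiableAt ℝ J (t, w)) :
    HasFDerivAt (fun z => J (t, z)) ((fderiv ℝ J (t, w)).comp
        (ContinuousLinearMap.inr ℝ ℝ ℂ)) w := by
  have h1 : HasFDerivAt (fun z : ℂ => (t, z)) (ContinuousLinearMap.inr ℝ ℝ ℂ) w :=
    hasFDerivAt_prodMk_right t w
  exact HasFDerivAt.comp (f := fun z : ℂ => (t, z)) w h.hasFDerivAt h1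

/-- Integrals against a cutoff function are differentiated under the integral sign. Only the
support of the cutoff has to lie in the domain of `J`. -/
lemma IsCutoff.hasDerivAt_integral {Γ : Subgroup PSL(2, ℝ)} {φ : ℂ → ℝ} (hφ : IsCutoff Γ φ)
    {J : ℝ × ℂ → ℝ} {O : Set (ℝ × ℂ)} (hO : IsOpen O) (hJ : ContDiffOn ℝ 1 J O)
    (hKO : ∀ w ∈ tsupport φ, ((0 : ℝ), w) ∈ O) :
    HasDerivAt (fun t => ∫ w in U, φ w * J (t, w))
      (∫ w in U, φ w * fderiv ℝ J (0, w) (1, 0)) 0 := by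
  simp only [hφ.setIntegral_K]
  have hK : IsCompact (tsupport φ) := hφ.compact.isCompact
  have hKm : MeasurableSet (tsupport φ) := (isClosed_tsupport φ).measurableSet
  obtain ⟨u, v, hu, -, h0u, hKv, huv⟩ := generalized_tube_lemma (isCompact_singleton (x := (0 : ℝ)))
    hK hO (by rintro ⟨t, w⟩ ⟨ht, hw⟩; rw [Set.mem_singleton_iff] at ht; subst ht; exact hKO w hw)
  obtain ⟨δ, hδ, hδu⟩ := Metric.nhds_basis_closedBall.mem_iff.1 (hu.mem_nhds (h0u rfl))
  have hsub : Metric.closedBall (0 : ℝ) δ ×ˢ tsupport φ ⊆ O :=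
    (Set.prod_mono hδu hKv).trans huv
  have hderiv : ContinuousOn (fun q => fderiv ℝ J q ((1 : ℝ), (0 : ℂ))) O :=
    (hJ.continuousOn_fderiv_of_isOpen hO le_rfl).clm_apply continuousOn_const
  have hmul : ContinuousOn (fun q : ℝ × ℂ => φ q.2 * fderiv ℝ J q ((1 : ℝ), (0 : ℂ))) O :=
    (hφ.smooth.continuous.comp continuous_snd).continuousOn.mul hderiv
  obtain ⟨C, hC⟩ := ((isCompact_closedBall (0 : ℝ) δ).prod hK).exists_bound_of_continuousOn
    (hmul.mono hsub)
  have hslice : ∀ {E : Type} [NormedAddCommGroup E] {G : ℝ × ℂ → E}, ContinuousOn G O →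
      ∀ t ∈ Metric.closedBall (0 : ℝ) δ, ContinuousOn (fun w => G (t, w)) (tsupport φ) :=
    fun hG t ht => hG.comp (Continuous.continuousOn (by fun_prop))
      fun w hw => hsub ⟨ht, hw⟩
  have hφJ : ContinuousOn (fun q : ℝ × ℂ => φ q.2 * J q) O :=
    (hφ.smooth.continuous.comp continuous_snd).continuousOn.mul hJ.continuousOn
  have h0 : (0 : ℝ) ∈ Metric.closedBall (0 : ℝ) δ := Metric.mem_closedBall_self hδ.le
  refine (hasDerivAt_integral_of_dominated_loc_of_deriv_le (μ := volume.restrict (tsupport φ))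
    (F := fun t w => φ w * J (t, w)) (F' := fun t w => φ w * fderiv ℝ J (t, w) (1, 0))
    (bound := fun _ => C) (Metric.ball_mem_nhds 0 hδ) ?_ ?_ ?_ ?_ ?_ ?_).2
  · filter_upwards [Metric.closedBall_mem_nhds (0 : ℝ) hδ] with t ht
    exact (hslice hφJ t ht).aestronglyMeasurable hKm
  · exact (hslice hφJ 0 h0).integrableOn_compact hK
  · exact (hslice hmul 0 h0).aestronglyMeasurable hKm
  · refine (ae_restrict_iff' hKm).2 (Filter.Eventually.of_forall fun w hw t ht => ?_)
    exact hC (t, w) ⟨Metric.ball_subset_closedBall ht, hw⟩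
  · exact integrableOn_const hK.measure_lt_top.ne
  · refine (ae_restrict_iff' hKm).2 (Filter.Eventually.of_forall fun w hw t ht => ?_)
    have hq : (t, w) ∈ O := hsub ⟨Metric.ball_subset_closedBall ht, hw⟩
    have hd := (hJ.differentiableOn one_ne_zero).differentiableAt (hO.mem_nhds hq)
    exact (hasDerivAt_slice hd).const_mul (φ w)

/-! ### Smooth families -/

/-- The domain of a smooth family. -/
def strip (ε : ℝ) : Set (ℝ × ℂ) := Set.Ioo (-ε) ε ×ˢ U

lemma isOpen_strip (ε : ℝ) : IsOpen (strip ε) := isOpen_Ioo.prod isOpen_U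

/-- A family of maps, as a function of the parameter and the point. -/
def hatFam (u : ℝ → ℍ → ℍ) (q : ℝ × ℂ) : ℂ := hat (u q.1) q.2

/-- The initial velocity of a family of maps. -/
def vel (u : ℝ → ℍ → ℍ) (w : ℂ) : ℂ := fderiv ℝ (hatFam u) (0, w) (1, 0)

/-- The initial velocity of a family of maps, in the frame `y ∂` of the target. -/
def velFrame (u : ℝ → ℍ → ℍ) (w : ℂ) : ℂ := vel u w / (hat (u 0) w).im

section

variable {ε : ℝ} {u : ℝ → ℍ → ℍ} (hu : IsSmoothFamilyH2 ε u)
include hu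

lemma contDiffOn_hatFam : ContDiffOn ℝ ∞ (hatFam u) (strip ε) := hu

lemma contDiffAt_hatFam {q : ℝ × ℂ} (hq : q ∈ strip ε) : ContDiffAt ℝ ∞ (hatFam u) q :=
  (contDiffOn_hatFam hu).contDiffAt ((isOpen_strip ε).mem_nhds hq)

lemma fderiv_hat_fam {q : ℝ × ℂ} (hq : q ∈ strip ε) (h : ℂ) :
    fderiv ℝ (hat (u q.1)) q.2 h = fderiv ℝ (hatFam u) q (0, h) := by
  have hd := (contDiffAt_hatFam hu hq).differentiableAt (by simp)
  have := (hasFDerivAt_slice (t := q.1) (w := q.2) hd).fderiv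
  change fderiv ℝ (fun z => hatFam u (q.1, z)) q.2 h = _
  rw [this]
  simp

lemma contDiffOn_fderiv_fam (h : ℂ) :
    ContDiffOn ℝ ∞ (fun q : ℝ × ℂ => fderiv ℝ (hat (u q.1)) q.2 h) (strip ε) := by
  have h1 := (contDiffOn_hatFam hu).fderiv_of_isOpen (isOpen_strip ε) (m := ∞) (by simp)
  refine (h1.clm_apply (contDiffOn_const (c := ((0 : ℝ), h)))).congr fun q hq => ?_
  exact fderiv_hat_fam hu hq h

lemma contDiffOn_dz_fam :
    ContDiffOn ℝ ∞ (fun q : ℝ × ℂ => dz (hat (u q.1)) q.2) (strip ε) :=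
  ((contDiffOn_fderiv_fam hu 1).sub (contDiffOn_const.mul
    (contDiffOn_fderiv_fam hu Complex.I))).div_const 2

lemma contDiffOn_dzb_fam :
    ContDiffOn ℝ ∞ (fun q : ℝ × ℂ => dzb (hat (u q.1)) q.2) (strip ε) :=
  ((contDiffOn_fderiv_fam hu 1).add (contDiffOn_const.mul
    (contDiffOn_fderiv_fam hu Complex.I))).div_const 2

omit hu in
lemma contDiffOn_cdiv {n : WithTop ℕ∞} {F : ℝ × ℂ → ℂ} {G : ℝ × ℂ → ℂ} {s : Set (ℝ × ℂ)}
    (hF : ContDiffOn ℝ n F s) (hG : ContDiffOn ℝ n G s)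
    (h0 : ∀ q ∈ s, (G q).im ≠ 0) :
    ContDiffOn ℝ n (fun q => q.2.im * F q / (G q).im) s := by
  have e : ContDiffOn ℝ n (fun q : ℝ × ℂ => (q.2.im : ℂ)) s :=
    ((Complex.ofRealCLM.contDiff.comp Complex.imCLM.contDiff).comp contDiff_snd).contDiffOn
  refine contDiffOn_div (e.mul hF)
    ((Complex.ofRealCLM.contDiff.comp Complex.imCLM.contDiff).comp_contDiffOn hG) fun q hq => ?_
  exact_mod_cast h0 q hq

lemma contDiffOn_al_fam :
    ContDiffOn ℝ ∞ (fun q : ℝ × ℂ => al (hat (u q.1)) q.2) (strip ε) :=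
  contDiffOn_cdiv (contDiffOn_dz_fam hu) (contDiffOn_hatFam hu)
    fun _ _ => (hat_im_pos _ _).ne'

lemma contDiffOn_be_fam :
    ContDiffOn ℝ ∞ (fun q : ℝ × ℂ => be (hat (u q.1)) q.2) (strip ε) :=
  contDiffOn_cdiv (contDiffOn_dzb_fam hu) (contDiffOn_hatFam hu)
    fun _ _ => (hat_im_pos _ _).ne'

lemma isSmoothH2_fam {t : ℝ} (ht : t ∈ Set.Ioo (-ε) ε) : IsSmoothH2 (u t) := by
  have h : ContDiffOn ℝ ∞ (fun w : ℂ => ((t, w) : ℝ × ℂ)) U :=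
    (contDiff_const.prodMk contDiff_id).contDiffOn
  exact (contDiffOn_hatFam hu).comp h fun w hw => ⟨ht, hw⟩

variable (hε : 0 < ε)
include hε

omit hu in
lemma zero_mem_strip {w : ℂ} (hw : w ∈ U) : ((0 : ℝ), w) ∈ strip ε :=
  ⟨⟨by simpa using hε, hε⟩, hw⟩

lemma contDiffOn_vel : ContDiffOn ℝ ∞ (vel u) U := by
  have h1 := (contDiffOn_hatFam hu).fderiv_of_isOpen (isOpen_strip ε) (m := ∞) (by simp)
  have h2 := h1.clm_apply (contDiffOn_const (c := ((1 : ℝ), (0 : ℂ))))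
  have h : ContDiffOn ℝ ∞ (fun w : ℂ => (((0 : ℝ), w) : ℝ × ℂ)) U :=
    (contDiff_const.prodMk contDiff_id).contDiffOn
  exact h2.comp h fun w hw => zero_mem_strip hε hw

lemma contDiffOn_velFrame : ContDiffOn ℝ ∞ (velFrame u) U :=
  contDiffOn_div (contDiffOn_vel hu hε) (contDiffOn_im (contDiffOn_hat (isSmoothH2_fam hu (t := 0)
    ⟨by simpa using hε, hε⟩))) fun _ _ => hat_im_ne _ _

lemma hasDerivAt_hat {w : ℂ} (hw : w ∈ U) : HasDerivAt (fun t => hat (u t) w) (vel u w) 0 :=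
  hasDerivAt_slice ((contDiffAt_hatFam hu (zero_mem_strip hε hw)).differentiableAt (by simp))

/-- Derivatives in the parameter and in the point commute. -/
lemma hasDerivAt_fderiv_hat {w : ℂ} (hw : w ∈ U) (h : ℂ) :
    HasDerivAt (fun t => fderiv ℝ (hat (u t)) w h) (fderiv ℝ (vel u) w h) 0 := by
  have hq := zero_mem_strip hε hw
  have hc : ContDiffAt ℝ 2 (hatFam u) (0, w) :=
    (contDiffAt_hatFam hu hq).of_le ENat.LEInfty.out
  have hsymm : IsSymmSndFDerivAt ℝ (hatFam u) (0, w) := hc.isSymmSndFDerivAt (by simp)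
  have hd : DifferentiableAt ℝ (fderiv ℝ (hatFam u)) (0, w) :=
    (hc.fderiv_right (m := 1) (by norm_num)).differentiableAt (by norm_num)
  have h1 := hasFDerivAt_slice hd
  have h2 := (h1.clm_apply (hasFDerivAt_const ((1 : ℝ), (0 : ℂ)) w)).fderiv
  have h3 := (hasDerivAt_slice hd).clm_apply (hasDerivAt_const (0 : ℝ) ((0 : ℝ), h))
  have hev : (fun t => fderiv ℝ (hat (u t)) w h) =ᶠ[nhds 0]
      fun t => fderiv ℝ (hatFam u) (t, w) (0, h) := by
    filter_upwards [Ioo_mem_nhds (show -ε < 0 by simpa using hε) hε] with t ht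
    exact fderiv_hat_fam hu (q := (t, w)) ⟨ht, hw⟩ h
  refine (h3.congr_of_eventuallyEq hev).congr_deriv ?_
  change _ = fderiv ℝ (fun z => fderiv ℝ (hatFam u) (0, z) (1, 0)) w h
  rw [h2]
  have := hsymm (1, 0) (0, h)
  simpa using this

lemma hasDerivAt_dz {w : ℂ} (hw : w ∈ U) :
    HasDerivAt (fun t => dz (hat (u t)) w) (dz (vel u) w) 0 :=
  ((hasDerivAt_fderiv_hat hu hε hw 1).sub
    ((hasDerivAt_fderiv_hat hu hε hw Complex.I).const_mul Complex.I)).div_const 2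

lemma hasDerivAt_dzb {w : ℂ} (hw : w ∈ U) :
    HasDerivAt (fun t => dzb (hat (u t)) w) (dzb (vel u) w) 0 :=
  ((hasDerivAt_fderiv_hat hu hε hw 1).add
    ((hasDerivAt_fderiv_hat hu hε hw Complex.I).const_mul Complex.I)).div_const 2

lemma hasWirt_velFrame {w : ℂ} (hw : w ∈ U) :
    HasWirt (velFrame u) (dz (velFrame u) w) (dzb (velFrame u) w) w :=
  hasWirt_of_differentiableAt (((contDiffOn_velFrame hu hε).differentiableOn
    (by simp)).differentiableAt (U_mem_nhds hw))

lemma dz_vel {w : ℂ} (hw : w ∈ U) :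
    dz (vel u) w = dz (velFrame u) w * (hat (u 0) w).im + velFrame u w *
      ((dz (hat (u 0)) w - conj (dzb (hat (u 0)) w)) / (2 * Complex.I)) ∧
    dzb (vel u) w = dzb (velFrame u) w * (hat (u 0) w).im + velFrame u w *
      ((dzb (hat (u 0)) w - conj (dz (hat (u 0)) w)) / (2 * Complex.I)) := by
  have h0 := isSmoothH2_fam hu (t := 0) ⟨by simpa using hε, hε⟩
  have h := (hasWirt_velFrame hu hε hw).mul (hasWirt_hat h0 hw).im
  have h' : HasWirt (vel u) _ _ w := h.congr_of_eventuallyEq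
      (Filter.Eventually.of_forall fun z => by
    have := hat_im_ne (u 0) z
    simp only [velFrame]
    field_simp)
  exact ⟨h'.dz_eq, h'.dzb_eq⟩

/-- First variation of the complex-linear part of the differential. -/
lemma hasDerivAt_al {w : ℂ} (hw : w ∈ U) :
    HasDerivAt (fun t => al (hat (u t)) w) (w.im * dz (velFrame u) w +
      (al (hat (u 0)) w * conj (velFrame u w) - conj (be (hat (u 0)) w) * velFrame u w) /
        (2 * Complex.I)) 0 := by
  have hv := hat_im_ne (u 0) w
  have him : HasDerivAt (fun t => ((hat (u t) w).im : ℂ)) ((vel u w).im : ℂ) 0 :=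
    (Complex.ofRealCLM.comp Complex.imCLM).hasFDerivAt.comp_hasDerivAt 0 (hasDerivAt_hat hu hε hw)
  refine (((hasDerivAt_dz hu hε hw).const_mul (w.im : ℂ)).div him hv).congr_deriv ?_
  have hV : vel u w = velFrame u w * (hat (u 0) w).im := by simp only [velFrame]; field_simp
  rw [(dz_vel hu hε hw).1, ofReal_im_eq (vel u w), hV]
  simp only [al, be, map_mul, map_div₀, Complex.conj_ofReal]
  field_simp
  ring

/-- First variation of the complex-antilinear part of the differential. -/
lemma hasDerivAt_be {w : ℂ} (hw : w ∈ U) :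
    HasDerivAt (fun t => be (hat (u t)) w) (w.im * dzb (velFrame u) w +
      (be (hat (u 0)) w * conj (velFrame u w) - conj (al (hat (u 0)) w) * velFrame u w) /
        (2 * Complex.I)) 0 := by
  have hv := hat_im_ne (u 0) w
  have him : HasDerivAt (fun t => ((hat (u t) w).im : ℂ)) ((vel u w).im : ℂ) 0 :=
    (Complex.ofRealCLM.comp Complex.imCLM).hasFDerivAt.comp_hasDerivAt 0 (hasDerivAt_hat hu hε hw)
  refine (((hasDerivAt_dzb hu hε hw).const_mul (w.im : ℂ)).div him hv).congr_deriv ?_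
  have hV : vel u w = velFrame u w * (hat (u 0) w).im := by simp only [velFrame]; field_simp
  rw [(dz_vel hu hε hw).2, ofReal_im_eq (vel u w), hV]
  simp only [al, be, map_mul, map_div₀, Complex.conj_ofReal]
  field_simp
  ring

end

/-! ### The Euler–Lagrange operator -/

/-- The rotation part of the differential of a map with `|∂F| > |∂̄F|`: in orthonormal frames
`dF = σ ∘ b` with `σ` the multiplication by `nn F`. -/
def nn (F : ℂ → ℂ) (w : ℂ) : ℂ := al F w / ‖al F w‖

/-- The Euler–Lagrange operator of the functional `F` on orientation preserving maps. It measures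
the difference between the Levi-Civita connection of the source and the connection pulled back
from the target by the rotation part of the differential. -/
def el (F : ℂ → ℂ) (w : ℂ) : ℂ :=
  ((w - conj w) * conj (nn F w) * dz (nn F) w + 1 - al F w - conj (be F w)) / (2 * Complex.I)

lemma two_I_im (w : ℂ) : w - conj w = 2 * Complex.I * w.im := by
  rw [ofReal_im_eq]; field_simp

/-- The differential of `f` preserves orientation everywhere. -/
def Pos (f : ℍ → ℍ) : Prop := ∀ w ∈ U, ‖be (hat f) w‖ < ‖al (hat f) w‖

lemma Pos.norm_al_pos {f : ℍ → ℍ} (h : Pos f) {w : ℂ} (hw : w ∈ U) : 0 < ‖al (hat f) w‖ :=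
  (norm_nonneg _).trans_lt (h w hw)

lemma Pos.al_ne {f : ℍ → ℍ} (h : Pos f) {w : ℂ} (hw : w ∈ U) : al (hat f) w ≠ 0 :=
  norm_pos_iff.1 (h.norm_al_pos hw)

lemma Pos.norm_al_ne {f : ℍ → ℍ} (h : Pos f) {w : ℂ} (hw : w ∈ U) :
    ((‖al (hat f) w‖ : ℝ) : ℂ) ≠ 0 := by exact_mod_cast (h.norm_al_pos hw).ne'

lemma Pos.nn_mul_conj {f : ℍ → ℍ} (h : Pos f) {w : ℂ} (hw : w ∈ U) :
    nn (hat f) w * conj (nn (hat f) w) = 1 := by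
  have h0 := h.norm_al_ne hw
  rw [nn, map_div₀, Complex.conj_ofReal, div_mul_div_comm, Complex.mul_conj,
    Complex.normSq_eq_norm_sq]
  push_cast
  field_simp

lemma Pos.nn_ne {f : ℍ → ℍ} (h : Pos f) {w : ℂ} (hw : w ∈ U) : nn (hat f) w ≠ 0 :=
  left_ne_zero_of_mul_eq_one (h.nn_mul_conj hw)

lemma Pos.al_eq {f : ℍ → ℍ} (h : Pos f) {w : ℂ} (hw : w ∈ U) :
    al (hat f) w = ‖al (hat f) w‖ * nn (hat f) w := by
  have h0 := h.norm_al_ne hw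
  rw [nn]; field_simp

lemma Pos.conj_nn_mul_al {f : ℍ → ℍ} (h : Pos f) {w : ℂ} (hw : w ∈ U) :
    conj (nn (hat f) w) * al (hat f) w = ‖al (hat f) w‖ := by
  have h1 := h.nn_mul_conj hw
  have h2 := h.al_eq hw
  generalize al (hat f) w = a at *
  linear_combination conj (nn (hat f) w) * h2 + (‖a‖ : ℂ) * h1

lemma contDiffOn_norm {n : WithTop ℕ∞} {E : Type*} [NormedAddCommGroup E] [NormedSpace ℝ E]
    {F : E → ℂ} {s : Set E} (hF : ContDiffOn ℝ n F s) (h0 : ∀ w ∈ s, F w ≠ 0) :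
    ContDiffOn ℝ n (fun w => ‖F w‖) s := hF.norm ℝ h0

section

variable {f : ℍ → ℍ} (hf : IsSmoothH2 f) (hpos : Pos f)
include hf hpos

lemma contDiffOn_nn : ContDiffOn ℝ ∞ (nn (hat f)) U :=
  contDiffOn_div (contDiffOn_al hf) (Complex.ofRealCLM.contDiff.comp_contDiffOn
    (contDiffOn_norm (contDiffOn_al hf) fun _ hw => hpos.al_ne hw)) fun _ hw => hpos.norm_al_ne hw

lemma hasWirt_nn {w : ℂ} (hw : w ∈ U) :
    HasWirt (nn (hat f)) (dz (nn (hat f)) w) (dzb (nn (hat f)) w) w :=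
  hasWirt_of_differentiableAt (((contDiffOn_nn hf hpos).differentiableOn
    (by simp)).differentiableAt (U_mem_nhds hw))

/-- The derivative of a unit complex function is tangent to the circle. -/
lemma nn_deriv {w : ℂ} (hw : w ∈ U) :
    dz (nn (hat f)) w * conj (nn (hat f) w) + nn (hat f) w * conj (dzb (nn (hat f)) w) = 0 := by
  have h := hasWirt_nn hf hpos hw
  have h1 : HasWirt (fun w => nn (hat f) w * conj (nn (hat f) w)) _ _ w := h.mul h.conj
  have h2 : HasWirt (fun w => nn (hat f) w * conj (nn (hat f) w)) 0 0 w :=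
    (hasWirt_const 1 w).congr_of_eventuallyEq (by
      filter_upwards [U_mem_nhds hw] with z hz using hpos.nn_mul_conj hz)
  exact h1.dz_eq.symm.trans h2.dz_eq

lemma contDiffOn_el : ContDiffOn ℝ ∞ (el (hat f)) U := by
  have hc : ContDiff ℝ ∞ (fun z : ℂ => conj z) := Complex.conjCLE.contDiff
  have h1 := contDiffOn_nn hf hpos
  have h2 := contDiffOn_dz isOpen_U h1 (m := ∞) (by simp)
  exact ((((((contDiff_id.sub hc).contDiffOn.mul (hc.comp_contDiffOn h1)).mul h2).add
    contDiffOn_const).sub (contDiffOn_al hf)).sub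
    (hc.comp_contDiffOn (contDiffOn_be hf))).div_const _

variable {γ k : SL(2, ℝ)} (hk : ∀ p, f (γ • p) = k • f p)
include hk

omit hpos in
lemma nn_smul (p : ℍ) :
    nn (hat f) ((γ • p : ℍ) : ℂ) = rot k (f p) * conj (rot γ p) * nn (hat f) p := by
  rw [nn, nn, norm_al_smul hf hk, al_smul hf hk, mul_div_assoc]

/-- The Euler–Lagrange operator transforms like a `(1, 0)`-form on the source. This is where the
connection terms in its definition are needed: the derivative of `nn` alone is not covariant. -/
lemma el_smul (p : ℍ) :
    el (hat f) ((γ • p : ℍ) : ℂ) = conj (rot γ p) * el (hat f) p := by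
  have hp := coe_mem_U p
  have d1 := den_ne_zero γ hp
  have d2 := den_ne_zero k (coe_mem_U (f p))
  have d1' : conj (den γ p) ≠ 0 := by simpa using d1
  have d2' : conj (den k (f p)) ≠ 0 := by simpa using d2
  -- the Wirtinger derivative of `nn` at `γ p`, by differentiating the transformation law
  have hden : ∀ (g : SL(2, ℝ)) {F : ℂ → ℂ} {a b w : ℂ}, HasWirt F a b w →
      HasWirt (fun w => den g (F w)) (g 1 0 * a) (g 1 0 * b) w := fun g F a b w h =>
    ((h.const_mul (g 1 0 : ℂ)).add (hasWirt_const _ w)).congr_deriv (by ring) (by ring)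
  have hF := hasWirt_hat hf hp
  have w1 := hden k hF
  have w2 := hden γ (hasWirt_id (p : ℂ))
  have w3 := ((w1.conj.div w1 (by rw [hat_coe]; exact d2)).mul (w2.div w2.conj d1')).mul
    (hasWirt_nn hf hpos hp)
  have w4 := HasWirt.comp_holo (g := fun w => ((γ • ofComplex w : ℍ) : ℂ))
    (hasWirt_nn hf hpos (coe_mem_U _)) (hasDerivAt_smul γ hp)
  have w5 := w4.congr_of_eventuallyEq (G := fun w => conj (den k (hat f w)) / den k (hat f w) *
    (den γ w / conj (den γ w)) * nn (hat f) w) (by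
      filter_upwards [U_mem_nhds hp] with z hz
      rw [nn_smul hf hk, coe_ofComplex hz]
      simp [rot, hat])
  have e := w3.dz_eq.symm.trans w5.dz_eq
  simp only [ofComplex_apply, hat_coe] at e
  have hY : (p : ℂ) - conj (p : ℂ) ≠ 0 := by
    rw [two_I_im]
    exact mul_ne_zero (by simp) (im_ne hp)
  have hV : (f p : ℂ) - conj (f p : ℂ) ≠ 0 := by
    rw [two_I_im]
    exact mul_ne_zero (by simp) (im_ne (coe_mem_U _))
  -- everything is expressed through `Y = w - w̄`, `V = F - F̄` and the denominators
  have hγden : (γ 1 0 : ℂ) = (den γ p - conj (den γ p)) / ((p : ℂ) - conj (p : ℂ)) := by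
    rw [eq_div_iff hY]
    simp only [den, map_add, map_mul, Complex.conj_ofReal]; ring
  have hkden : (k 1 0 : ℂ) = (den k (f p) - conj (den k (f p))) / ((f p : ℂ) - conj (f p : ℂ)) := by
    rw [eq_div_iff hV]
    simp only [den, map_add, map_mul, Complex.conj_ofReal]; ring
  have hyγ : ((γ • p : ℍ) : ℂ) - conj ((γ • p : ℍ) : ℂ) =
      ((p : ℂ) - conj (p : ℂ)) / (den γ p * conj (den γ p)) := by
    rw [two_I_im, two_I_im, im_smul_eq]; ring
  have hal : dz (hat f) p = al (hat f) p *
      ((f p : ℂ) - conj (f p : ℂ)) / ((p : ℂ) - conj (p : ℂ)) := by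
    have h1 := im_ne hp
    have h2 := im_ne (coe_mem_U (f p))
    rw [two_I_im, two_I_im, al, hat_coe]; field_simp
  have hbe : conj (dzb (hat f) p) =
      conj (be (hat f) p) * ((f p : ℂ) - conj (f p : ℂ)) / ((p : ℂ) - conj (p : ℂ)) := by
    have h1 := im_ne hp
    have h2 := im_ne (coe_mem_U (f p))
    rw [two_I_im, two_I_im, be, hat_coe]
    simp only [map_div₀, map_mul, Complex.conj_ofReal]
    field_simp
  have hN := hpos.nn_mul_conj hp
  have hN0 := hpos.nn_ne hp
  have hNc : conj (nn (hat f) p) = 1 / nn (hat f) p := by field_simp; rw [mul_comm]; exact hN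
  have hden0 : (1 : ℂ) / den γ p ^ 2 ≠ 0 := one_div_ne_zero (pow_ne_zero 2 d1)
  have e' : dz (nn (hat f)) ((γ • p : ℍ) : ℂ) = _ / (1 / den γ p ^ 2) :=
    eq_div_of_mul_eq hden0 e.symm
  rw [el, el, al_smul hf hk, be_smul hf hk, nn_smul hf hk, e', hyγ]
  simp only [map_mul, rot, map_div₀, Complex.conj_conj, hal, map_zero, hbe, Complex.conj_ofReal,
    mul_zero, mul_one]
  rw [hNc, hγden, hkden]
  generalize conj (be (hat f) p) = B
  generalize al (hat f) p = A
  generalize nn (hat f) p = N at hN0 ⊢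
  generalize dz (nn (hat f)) (p : ℂ) = DN
  generalize (p : ℂ) - conj (p : ℂ) = Y at hY ⊢
  generalize (f p : ℂ) - conj (f p : ℂ) = V at hV ⊢
  generalize conj (den γ p) = dc at d1' ⊢
  generalize den γ p = d at d1 ⊢
  generalize conj (den k (f p)) = dc₂ at d2' ⊢
  generalize den k (f p) = d₂ at d2 ⊢
  field_simp
  ring

end

/-! ### First variation of the functional -/

lemma hasDerivAt_norm {z : ℝ → ℂ} {z' : ℂ} {t : ℝ} (h : HasDerivAt z z' t) (h0 : z t ≠ 0) :
    HasDerivAt (fun s => ‖z s‖) ((conj (z t / ‖z t‖) * z').re) t := by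
  have h1 := h.norm_sq.sqrt (by simpa using h0)
  have h2 : (fun s => √(‖z s‖ ^ 2)) = fun s => ‖z s‖ := by
    funext s; exact Real.sqrt_sq (norm_nonneg _)
  rw [h2] at h1
  refine h1.congr_deriv ?_
  rw [Real.sqrt_sq (norm_nonneg _), Complex.inner, map_div₀, Complex.conj_ofReal,
      div_mul_eq_mul_div,
    Complex.div_ofReal_re, mul_comm z']
  have : ‖z t‖ ≠ 0 := by simpa using h0
  field_simp

lemma inv_two_I : (1 : ℂ) / (2 * Complex.I) = -Complex.I / 2 := by
  field_simp; simp

lemma div_two_I (z : ℂ) : z / (2 * Complex.I) = z * (-Complex.I / 2) := by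
  rw [← inv_two_I]; ring

lemma re_mul_I_eq_zero (a : ℝ) (z : ℂ) : (a * (z + conj z) * (-Complex.I / 2)).re = 0 := by
  simp

lemma el_eq (F : ℂ → ℂ) (w : ℂ) : el F w =
    w.im * conj (nn F w) * dz (nn F) w + (1 - al F w - conj (be F w)) * (-Complex.I / 2) := by
  rw [el, two_I_im, ← inv_two_I]
  field_simp
  ring

/-- The divergence of a vector field given in the frame `y ∂`. -/
lemma hasWirt_div_im {X : ℂ → ℂ} {a b w : ℂ} (hX : HasWirt X a b w) (hw : w ∈ U) :
    dz (fun z => X z / z.im) w = (a * w.im + X w * (Complex.I / 2)) / w.im ^ 2 := by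
  have h := (hX.div (hasWirt_im w) (im_ne hw)).dz_eq
  rw [h]
  ring

section

variable {f : ℍ → ℍ} (hf : IsSmoothH2 f) (hpos : Pos f)
include hf hpos

/-- The first variation of `|∂f|` is a divergence plus the pairing with the Euler–Lagrange
operator. -/
lemma first_variation_pointwise {W : ℂ → ℂ} {a b w : ℂ} (hW : HasWirt W a b w) (hw : w ∈ U) :
    (conj (nn (hat f) w) * (w.im * a + (al (hat f) w * conj (W w) - conj (be (hat f) w) * W w) /
        (2 * Complex.I))).re =
      w.im ^ 2 * (dz (fun z => conj (nn (hat f) z) * W z / z.im) w).re +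
        (el (hat f) w * (conj (nn (hat f) w) * W w)).re := by
  have hy := im_ne hw
  have hX := (hasWirt_nn hf hpos hw).conj.mul hW
  have hn := hpos.nn_mul_conj hw
  have hn' := nn_deriv hf hpos hw
  have hα := hpos.conj_nn_mul_al hw
  have e1 : w.im ^ 2 * (dz (fun z => conj (nn (hat f) z) * W z / z.im) w).re =
      ((w.im : ℂ) ^ 2 * dz (fun z => conj (nn (hat f) z) * W z / z.im) w).re := by
    rw [← Complex.ofReal_pow, Complex.re_ofReal_mul]
  have e2 := re_mul_I_eq_zero ‖al (hat f) w‖ (W w)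
  rw [e1, hasWirt_div_im hX hw, mul_div_cancel₀ _ (pow_ne_zero 2 hy), ← Complex.add_re, el_eq,
    div_two_I, ← add_zero (Complex.re (_ + _)), ← e2, ← Complex.add_re]
  congr 1
  linear_combination (-(w.im : ℂ) * W w * conj (nn (hat f) w)) * hn' +
    ((w.im : ℂ) * W w * conj (dzb (nn (hat f)) w)) * hn +
    (-Complex.I / 2 * (conj (W w) + W w)) * hα

end

/-- A family of maps, equivariant under `Γ` for isometries of the target which do not depend on the
parameter. -/
def EquivariantFam (Γ : Subgroup PSL(2, ℝ)) (ε : ℝ) (u : ℝ → ℍ → ℍ) : Prop :=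
  ∀ γ : SL(2, ℝ), (γ : PSL(2, ℝ)) ∈ Γ → ∃ k : SL(2, ℝ), ∀ t ∈ Set.Ioo (-ε) ε, ∀ p,
    u t (γ • p) = k • u t p

lemma velFrame_smul {ε : ℝ} {u : ℝ → ℍ → ℍ} (hu : IsSmoothFamilyH2 ε u) (hε : 0 < ε)
    {γ k : SL(2, ℝ)} (hk : ∀ t ∈ Set.Ioo (-ε) ε, ∀ p, u t (γ • p) = k • u t p) (p : ℍ) :
    velFrame u ((γ • p : ℍ) : ℂ) = rot k (u 0 p) * velFrame u p := by
  have h0 : (0 : ℝ) ∈ Set.Ioo (-ε) ε := ⟨by simpa using hε, hε⟩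
  have h1 := hasDerivAt_hat hu hε (coe_mem_U (γ • p))
  have h2 := hasDerivAt_hat hu hε (coe_mem_U p)
  have h3 := ((hasDerivAt_smul k (hat_mem_U (u 0) p)).hasFDerivAt.restrictScalars ℝ).comp_hasDerivAt
    (0 : ℝ) h2
  have h4 : (fun t => hat (u t) ((γ • p : ℍ) : ℂ)) =ᶠ[nhds 0]
      (fun w : ℂ => ((k • ofComplex w : ℍ) : ℂ)) ∘ fun t => hat (u t) p := by
    filter_upwards [isOpen_Ioo.mem_nhds h0] with t ht
    simp [hat, hk t ht]
  have h5 := (h1.congr_of_eventuallyEq h4.symm).unique h3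
  simp only [ContinuousLinearMap.coe_restrictScalars', ContinuousLinearMap.toSpanSingleton_apply,
    smul_eq_mul, hat_coe] at h5
  have hd := den_ne_zero k (coe_mem_U (u 0 p))
  have hd' : conj (den k (u 0 p)) ≠ 0 := by simpa using hd
  have hv := im_ne (coe_mem_U (u 0 p))
  rw [velFrame, velFrame, h5, hat_coe, hat_coe, hk 0 h0, im_smul_eq, rot]
  field_simp

section

variable {Γ : Subgroup PSL(2, ℝ)} (hΓ : IsSurfaceGroup Γ) {D : Set ℍ}
  (hD : IsFundamentalDomain Γ D (volume : Measure ℍ)) {φ : ℂ → ℝ} (hφ : IsCutoff Γ φ)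

include hΓ hD hφ

lemma energyH2_eq {f : ℍ → ℍ} (hf : IsSmoothH2 f) (he : Equivariant Γ f) :
    energyH2 D f =
      ∫ w in U, φ w * (2 * max ‖al (hat f) w‖ ‖be (hat f) w‖ / w.im ^ 2) := by
  have := hΓ.countable
  rw [energyH2]
  simp only [traceRoot_pullH2]
  rw [hφ.setIntegral_eq hD (h := fun p : ℍ => 2 * max ‖al (hat f) p‖ ‖be (hat f) p‖)]
  · refine setIntegral_congr_fun isOpen_U.measurableSet fun w hw => ?_
    simp only [coe_ofComplex hw]
  · have h1 := (contDiffOn_al hf).continuousOn.comp_continuous UpperHalfPlane.continuous_coe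
      coe_mem_U
    have h2 := (contDiffOn_be hf).continuousOn.comp_continuous UpperHalfPlane.continuous_coe
        coe_mem_U
    exact continuous_const.mul (h1.norm.max h2.norm)
  · intro γ p
    obtain ⟨g, hg⟩ := exists_rep (γ : PSL(2, ℝ))
    obtain ⟨k, hk⟩ := he g (by rw [hg]; exact γ.2)
    have hs : γ • p = g • p := by
      change (γ : PSL(2, ℝ)) • p = _
      rw [← hg, mk_smul]
    rw [hs, norm_al_smul hf hk, norm_be_smul hf hk]

/-- The integrated pairing of the Euler–Lagrange operator with a variation, plus a divergence, is
the integral of the pairing. -/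
lemma integral_first_variation {f : ℍ → ℍ} (hf : IsSmoothH2 f) (hpos : Pos f)
    {W : ℂ → ℂ} (hW : ContDiffOn ℝ 1 W U) (hWinv : ∀ γ : SL(2, ℝ), (γ : PSL(2, ℝ)) ∈ Γ →
      ∃ k : SL(2, ℝ), (∀ p, f (γ • p) = k • f p) ∧
        ∀ p : ℍ, W ((γ • p : ℍ) : ℂ) = rot k (f p) * W p) :
    ∫ w in U, φ w * (2 * (conj (nn (hat f) w) * (w.im * dz W w +
        (al (hat f) w * conj (W w) - conj (be (hat f) w) * W w) / (2 * Complex.I))).re /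
          w.im ^ 2) =
      ∫ w in U, φ w * (2 * (el (hat f) w * (conj (nn (hat f) w) * W w)).re / w.im ^ 2) := by
  have hc : ContDiff ℝ ∞ (fun z : ℂ => conj z) := Complex.conjCLE.contDiff
  have hX : ContDiffOn ℝ 1 (fun z => conj (nn (hat f) z) * W z) U :=
    ((hc.comp_contDiffOn (contDiffOn_nn hf hpos)).of_le ENat.LEInfty.out).mul hW
  have hdiv := hφ.integral_div_eq_zero hΓ hD hX fun γ hγ p => by
    obtain ⟨k, hk, hWk⟩ := hWinv γ hγ
    have := rot_mul_conj k (coe_mem_U (f p))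
    rw [nn_smul hf hk, hWk]
    simp only [map_mul, Complex.conj_conj]
    linear_combination (rot γ p * conj (nn (hat f) p) * W p) * this
  have hY : ContDiffOn ℝ 1 (fun z => conj (nn (hat f) z) * W z / z.im) U :=
    contDiffOn_div hX (contDiffOn_im contDiffOn_id) fun w hw => im_ne hw
  have i1 := hφ.integrable_mul (h := fun w =>
      2 * (dz (fun z => conj (nn (hat f) z) * W z / z.im) w).re)
    (continuousOn_const.mul (Complex.continuous_re.comp_continuousOn
      (contDiffOn_dz isOpen_U hY (m := 0) (by simp)).continuousOn))
  have i2 := hφ.integrable_mul (h := fun w =>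
      2 * (el (hat f) w * (conj (nn (hat f) w) * W w)).re / w.im ^ 2)
    ((continuousOn_const.mul (Complex.continuous_re.comp_continuousOn
      ((contDiffOn_el hf hpos).continuousOn.mul hX.continuousOn))).div
        (Complex.continuous_im.pow 2).continuousOn fun w hw =>
          pow_ne_zero 2 (show 0 < w.im from hw).ne')
  rw [← add_zero (∫ w in U, φ w * (2 * (el (hat f) w * (conj (nn (hat f) w) * W w)).re / w.im ^ 2)),
    ← hdiv, ← integral_add i2.integrableOn i1.integrableOn]
  refine setIntegral_congr_fun isOpen_U.measurableSet fun w hw => ?_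
  have hd := hasWirt_of_differentiableAt
    ((hW.differentiableOn one_ne_zero).differentiableAt (U_mem_nhds hw))
  have hy : w.im ≠ 0 := (show 0 < w.im from hw).ne'
  simp only [first_variation_pointwise hf hpos hd hw]
  field_simp
  ring

/-- First variation of the functional at an orientation preserving local diffeomorphism. -/
theorem hasDerivAt_energyH2 {ε : ℝ} (hε : 0 < ε) {u : ℝ → ℍ → ℍ} (hu : IsSmoothFamilyH2 ε u)
    (he : EquivariantFam Γ ε u) (hpos : Pos (u 0)) :
    HasDerivAt (fun t => energyH2 D (u t))
      (∫ w in U, φ w * (2 * (el (hat (u 0)) w * (conj (nn (hat (u 0)) w) * velFrame u w)).re /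
        w.im ^ 2)) 0 := by
  have h0 : (0 : ℝ) ∈ Set.Ioo (-ε) ε := ⟨by simpa using hε, hε⟩
  let J : ℝ × ℂ → ℝ := fun q =>
    2 * max ‖al (hat (u q.1)) q.2‖ ‖be (hat (u q.1)) q.2‖ / q.2.im ^ 2
  let O : Set (ℝ × ℂ) := strip ε ∩ {q | 0 < ‖al (hat (u q.1)) q.2‖ - ‖be (hat (u q.1)) q.2‖}
  have hcont : ContinuousOn (fun q : ℝ × ℂ => ‖al (hat (u q.1)) q.2‖ - ‖be (hat (u q.1)) q.2‖)
      (strip ε) := (contDiffOn_al_fam hu).continuousOn.norm.sub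
          (contDiffOn_be_fam hu).continuousOn.norm
  have hO : IsOpen O := hcont.isOpen_inter_preimage (isOpen_strip ε) isOpen_Ioi
  have halne : ∀ q ∈ O, al (hat (u q.1)) q.2 ≠ 0 := fun q hq => by
    have h : 0 < ‖al (hat (u q.1)) q.2‖ - ‖be (hat (u q.1)) q.2‖ := hq.2
    exact norm_pos_iff.1 ((norm_nonneg _).trans_lt (sub_pos.1 h))
  have hJeq : ∀ q ∈ O, J q = 2 * ‖al (hat (u q.1)) q.2‖ / q.2.im ^ 2 := fun q hq => by
    have h : 0 < ‖al (hat (u q.1)) q.2‖ - ‖be (hat (u q.1)) q.2‖ := hq.2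
    simp only [J]
    rw [max_eq_left (sub_pos.1 h).le]
  have hJ : ContDiffOn ℝ 1 J O := by
    have h1 := contDiffOn_norm ((contDiffOn_al_fam hu).mono (Set.inter_subset_left (t := _))) halne
    have h2 : ContDiffOn ℝ ∞ (fun q : ℝ × ℂ => 2 * ‖al (hat (u q.1)) q.2‖ / q.2.im ^ 2) O :=
      (contDiffOn_const.mul h1).div ((Complex.imCLM.contDiff.comp contDiff_snd).pow 2).contDiffOn
        fun q hq => pow_ne_zero 2 (show 0 < q.2.im from hq.1.2).ne'
    exact (h2.congr hJeq).of_le ENat.LEInfty.out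
  have hmem : ∀ w ∈ U, ((0 : ℝ), w) ∈ O := fun w hw =>
    ⟨zero_mem_strip hε hw, sub_pos.2 (hpos w hw)⟩
  have hmain := hφ.hasDerivAt_integral hO hJ fun w hw => hmem w (hφ.supp hw)
  have hev : (fun t => energyH2 D (u t)) =ᶠ[nhds 0] fun t => ∫ w in U, φ w * J (t, w) := by
    filter_upwards [isOpen_Ioo.mem_nhds h0] with t ht
    refine energyH2_eq hΓ hD hφ (isSmoothH2_fam hu ht) fun γ hγ => ?_
    obtain ⟨k, hk⟩ := he γ hγ
    exact ⟨k, hk t ht⟩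
  refine (hmain.congr_of_eventuallyEq hev).congr_deriv ?_
  rw [← integral_first_variation hΓ hD hφ (isSmoothH2_fam hu h0) hpos
    ((contDiffOn_velFrame hu hε).of_le ENat.LEInfty.out)
    fun γ hγ => by
      obtain ⟨k, hk⟩ := he γ hγ
      exact ⟨k, hk 0 h0, velFrame_smul hu hε hk⟩]
  refine setIntegral_congr_fun isOpen_U.measurableSet fun w hw => ?_
  congr 1
  have d1 := hasDerivAt_slice ((hJ.differentiableOn one_ne_zero).differentiableAt
    (hO.mem_nhds (hmem w hw)))
  have d2 := ((hasDerivAt_norm (hasDerivAt_al hu hε hw) (hpos.al_ne hw)).const_mul 2).div_const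
    (w.im ^ 2)
  have hev2 : (fun t => J (t, w)) =ᶠ[nhds 0] fun t => 2 * ‖al (hat (u t)) w‖ / w.im ^ 2 := by
    have hc : Continuous fun t : ℝ => (t, w) := by fun_prop
    filter_upwards [hc.continuousAt.preimage_mem_nhds (hO.mem_nhds (hmem w hw))] with t ht
    exact hJeq (t, w) ht
  exact d1.unique (d2.congr_of_eventuallyEq hev2)

end

/-! ### Critical points satisfy the Euler–Lagrange equation -/

/-- The point with disc coordinate `ζ` in the chart of the hyperbolic plane centred at `z`. -/
def discPt (z ζ : ℂ) : ℂ := (z - ζ * conj z) / (1 - ζ)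

lemma one_sub_ne_zero {ζ : ℂ} (hζ : ‖ζ‖ < 1) : 1 - ζ ≠ 0 := by
  intro h
  rw [sub_eq_zero] at h
  rw [← h] at hζ
  simp at hζ

lemma discPt_mem_U {z ζ : ℂ} (hz : z ∈ U) (hζ : ‖ζ‖ < 1) : discPt z ζ ∈ U := by
  have h1 := one_sub_ne_zero hζ
  have h2 : (discPt z ζ).im = z.im * (1 - ‖ζ‖ ^ 2) / ‖1 - ζ‖ ^ 2 := by
    have h1' : 1 - conj ζ ≠ 0 := by simpa using (map_ne_zero (starRingEnd ℂ)).2 h1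
    have e1 : ∀ x : ℂ, ((‖x‖ ^ 2 : ℝ) : ℂ) = x * conj x := fun x => by
      rw [Complex.mul_conj, Complex.normSq_eq_norm_sq]
    rw [← Complex.ofReal_inj, Complex.ofReal_div, Complex.ofReal_mul, Complex.ofReal_sub, e1, e1,
      ofReal_im_eq, ofReal_im_eq, discPt]
    simp only [map_div₀, map_sub, map_mul, Complex.conj_conj, map_one, Complex.ofReal_one]
    field_simp
    ring
  have hy : 0 < z.im := hz
  change 0 < (discPt z ζ).im
  rw [h2]
  have h3 : 0 < ‖1 - ζ‖ := norm_pos_iff.2 h1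
  have h4 : 0 < 1 - ‖ζ‖ ^ 2 := by nlinarith [norm_nonneg ζ]
  positivity

/-- The chart `ζ ↦ discPt p ζ` of the hyperbolic plane, centred at `p`, is equivariant. -/
lemma discPt_smul (k : SL(2, ℝ)) (p : ℍ) {ζ : ℂ} (hζ : ‖ζ‖ < 1) :
    discPt ((k • p : ℍ) : ℂ) (rot k p * ζ) = ((k • ofComplex (discPt p ζ) : ℍ) : ℂ) := by
  have h1 := one_sub_ne_zero hζ
  have hm := discPt_mem_U (coe_mem_U p) hζ
  have hd := den_ne_zero k (coe_mem_U p)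
  have hd' : conj (den k p) ≠ 0 := by simpa using hd
  have h3 := den_ne_zero k hm
  have hE : discPt p ζ * (1 - ζ) = p - ζ * conj (p : ℂ) := by rw [discPt]; field_simp
  have hM : den k p - ζ * conj (den k p) = den k (discPt p ζ) * (1 - ζ) := by
    simp only [den, map_add, map_mul, Complex.conj_ofReal]
    linear_combination (-(k 1 0 : ℂ)) * hE
  have hN : ((k 0 0 : ℂ) * p + (k 0 1 : ℂ)) - ζ * conj ((k 0 0 : ℂ) * p + (k 0 1 : ℂ)) =
      ((k 0 0 : ℂ) * discPt p ζ + (k 0 1 : ℂ)) * (1 - ζ) := by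
    simp only [map_add, map_mul, Complex.conj_ofReal]
    linear_combination (-(k 0 0 : ℂ)) * hE
  rw [coe_smul_eq, coe_smul_eq, coe_ofComplex hm]
  generalize (k 0 0 : ℂ) * p + (k 0 1 : ℂ) = A at *
  generalize (k 0 0 : ℂ) * discPt p ζ + (k 0 1 : ℂ) = B at *
  have hl : discPt (A / den k p) (rot k p * ζ) =
      (A - ζ * conj A) / (den k p - ζ * conj (den k p)) := by
    rw [discPt, rot, map_div₀]
    field_simp
  rw [hl, hM, hN, mul_div_mul_right _ _ h1]

/-- An invariant continuous function on a cocompact half-plane is bounded. -/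
lemma IsSurfaceGroup.exists_bound {Γ : Subgroup PSL(2, ℝ)} (hΓ : IsSurfaceGroup Γ) {h : ℂ → ℝ}
    (hc : ContinuousOn h U) (hinv : ∀ γ : SL(2, ℝ), (γ : PSL(2, ℝ)) ∈ Γ → ∀ p : ℍ,
      h ((γ • p : ℍ) : ℂ) = h p) : ∃ C : ℝ, ∀ w ∈ U, h w ≤ C := by
  obtain ⟨K, hK, hKΓ⟩ := hΓ.cocompact
  have h1 := hc.comp_continuous UpperHalfPlane.continuous_coe coe_mem_U
  obtain ⟨C, hC⟩ := (hK.image h1).bddAbove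
  refine ⟨C, fun w hw => ?_⟩
  obtain ⟨γ, hγ, hp⟩ := hKΓ (ofComplex w)
  obtain ⟨g, rfl⟩ := exists_rep γ
  have := hC ⟨_, hp, rfl⟩
  rwa [mk_smul, Function.comp_apply, hinv g hγ, coe_ofComplex hw] at this

/-- The variation in the direction of the Euler–Lagrange operator. It has all the symmetries of
the given map. -/
theorem exists_el_variation {Γ : Subgroup PSL(2, ℝ)} (hΓ : IsSurfaceGroup Γ) {f : ℍ → ℍ}
    (hf : IsSmoothH2 f) (hpos : Pos f) (he : Equivariant Γ f) :
    ∃ ε > 0, ∃ u : ℝ → ℍ → ℍ, IsSmoothFamilyH2 ε u ∧ u 0 = f ∧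
      (∀ w ∈ U, velFrame u w = nn (hat f) w * conj (el (hat f) w)) ∧
      ∀ γ k : SL(2, ℝ), (∀ p, f (γ • p) = k • f p) →
        ∀ t ∈ Set.Ioo (-ε) ε, ∀ p, u t (γ • p) = k • u t p := by
  have hc : ContDiff ℝ ∞ (fun z : ℂ => conj z) := Complex.conjCLE.contDiff
  -- the curve `t ↦ discPt p (t ζ)` starts with velocity `2 i ζ` in the frame `y ∂`
  let ζ : ℂ → ℂ := fun w => nn (hat f) w * conj (el (hat f) w) / (2 * Complex.I)
  have hζ : ContDiffOn ℝ ∞ ζ U :=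
    ((contDiffOn_nn hf hpos).mul (hc.comp_contDiffOn (contDiffOn_el hf hpos))).div_const _
  have hζsmul : ∀ γ k : SL(2, ℝ), (∀ p, f (γ • p) = k • f p) → ∀ p : ℍ,
      ζ ((γ • p : ℍ) : ℂ) = rot k (f p) * ζ p := fun γ k hk p => by
    have := rot_mul_conj γ (coe_mem_U p)
    simp only [ζ]
    rw [nn_smul hf hk, el_smul hf hpos hk, map_mul, Complex.conj_conj]
    linear_combination (rot k (f p) * nn (hat f) p * conj (el (hat f) p) / (2 * Complex.I)) * this
  obtain ⟨C, hC⟩ := hΓ.exists_bound hζ.continuousOn.norm fun γ hγ p => by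
    obtain ⟨k, hk⟩ := he γ hγ
    rw [hζsmul γ k hk, norm_mul, norm_rot k (coe_mem_U _), one_mul]
  have hC0 : 0 ≤ C := (norm_nonneg _).trans (hC _ (coe_mem_U UpperHalfPlane.I))
  have hε : 0 < 1 / (C + 1) := by positivity
  have hlt : ∀ t ∈ Set.Ioo (-(1 / (C + 1))) (1 / (C + 1)), ∀ w ∈ U, ‖(t : ℂ) * ζ w‖ < 1 :=
    fun t ht w hw => by
      rw [norm_mul, Complex.norm_real, Real.norm_eq_abs]
      have h1 := abs_lt.2 ht
      have h2 := hC w hw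
      have h3 : |t| * ‖ζ w‖ ≤ 1 / (C + 1) * C :=
        mul_le_mul h1.le h2 (norm_nonneg _) hε.le
      have h4 : 1 / (C + 1) * C < 1 := by
        rw [one_div_mul_eq_div, div_lt_one (by positivity)]; linarith
      exact h3.trans_lt h4
  let u : ℝ → ℍ → ℍ := fun t p => ofComplex (discPt (f p) (t * ζ p))
  have hu : ∀ t ∈ Set.Ioo (-(1 / (C + 1))) (1 / (C + 1)), ∀ w ∈ U,
      hat (u t) w = discPt (hat f w) (t * ζ w) := fun t ht w hw => by
    simp only [hat, u]
    rw [coe_ofComplex hw, coe_ofComplex (discPt_mem_U (coe_mem_U _) (hlt t ht w hw))]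
  have h0 : (0 : ℝ) ∈ Set.Ioo (-(1 / (C + 1))) (1 / (C + 1)) := ⟨by simpa using hε, hε⟩
  have hu0 : u 0 = f := by
    funext p
    simp [u, discPt]
  have hsm : IsSmoothFamilyH2 (1 / (C + 1)) u := by
    have hF : ContDiffOn ℝ ∞ (fun q : ℝ × ℂ => hat f q.2) (strip (1 / (C + 1))) :=
      (contDiffOn_hat hf).comp contDiff_snd.contDiffOn fun q hq => hq.2
    have hZ : ContDiffOn ℝ ∞ (fun q : ℝ × ℂ => (q.1 : ℂ) * ζ q.2) (strip (1 / (C + 1))) :=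
      (Complex.ofRealCLM.contDiff.comp contDiff_fst).contDiffOn.mul
        (hζ.comp contDiff_snd.contDiffOn fun q hq => hq.2)
    have hE : ContDiffOn ℝ ∞ (fun q : ℝ × ℂ => discPt (hat f q.2) (q.1 * ζ q.2))
        (strip (1 / (C + 1))) :=
      contDiffOn_div (hF.sub (hZ.mul (hc.comp_contDiffOn hF))) (contDiffOn_const.sub hZ)
        fun q hq => one_sub_ne_zero (hlt q.1 hq.1 q.2 hq.2)
    exact hE.congr fun q hq => hu q.1 hq.1 q.2 hq.2
  refine ⟨1 / (C + 1), hε, u, hsm, hu0, fun w hw => ?_, fun γ k hk t ht p => ?_⟩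
  · have d1 := hasDerivAt_hat hsm hε hw
    have d2 : HasDerivAt (fun t : ℝ => discPt (hat f w) (t * ζ w))
        (ζ w * (hat f w - conj (hat f w))) 0 := by
      have e0 : HasDerivAt (fun t : ℝ => (t : ℂ) * ζ w) (ζ w) 0 := by
        simpa using (Complex.ofRealCLM.hasDerivAt (x := (0 : ℝ))).mul_const (ζ w)
      have e1 := (e0.mul_const (conj (hat f w))).const_sub (hat f w)
      have e2 := e0.const_sub 1
      refine (e1.div e2 (by simp)).congr_deriv ?_
      simp
      ring
    have hev : (fun t => hat (u t) w) =ᶠ[nhds 0] fun t : ℝ => discPt (hat f w) (t * ζ w) := by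
      filter_upwards [isOpen_Ioo.mem_nhds h0] with t ht using hu t ht w hw
    have hv := hat_im_ne f w
    rw [velFrame, d1.unique (d2.congr_of_eventuallyEq hev), hu0, two_I_im]
    simp only [ζ]
    field_simp
  · have hl := hlt t ht p (coe_mem_U p)
    have hm := discPt_smul k (f p) hl
    apply UpperHalfPlane.ext
    have h1 : ((u t (γ • p) : ℍ) : ℂ) = discPt (f (γ • p)) (t * ζ ((γ • p : ℍ) : ℂ)) :=
      coe_ofComplex (discPt_mem_U (coe_mem_U _) (hlt t ht _ (coe_mem_U _)))
    rw [h1, hk, hζsmul γ k hk, mul_left_comm, hm]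

/-- If the first variation vanishes in the direction of the Euler–Lagrange operator, then the
Euler–Lagrange equation holds. -/
lemma el_eq_zero_of_integral {Γ : Subgroup PSL(2, ℝ)} {φ : ℂ → ℝ} (hφ : IsCutoff Γ φ) {f : ℍ → ℍ}
    (hf : IsSmoothH2 f) (hpos : Pos f) (he : Equivariant Γ f)
    (h : ∫ w in U, φ w * (2 * (el (hat f) w * (conj (nn (hat f) w) *
      (nn (hat f) w * conj (el (hat f) w)))).re / w.im ^ 2) = 0) :
    ∀ w ∈ U, el (hat f) w = 0 := by
  have hval : ∀ w ∈ U, φ w * (2 * (el (hat f) w * (conj (nn (hat f) w) *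
      (nn (hat f) w * conj (el (hat f) w)))).re / w.im ^ 2) =
      φ w * (2 * ‖el (hat f) w‖ ^ 2 / w.im ^ 2) := fun w hw => by
    have e : el (hat f) w * (conj (nn (hat f) w) * (nn (hat f) w * conj (el (hat f) w))) =
        ((‖el (hat f) w‖ ^ 2 : ℝ) : ℂ) := by
      have := hpos.nn_mul_conj hw
      rw [← Complex.normSq_eq_norm_sq, ← Complex.mul_conj]
      linear_combination (el (hat f) w * conj (el (hat f) w)) * this
    rw [e, Complex.ofReal_re]
  rw [setIntegral_congr_fun isOpen_U.measurableSet hval] at h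
  have hcont : ContinuousOn (fun w => 2 * ‖el (hat f) w‖ ^ 2 / w.im ^ 2) U :=
    (continuousOn_const.mul ((contDiffOn_el hf hpos).continuousOn.norm.pow 2)).div
      (Complex.continuous_im.pow 2).continuousOn fun w hw =>
        pow_ne_zero 2 (show 0 < w.im from hw).ne'
  have hnn : ∀ w, 0 ≤ φ w * (2 * ‖el (hat f) w‖ ^ 2 / w.im ^ 2) := fun w =>
    mul_nonneg (hφ.nonneg w) (by positivity)
  have hae := (setIntegral_eq_zero_iff_of_nonneg_ae (Filter.Eventually.of_forall hnn)
    (hφ.integrable_mul hcont).integrableOn).1 h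
  have hzero := Measure.eqOn_open_of_ae_eq (μ := (volume : Measure ℂ)) hae isOpen_U
    (hφ.smooth.continuous.continuousOn.mul hcont) continuousOn_const
  intro w hw
  have hsum := hφ.sum (ofComplex w)
  obtain ⟨γ, hγ⟩ : ∃ γ : Γ, φ ((γ • ofComplex w : ℍ) : ℂ) ≠ 0 := by
    by_contra! hcon
    simp [hcon] at hsum
  obtain ⟨g, hg⟩ := exists_rep (γ : PSL(2, ℝ))
  have hs : γ • ofComplex w = g • ofComplex w := by
    change (γ : PSL(2, ℝ)) • ofComplex w = _
    rw [← hg, mk_smul]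
  obtain ⟨k, hk⟩ := he g (by rw [hg]; exact γ.2)
  rw [hs] at hγ
  have h1 := hzero (coe_mem_U (g • ofComplex w))
  simp only [Pi.zero_apply, mul_eq_zero, hγ, false_or, div_eq_zero_iff] at h1
  have hy : ((g • ofComplex w : ℍ) : ℂ).im ^ 2 ≠ 0 :=
    pow_ne_zero 2 (g • ofComplex w : ℍ).im_pos.ne'
  have h2 : el (hat f) ((g • ofComplex w : ℍ) : ℂ) = 0 := by
    rcases h1 with h1 | h1
    · simpa using h1
    · exact absurd h1 hy
  rw [el_smul hf hpos hk, coe_ofComplex hw, mul_eq_zero] at h2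
  refine h2.resolve_left fun h3 => ?_
  have := rot_mul_conj g (coe_mem_U (ofComplex w))
  rw [coe_ofComplex hw, h3] at this
  simp at this

/-! ### Consequences of the Euler–Lagrange equation -/

section

variable {f : ℍ → ℍ} (hf : IsSmoothH2 f)
include hf

lemma hasWirt_dz_hat {w : ℂ} (hw : w ∈ U) : HasWirt (dz (hat f)) (dz (dz (hat f)) w)
    (dzb (dz (hat f)) w) w ∧ HasWirt (dzb (hat f)) (dzb (dz (hat f)) w)
        (dzb (dzb (hat f)) w) w := by
  have h1 := contDiffOn_dz isOpen_U (contDiffOn_hat hf) (m := ∞) (by simp)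
  have h2 := contDiffOn_dzb isOpen_U (contDiffOn_hat hf) (m := ∞) (by simp)
  have hc := ((contDiffOn_hat hf).contDiffAt (U_mem_nhds hw)).of_le (m := 2) ENat.LEInfty.out
  refine ⟨hasWirt_of_differentiableAt ((h1.differentiableOn (by simp)).differentiableAt
    (U_mem_nhds hw)), ?_⟩
  rw [← dz_dzb_comm hc]
  exact hasWirt_of_differentiableAt ((h2.differentiableOn (by simp)).differentiableAt
    (U_mem_nhds hw))

omit hf in
lemma sub_conj_ne {z : ℂ} (hz : z ∈ U) : z - conj z ≠ 0 := by
  rw [two_I_im]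
  exact mul_ne_zero (by simp) (im_ne hz)

omit hf in
lemma al_eq (F : ℂ → ℂ) (w : ℂ) :
    al F w = (w - conj w) * dz F w / (F w - conj (F w)) := by
  rw [al, two_I_im, two_I_im, mul_assoc, mul_div_mul_left _ _ (by simp)]

omit hf in
lemma be_eq (F : ℂ → ℂ) (w : ℂ) :
    be F w = (w - conj w) * dzb F w / (F w - conj (F w)) := by
  rw [be, two_I_im, two_I_im, mul_assoc, mul_div_mul_left _ _ (by simp)]

/-- The logarithmic derivative of `nn`, when the Euler–Lagrange equation holds. -/
def conn (F : ℂ → ℂ) (w : ℂ) : ℂ :=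
  (dz F w + conj (dzb F w)) / (F w - conj (F w)) - 1 / (w - conj w)

omit hf in
lemma conj_conn (F : ℂ → ℂ) (w : ℂ) : conj (conn F w) =
    1 / (w - conj w) - (dzb F w + conj (dz F w)) / (F w - conj (F w)) := by
  have h1 : ∀ z : ℂ, conj z - z = -(z - conj z) := fun z => by ring
  simp only [conn, map_sub, map_div₀, map_add, Complex.conj_conj, map_one, h1, div_neg]
  ring

lemma hasWirt_conn {w : ℂ} (hw : w ∈ U) : ∃ c, HasWirt (conn (hat f)) c
    ((dzb (dz (hat f)) w + conj (dzb (dz (hat f)) w)) / (hat f w - conj (hat f w)) -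
      (dz (hat f) w + conj (dzb (hat f) w)) * (dzb (hat f) w - conj (dz (hat f) w)) /
        (hat f w - conj (hat f w)) ^ 2 - 1 / (w - conj w) ^ 2) w := by
  obtain ⟨h1, h2⟩ := hasWirt_dz_hat hf hw
  have h0 := hasWirt_hat hf hw
  have hV := sub_conj_ne (hat_mem_U f w)
  have hY := sub_conj_ne hw
  have hid := hasWirt_id w
  have h := ((h1.add h2.conj).div (h0.sub h0.conj) hV).sub
    ((hasWirt_const 1 w).div (hid.sub hid.conj) hY)
  refine ⟨_, h.congr_deriv rfl ?_⟩
  simp only [map_one]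
  field_simp
  ring

variable (hpos : Pos f) (hel : ∀ w ∈ U, el (hat f) w = 0)
include hpos hel

/-- If `el` vanishes, the rotation part of the differential is parallel for the connection induced
by source and target. -/
lemma hasWirt_nn_of_el {w : ℂ} (hw : w ∈ U) : HasWirt (nn (hat f)) (nn (hat f) w * conn (hat f) w)
    (-(nn (hat f) w * conj (conn (hat f) w))) w := by
  have hn := hpos.nn_mul_conj hw
  have hV := sub_conj_ne (hat_mem_U f w)
  have hY := sub_conj_ne hw
  have hV' : conj (hat f w) - hat f w ≠ 0 := fun h => hV (by rw [← neg_sub, h, neg_zero])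
  have e1 : dz (nn (hat f)) w = nn (hat f) w * conn (hat f) w := by
    have h := hel w hw
    rw [el, div_eq_zero_iff, or_iff_left (by simp)] at h
    have h2 : (w - conj w) * (conj (nn (hat f) w) * dz (nn (hat f)) w - conn (hat f) w) = 0 := by
      rw [← h, al_eq, be_eq, conn]
      simp only [map_div₀, map_mul, map_sub, Complex.conj_conj]
      field_simp
      ring
    rcases mul_eq_zero.1 h2 with h3 | h3
    · exact absurd h3 hY
    · linear_combination nn (hat f) w * h3 - dz (nn (hat f)) w * hn
  refine (hasWirt_nn hf hpos hw).congr_deriv e1 ?_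
  have h := nn_deriv hf hpos hw
  rw [e1] at h
  have h2 : conj (dzb (nn (hat f)) w) = -(conj (nn (hat f) w) * conn (hat f) w) := by
    linear_combination conj (nn (hat f) w) * h -
      (conj (dzb (nn (hat f)) w) + conj (nn (hat f) w) * conn (hat f) w) * hn
  have h3 := congrArg conj h2
  simpa using h3

/-- The Euler–Lagrange equation implies that the map preserves area. This is the integrability
condition of the connection form `conn`, whose curvature is minus the difference between the area
density of the map and that of the source. -/
theorem det_eq_one {w : ℂ} (hw : w ∈ U) : ‖al (hat f) w‖ ^ 2 - ‖be (hat f) w‖ ^ 2 = 1 := by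
  have hn := hasWirt_nn_of_el hf hpos hel hw
  obtain ⟨c, hc⟩ := hasWirt_conn hf hw
  have hV := sub_conj_ne (hat_mem_U f w)
  have hY := sub_conj_ne hw
  have g1 : HasWirt (dz (nn (hat f))) _ _ w := (hn.mul hc).congr_of_eventuallyEq (by
    filter_upwards [U_mem_nhds hw] with z hz
    rw [(hasWirt_nn_of_el hf hpos hel hz).dz_eq])
  have g2 : HasWirt (dzb (nn (hat f))) _ _ w := (hn.mul hc.conj).neg.congr_of_eventuallyEq (by
    filter_upwards [U_mem_nhds hw] with z hz
    rw [(hasWirt_nn_of_el hf hpos hel hz).dzb_eq])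
  have hcomm := dz_dzb_comm (((contDiffOn_nn hf hpos).contDiffAt (U_mem_nhds hw)).of_le
    (m := 2) ENat.LEInfty.out)
  rw [g1.dzb_eq, g2.dz_eq] at hcomm
  have hne := hpos.nn_ne hw
  generalize hB : (dzb (dz (hat f)) w + conj (dzb (dz (hat f)) w)) / (hat f w - conj (hat f w)) -
      (dz (hat f) w + conj (dzb (hat f) w)) * (dzb (hat f) w - conj (dz (hat f) w)) /
        (hat f w - conj (hat f w)) ^ 2 - 1 / (w - conj w) ^ 2 = B at *
  have h0 : B + conj B = 0 := by
    refine (mul_eq_zero.1 (?_ : nn (hat f) w * (B + conj B) = 0)).resolve_left hne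
    linear_combination -hcomm
  have hd : ((‖al (hat f) w‖ ^ 2 - ‖be (hat f) w‖ ^ 2 : ℝ) : ℂ) = 1 := by
    push_cast
    rw [← Complex.mul_conj', ← Complex.mul_conj', al_eq, be_eq]
    rw [← hB] at h0
    simp only [map_div₀, map_mul, map_sub, map_add, Complex.conj_conj, map_pow, map_one] at h0 ⊢
    have e1 : ∀ z : ℂ, conj z - z = -(z - conj z) := fun z => by ring
    rw [e1 w, e1 (hat f w)] at h0 ⊢
    generalize w - conj w = Y at *
    generalize hat f w - conj (hat f w) = V at *
    field_simp at h0 ⊢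
    linear_combination (1/2) * h0
  exact_mod_cast hd

/-- The Codazzi equation: the operator `b`, with complex-linear part `‖al‖` and antilinear part
`conj nn * be`, is a Codazzi tensor. -/
lemma codazzi {w : ℂ} (hw : w ∈ U) : ∃ a' c' d' : ℂ,
    HasWirt (fun z => (‖al (hat f) z‖ : ℂ)) (conj a') a' w ∧
    HasWirt (fun z => conj (nn (hat f) z) * be (hat f) z) c' d' w ∧
    w.im * a' = w.im * c' + Complex.I * (conj (nn (hat f) w) * be (hat f) w) := by
  have hn := hasWirt_nn_of_el hf hpos hel hw
  obtain ⟨h1, h2⟩ := hasWirt_dz_hat hf hw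
  have h0 := hasWirt_hat hf hw
  have hV := sub_conj_ne (hat_mem_U f w)
  have hY := sub_conj_ne hw
  have hid := hasWirt_id w
  have ha : HasWirt (al (hat f)) _ _ w :=
    (((hid.sub hid.conj).mul h1).div (h0.sub h0.conj) hV).congr_of_eventuallyEq
      (Filter.Eventually.of_forall fun z => al_eq _ z)
  have hb : HasWirt (be (hat f)) _ _ w :=
    (((hid.sub hid.conj).mul h2).div (h0.sub h0.conj) hV).congr_of_eventuallyEq
      (Filter.Eventually.of_forall fun z => be_eq _ z)
  have hA := hn.conj.mul ha
  have hC := hn.conj.mul hb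
  have hA' : HasWirt (fun z => (‖al (hat f) z‖ : ℂ)) _ _ w := hA.congr_of_eventuallyEq (by
    filter_upwards [U_mem_nhds hw] with z hz using (hpos.conj_nn_mul_al hz).symm)
  have hreal := hA'.conj.congr_of_eventuallyEq (G := fun z => (‖al (hat f) z‖ : ℂ))
    (Filter.Eventually.of_forall fun z => (Complex.conj_ofReal _).symm)
  refine ⟨_, _, _, hA'.congr_deriv (hA'.dz_eq.symm.trans hreal.dz_eq) rfl, hC, ?_⟩
  rw [ofReal_im_eq w, al_eq, be_eq]
  simp only [map_one, map_zero, map_neg, map_mul, Complex.conj_conj]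
  rw [conj_conn, conn]
  generalize w - conj w = Y at *
  generalize hat f w - conj (hat f w) = V at *
  field_simp
  rw [Complex.I_sq]
  ring

end

/-! ### First variation of the area of graphs -/

lemma hat_id {w : ℂ} (hw : w ∈ U) : hat id w = w := coe_ofComplex hw

lemma hasWirt_hat_of_eq_id {f : ℍ → ℍ} (h : f = id) {w : ℂ} (hw : w ∈ U) :
    HasWirt (hat f) 1 0 w := by
  subst h
  refine (hasWirt_id w).congr_of_eventuallyEq ?_
  filter_upwards [U_mem_nhds hw] with z hz using hat_id hz

lemma al_id {f : ℍ → ℍ} (h : f = id) {w : ℂ} (hw : w ∈ U) : al (hat f) w = 1 := by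
  rw [al, (hasWirt_hat_of_eq_id h hw).dz_eq, h, hat_id hw, mul_one, div_self (im_ne hw)]

lemma be_id {f : ℍ → ℍ} (h : f = id) {w : ℂ} (hw : w ∈ U) : be (hat f) w = 0 := by
  rw [be, (hasWirt_hat_of_eq_id h hw).dzb_eq, mul_zero, zero_div]

/-- The square of the area density of the map `(f, g)`, in terms of the frame components of the
two differentials. -/
def areaSq (μ ν α β : ℂ) : ℝ :=
  (‖μ‖ ^ 2 + ‖ν‖ ^ 2 + ‖α‖ ^ 2 + ‖β‖ ^ 2) ^ 2 - 4 * ‖conj μ * ν + conj α * β‖ ^ 2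

lemma contDiffOn_norm_sq {E : Type*} [NormedAddCommGroup E] [NormedSpace ℝ E] {F : E → ℂ}
    {s : Set E} (hF : ContDiffOn ℝ ∞ F s) : ContDiffOn ℝ ∞ (fun q => ‖F q‖ ^ 2) s := hF.norm_sq ℂ

lemma contDiffOn_areaSq {E : Type*} [NormedAddCommGroup E] [NormedSpace ℝ E] {μ ν α β : E → ℂ}
    {s : Set E} (hμ : ContDiffOn ℝ ∞ μ s) (hν : ContDiffOn ℝ ∞ ν s) (hα : ContDiffOn ℝ ∞ α s)
    (hβ : ContDiffOn ℝ ∞ β s) : ContDiffOn ℝ ∞ (fun q => areaSq (μ q) (ν q) (α q) (β q)) s := by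
  have hc : ContDiff ℝ ∞ (fun z : ℂ => conj z) := Complex.conjCLE.contDiff
  exact (((((contDiffOn_norm_sq hμ).add (contDiffOn_norm_sq hν)).add (contDiffOn_norm_sq hα)).add
    (contDiffOn_norm_sq hβ)).pow 2).sub (contDiffOn_const.mul (contDiffOn_norm_sq
      (((hc.comp_contDiffOn hμ).mul hν).add ((hc.comp_contDiffOn hα).mul hβ))))

lemma hasDerivAt_norm_sq {z : ℝ → ℂ} {z' : ℂ} {t : ℝ} (h : HasDerivAt z z' t) :
    HasDerivAt (fun s => ‖z s‖ ^ 2) (2 * (conj (z t) * z').re) t := by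
  refine h.norm_sq.congr_deriv ?_
  rw [Complex.inner]
  ring_nf

lemma areaSq_graph {α β : ℂ} (h : ‖α‖ ^ 2 - ‖β‖ ^ 2 = 1) : areaSq 1 0 α β = (2 * ‖α‖) ^ 2 := by
  simp only [areaSq, norm_one, norm_zero, mul_zero, zero_add, norm_mul, Complex.norm_conj]
  linear_combination (‖α‖ ^ 2 - ‖β‖ ^ 2 - 1) * h

/-- Variation of the area density at the graph of an area-preserving map. -/
lemma hasDerivAt_sqrt_areaSq {μ ν α β : ℝ → ℂ} {μ' ν' α' β' : ℂ} (hμ : HasDerivAt μ μ' 0)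
    (hν : HasDerivAt ν ν' 0) (hα : HasDerivAt α α' 0) (hβ : HasDerivAt β β' 0) (hμ0 : μ 0 = 1)
    (hν0 : ν 0 = 0) (h : ‖α 0‖ ^ 2 - ‖β 0‖ ^ 2 = 1) :
    HasDerivAt (fun t => √(areaSq (μ t) (ν t) (α t) (β t)))
      (2 * (conj (α 0 / ‖α 0‖) * α').re + 2 * (‖α 0‖ * μ' -
        conj (conj (α 0 / ‖α 0‖) * β 0) * ν').re) 0 := by
  have hpos : 0 < ‖α 0‖ := by
    by_contra! hle
    have : ‖α 0‖ = 0 := le_antisymm hle (norm_nonneg _)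
    nlinarith [sq_nonneg ‖β 0‖]
  have e0 : areaSq (μ 0) (ν 0) (α 0) (β 0) = (2 * ‖α 0‖) ^ 2 := by rw [hμ0, hν0, areaSq_graph h]
  have hconj : ∀ {z : ℝ → ℂ} {z' : ℂ}, HasDerivAt z z' 0 →
      HasDerivAt (fun t => conj (z t)) (conj z') 0 := fun hz =>
    Complex.conjCLE.toContinuousLinearMap.hasFDerivAt.comp_hasDerivAt 0 hz
  have d1 := ((((hasDerivAt_norm_sq hμ).add (hasDerivAt_norm_sq hν)).add
    (hasDerivAt_norm_sq hα)).add (hasDerivAt_norm_sq hβ)).pow 2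
  have d2 := (hasDerivAt_norm_sq (((hconj hμ).mul hν).add ((hconj hα).mul hβ))).const_mul 4
  have d : HasDerivAt (fun t => areaSq (μ t) (ν t) (α t) (β t)) _ 0 := d1.sub d2
  refine (d.sqrt (by rw [e0]; positivity)).congr_deriv ?_
  rw [e0, Real.sqrt_sq (by positivity)]
  have hN : ‖α 0‖ ^ 2 = (α 0).re ^ 2 + (α 0).im ^ 2 := norm_sq_eq _
  have hM : ‖β 0‖ ^ 2 = (β 0).re ^ 2 + (β 0).im ^ 2 := norm_sq_eq _
  simp only [Pi.add_apply, Pi.mul_apply]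
  simp only [hμ0, hν0]
  generalize α 0 = α at *
  generalize β 0 = β at *
  have hne := hpos.ne'
  rw [hM] at h ⊢
  generalize ‖α‖ = N at *
  have hd : α / N = ⟨α.re / N, α.im / N⟩ := by
    apply Complex.ext
    · simp [Complex.div_ofReal_re]
    · simp [Complex.div_ofReal_im]
  rw [hd]
  simp
  field_simp
  linear_combination (4 * (α.re * α'.re + α.im * α'.im) - 2 * (μ'.re + (α.re * α'.re +
    α.im * α'.im) + (β.re * β'.re + β.im * β'.im))) * h +
    4 * (β.re * β'.re + β.im * β'.im) * hN

section

variable {Γ : Subgroup PSL(2, ℝ)} (hΓ : IsSurfaceGroup Γ) {D : Set ℍ}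
  (hD : IsFundamentalDomain Γ D (volume : Measure ℍ)) {φ : ℂ → ℝ} (hφ : IsCutoff Γ φ)
include hΓ hD hφ

lemma areaProd_eq {f g : ℍ → ℍ} (hf : IsSmoothH2 f) (hfe : Equivariant Γ f) (hg : IsSmoothH2 g)
    (hge : Equivariant Γ g) : areaProd D f g = ∫ w in U, φ w *
      (√(areaSq (al (hat f) w) (be (hat f) w) (al (hat g) w) (be (hat g) w)) / w.im ^ 2) := by
  have := hΓ.countable
  have hA : ∀ p, areaDensity p (pullH2 f p + pullH2 g p) =
      √(areaSq (al (hat f) p) (be (hat f) p) (al (hat g) p) (be (hat g) p)) := areaDensity_add f g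
  rw [areaProd]
  simp only [hA]
  rw [hφ.setIntegral_eq hD (h := fun p : ℍ =>
    √(areaSq (al (hat f) p) (be (hat f) p) (al (hat g) p) (be (hat g) p)))]
  · refine setIntegral_congr_fun isOpen_U.measurableSet fun w hw => ?_
    simp only [coe_ofComplex hw]
  · exact ((contDiffOn_areaSq (contDiffOn_al hf) (contDiffOn_be hf) (contDiffOn_al hg)
      (contDiffOn_be hg)).continuousOn.comp_continuous UpperHalfPlane.continuous_coe
        coe_mem_U).sqrt
  · intro γ p
    obtain ⟨c, hc⟩ := exists_rep (γ : PSL(2, ℝ))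
    have hcΓ : (c : PSL(2, ℝ)) ∈ Γ := by rw [hc]; exact γ.2
    obtain ⟨k, hk⟩ := hfe c hcΓ
    obtain ⟨l, hl⟩ := hge c hcΓ
    have hs : γ • p = c • p := by
      change (γ : PSL(2, ℝ)) • p = _
      rw [← hc, mk_smul]
    have h1 := rot_mul_conj k (coe_mem_U (f p))
    have h2 := rot_mul_conj l (coe_mem_U (g p))
    have e : conj (al (hat f) ((c • p : ℍ) : ℂ)) * be (hat f) ((c • p : ℍ) : ℂ) +
        conj (al (hat g) ((c • p : ℍ) : ℂ)) * be (hat g) ((c • p : ℍ) : ℂ) =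
        rot c p ^ 2 * (conj (al (hat f) p) * be (hat f) p +
            conj (al (hat g) p) * be (hat g) p) := by
      rw [al_smul hf hk, be_smul hf hk, al_smul hg hl, be_smul hg hl]
      simp only [map_mul, Complex.conj_conj]
      linear_combination (rot c p ^ 2 * conj (al (hat f) p) * be (hat f) p) * h1 +
        (rot c p ^ 2 * conj (al (hat g) p) * be (hat g) p) * h2
    rw [hs, areaSq, areaSq, e, norm_al_smul hf hk, norm_be_smul hf hk, norm_al_smul hg hl,
      norm_be_smul hg hl, norm_mul, norm_pow, norm_rot c (coe_mem_U p), one_pow, one_mul]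

/-- First variation of the area at the graph of an area-preserving map, for variations `(u, v)`.
The contribution of `v` is the first variation of the functional `F`. -/
theorem hasDerivAt_areaProd {ε : ℝ} (hε : 0 < ε) {u v : ℝ → ℍ → ℍ} (hu : IsSmoothFamilyH2 ε u)
    (hue : EquivariantFam Γ ε u) (hu0 : u 0 = id) (hv : IsSmoothFamilyH2 ε v)
    (hve : EquivariantFam Γ ε v) (hpos : Pos (v 0))
    (hdet : ∀ w ∈ U, ‖al (hat (v 0)) w‖ ^ 2 - ‖be (hat (v 0)) w‖ ^ 2 = 1) :
    HasDerivAt (fun t => areaProd D (u t) (v t))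
      ((∫ w in U, φ w * (2 * (el (hat (v 0)) w * (conj (nn (hat (v 0)) w) * velFrame v w)).re /
        w.im ^ 2)) + ∫ w in U, φ w * (2 * (‖al (hat (v 0)) w‖ * (w.im * dz (velFrame u) w +
          conj (velFrame u w) / (2 * Complex.I)) - conj (conj (nn (hat (v 0)) w) *
          be (hat (v 0)) w) * (w.im * dzb (velFrame u) w - velFrame u w / (2 * Complex.I))).re /
        w.im ^ 2)) 0 := by
  have h0 : (0 : ℝ) ∈ Set.Ioo (-ε) ε := ⟨by simpa using hε, hε⟩
  let Q : ℝ × ℂ → ℝ := fun q => areaSq (al (hat (u q.1)) q.2) (be (hat (u q.1)) q.2)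
    (al (hat (v q.1)) q.2) (be (hat (v q.1)) q.2)
  have hQ : ContDiffOn ℝ ∞ Q (strip ε) := contDiffOn_areaSq (contDiffOn_al_fam hu)
    (contDiffOn_be_fam hu) (contDiffOn_al_fam hv) (contDiffOn_be_fam hv)
  let O : Set (ℝ × ℂ) := strip ε ∩ {q | 0 < Q q}
  have hO : IsOpen O := hQ.continuousOn.isOpen_inter_preimage (isOpen_strip ε) isOpen_Ioi
  let J : ℝ × ℂ → ℝ := fun q => √(Q q) / q.2.im ^ 2
  have hJ : ContDiffOn ℝ 1 J O := by
    have h2 : ContDiffOn ℝ ∞ J O :=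
      ((hQ.mono Set.inter_subset_left).sqrt fun q hq => (show 0 < Q q from hq.2).ne').div
        ((Complex.imCLM.contDiff.comp contDiff_snd).pow 2).contDiffOn
        fun q hq => pow_ne_zero 2 (show 0 < q.2.im from hq.1.2).ne'
    exact h2.of_le ENat.LEInfty.out
  have hmem : ∀ w ∈ U, ((0 : ℝ), w) ∈ O := fun w hw => by
    refine ⟨zero_mem_strip hε hw, ?_⟩
    have := hpos.norm_al_pos hw
    simp only [Set.mem_ofPred_eq, Q]
    rw [al_id hu0 hw, be_id hu0 hw, areaSq_graph (hdet w hw)]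
    positivity
  have hmain := hφ.hasDerivAt_integral hO hJ fun w hw => hmem w (hφ.supp hw)
  have hev : (fun t => areaProd D (u t) (v t)) =ᶠ[nhds 0] fun t => ∫ w in U, φ w * J (t, w) := by
    filter_upwards [isOpen_Ioo.mem_nhds h0] with t ht
    refine areaProd_eq hΓ hD hφ (isSmoothH2_fam hu ht) (fun γ hγ => ?_) (isSmoothH2_fam hv ht)
      fun γ hγ => ?_
    · obtain ⟨k, hk⟩ := hue γ hγ
      exact ⟨k, hk t ht⟩
    · obtain ⟨k, hk⟩ := hve γ hγ
      exact ⟨k, hk t ht⟩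
  refine (hmain.congr_of_eventuallyEq hev).congr_deriv ?_
  have hv0 := isSmoothH2_fam hv h0
  rw [← integral_first_variation hΓ hD hφ hv0 hpos
    ((contDiffOn_velFrame hv hε).of_le ENat.LEInfty.out)
    fun γ hγ => by
      obtain ⟨k, hk⟩ := hve γ hγ
      exact ⟨k, hk 0 h0, velFrame_smul hv hε hk⟩]
  have hc : ContDiff ℝ ∞ (fun z : ℂ => conj z) := Complex.conjCLE.contDiff
  have hy : ContinuousOn (fun w : ℂ => (w.im : ℂ)) U :=
    (contDiffOn_im (n := ∞) contDiffOn_id).continuousOn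
  have hV := contDiffOn_velFrame hv hε
  have hY := contDiffOn_velFrame hu hε
  have hdiv : ∀ {G : ℂ → ℂ}, ContinuousOn G U →
      ContinuousOn (fun w => 2 * (G w).re / w.im ^ 2) U := fun hG =>
    (continuousOn_const.mul (Complex.continuous_re.comp_continuousOn hG)).div
      (Complex.continuous_im.pow 2).continuousOn fun w hw =>
        pow_ne_zero 2 (show 0 < w.im from hw).ne'
  rw [← integral_add (hφ.integrable_mul (hdiv ?_)).integrableOn
    (hφ.integrable_mul (hdiv ?_)).integrableOn]
  · refine setIntegral_congr_fun isOpen_U.measurableSet fun w hw => ?_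
    have d1 := hasDerivAt_slice ((hJ.differentiableOn one_ne_zero).differentiableAt
      (hO.mem_nhds (hmem w hw)))
    have d2 := (hasDerivAt_sqrt_areaSq (hasDerivAt_al hu hε hw) (hasDerivAt_be hu hε hw)
      (hasDerivAt_al hv hε hw) (hasDerivAt_be hv hε hw) (al_id hu0 hw) (be_id hu0 hw)
      (hdet w hw)).div_const (w.im ^ 2)
    have e := d1.unique d2
    simp only [e, al_id hu0 hw, be_id hu0 hw, nn]
    simp only [one_mul, map_zero, map_one, zero_mul, sub_zero, zero_sub, neg_div, ← sub_eq_add_neg]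
    ring
  · exact ((hc.comp_contDiffOn (contDiffOn_nn hv0 hpos)).continuousOn.mul
      ((hy.mul (contDiffOn_dz isOpen_U hV (m := ∞) (by simp)).continuousOn).add
        ((((contDiffOn_al hv0).mul (hc.comp_contDiffOn hV)).sub
          ((hc.comp_contDiffOn (contDiffOn_be hv0)).mul hV)).div_const _).continuousOn))
  · refine ContinuousOn.sub (ContinuousOn.mul ?_ (ContinuousOn.add ?_ ?_)) (ContinuousOn.mul ?_
      (ContinuousOn.sub ?_ ?_))
    · exact Complex.continuous_ofReal.comp_continuousOn (contDiffOn_al hv0).continuousOn.norm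
    · exact hy.mul (contDiffOn_dz isOpen_U hY (m := ∞) (by simp)).continuousOn
    · exact ((hc.comp_contDiffOn hY).div_const _).continuousOn
    · exact (hc.comp_contDiffOn ((hc.comp_contDiffOn (contDiffOn_nn hv0 hpos)).mul
        (contDiffOn_be hv0))).continuousOn
    · exact hy.mul (contDiffOn_dzb isOpen_U hY (m := ∞) (by simp)).continuousOn
    · exact (hY.div_const _).continuousOn

/-- For a solution of the Euler–Lagrange equation, the contribution of the variations of the source
to the first variation of the area vanishes, by the Codazzi equation. -/
lemma integral_source_eq_zero {f : ℍ → ℍ} (hf : IsSmoothH2 f) (hpos : Pos f)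
    (hel : ∀ w ∈ U, el (hat f) w = 0) (he : Equivariant Γ f) {Y : ℂ → ℂ} (hY : ContDiffOn ℝ ∞ Y U)
    (hYinv : ∀ γ : SL(2, ℝ), (γ : PSL(2, ℝ)) ∈ Γ → ∀ p : ℍ, Y ((γ • p : ℍ) : ℂ) = rot γ p * Y p) :
    ∫ w in U, φ w * (2 * (‖al (hat f) w‖ * (w.im * dz Y w + conj (Y w) / (2 * Complex.I)) -
      conj (conj (nn (hat f) w) * be (hat f) w) * (w.im * dzb Y w - Y w / (2 * Complex.I))).re /
        w.im ^ 2) = 0 := by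
  have hc : ContDiff ℝ ∞ (fun z : ℂ => conj z) := Complex.conjCLE.contDiff
  let Z : ℂ → ℂ := fun w => ‖al (hat f) w‖ * Y w - conj (nn (hat f) w) * be (hat f) w * conj (Y w)
  have hZ : ContDiffOn ℝ ∞ Z U :=
    ((Complex.ofRealCLM.contDiff.comp_contDiffOn (contDiffOn_norm (contDiffOn_al hf)
      fun _ hw => hpos.al_ne hw)).mul hY).sub (((hc.comp_contDiffOn (contDiffOn_nn hf hpos)).mul
        (contDiffOn_be hf)).mul (hc.comp_contDiffOn hY))
  rw [← hφ.integral_div_eq_zero hΓ hD (X := Z) (hZ.of_le ENat.LEInfty.out) fun γ hγ p => by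
    obtain ⟨k, hk⟩ := he γ hγ
    have h1 := rot_mul_conj k (coe_mem_U (f p))
    have h2 := rot_mul_conj γ (coe_mem_U p)
    simp only [Z]
    rw [norm_al_smul hf hk, nn_smul hf hk, be_smul hf hk, hYinv γ hγ]
    simp only [map_mul, Complex.conj_conj]
    linear_combination (-(rot γ p * conj (nn (hat f) p) * be (hat f) p * conj (Y p))) *
      (rot γ p * conj (rot γ p) * h1 + h2)]
  refine setIntegral_congr_fun isOpen_U.measurableSet fun w hw => ?_
  obtain ⟨a', c', d', ha, hcc, hcod⟩ := codazzi hf hpos hel hw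
  have hYw := hasWirt_of_differentiableAt
    ((hY.differentiableOn (by simp)).differentiableAt (U_mem_nhds hw))
  have hy : w.im ≠ 0 := (show 0 < w.im from hw).ne'
  have hdz := hasWirt_div_im ((ha.mul hYw).sub (hcc.mul hYw.conj)) hw
  have hdz' : dz (fun z => Z z / z.im) w = _ := hdz
  rw [hdz', ← Complex.ofReal_pow, Complex.div_ofReal_re, mul_div_assoc]
  congr 3
  rw [div_two_I, div_two_I]
  have h1 := congrArg Complex.re hcod
  have h2 := congrArg Complex.im hcod
  generalize conj (nn (hat f) w) * be (hat f) w = c at *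
  simp at h1 h2 ⊢
  linear_combination -(Y w).re * h1 - (Y w).im * h2

end

/-! ### The inverse exponential map of the hyperbolic plane -/

/-- The function `d / sinh d` of `s = cosh d`. -/
def psi (s : ℝ) : ℝ := ∫ x in (0 : ℝ)..1, 2 / (x ^ 2 + 2 * s * x + 1)

/-- The derivative of `psi`. -/
def psi' (s : ℝ) : ℝ := ∫ x in (0 : ℝ)..1, -(4 * x) / (x ^ 2 + 2 * s * x + 1) ^ 2

lemma one_le_quad {s x : ℝ} (hs : 0 < s) (hx : 0 ≤ x) : 1 ≤ x ^ 2 + 2 * s * x + 1 := by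
  have : 0 ≤ s * x := mul_nonneg hs.le hx
  nlinarith [sq_nonneg x]

lemma continuousOn_quad {s : ℝ} (hs : 0 < s) {g : ℝ → ℝ} (hg : Continuous g) (n : ℕ) :
    ContinuousOn (fun x => g x / (x ^ 2 + 2 * s * x + 1) ^ n) (Set.uIcc 0 1) :=
  hg.continuousOn.div (by fun_prop) fun x hx => by
    rw [Set.uIcc_of_le zero_le_one] at hx
    have := one_le_quad hs hx.1
    positivity

lemma psi_integrand_bound {s x : ℝ} (hs : 0 < s) (hx : x ∈ Set.uIoc (0 : ℝ) 1) :
    ‖-(4 * x) / (x ^ 2 + 2 * s * x + 1) ^ 2‖ ≤ 4 := by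
  rw [Set.uIoc_of_le zero_le_one] at hx
  have h1 := one_le_quad hs hx.1.le
  rw [norm_div, Real.norm_eq_abs, Real.norm_eq_abs, abs_neg, abs_of_nonneg (by linarith [hx.1]),
    abs_of_pos (by positivity), div_le_iff₀ (by positivity)]
  nlinarith [hx.2]

lemma hasDerivAt_psi {s : ℝ} (hs : 0 < s) : HasDerivAt psi (psi' s) s := by
  have hc : ∀ r ∈ Set.Ioi (0 : ℝ), ∀ x ∈ Set.uIoc (0 : ℝ) 1,
      HasDerivAt (fun r => 2 / (x ^ 2 + 2 * r * x + 1))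
        (-(4 * x) / (x ^ 2 + 2 * r * x + 1) ^ 2) r := fun r hr x hx => by
    rw [Set.uIoc_of_le zero_le_one] at hx
    have h1 := one_le_quad hr hx.1.le
    have h2 : HasDerivAt (fun r : ℝ => x ^ 2 + 2 * r * x + 1) (2 * x) r := by
      simpa using ((((hasDerivAt_id r).const_mul 2).mul_const x).const_add (x ^ 2)).add_const 1
    refine ((hasDerivAt_const r (2 : ℝ)).div h2 (by positivity)).congr_deriv ?_
    ring
  have hcont : ∀ r ∈ Set.Ioi (0 : ℝ),
      ContinuousOn (fun x : ℝ => 2 / (x ^ 2 + 2 * r * x + 1)) (Set.uIcc 0 1) := fun r hr => by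
    simpa using continuousOn_quad hr (continuous_const (y := (2 : ℝ))) 1
  refine (intervalIntegral.hasDerivAt_integral_of_dominated_loc_of_deriv_le
    (F := fun r x => 2 / (x ^ 2 + 2 * r * x + 1))
    (F' := fun r x => -(4 * x) / (x ^ 2 + 2 * r * x + 1) ^ 2) (bound := fun _ => 4)
    (Ioi_mem_nhds hs) ?_ (hcont s hs).intervalIntegrable ?_ ?_ intervalIntegrable_const ?_).2
  · filter_upwards [Ioi_mem_nhds hs] with r hr
    exact ((hcont r hr).mono Set.uIoc_subset_uIcc).aestronglyMeasurable measurableSet_uIoc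
  · exact ((continuousOn_quad hs (by fun_prop) 2).mono Set.uIoc_subset_uIcc).aestronglyMeasurable
      measurableSet_uIoc
  · exact Filter.Eventually.of_forall fun x hx r hr => psi_integrand_bound hr hx
  · exact Filter.Eventually.of_forall fun x hx r hr => hc r hr x hx

lemma continuousOn_psi' : ContinuousOn psi' (Set.Ioi 0) := by
  intro s hs
  refine ContinuousAt.continuousWithinAt ?_
  refine intervalIntegral.continuousAt_of_dominated_interval (bound := fun _ => 4) ?_ ?_
    intervalIntegrable_const ?_
  · filter_upwards [Ioi_mem_nhds hs] with r hr
    exact ((continuousOn_quad hr (by fun_prop) 2).mono Set.uIoc_subset_uIcc).aestronglyMeasurable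
      measurableSet_uIoc
  · filter_upwards [Ioi_mem_nhds hs] with r hr
    exact Filter.Eventually.of_forall fun x hx => psi_integrand_bound hr hx
  · refine Filter.Eventually.of_forall fun x hx => ?_
    rw [Set.uIoc_of_le zero_le_one] at hx
    have h1 := one_le_quad (Set.mem_Ioi.1 hs) hx.1.le
    exact ContinuousAt.div (by fun_prop) (by fun_prop) (by positivity)

lemma contDiffOn_psi : ContDiffOn ℝ 1 psi (Set.Ioi 0) := by
  rw [show (1 : WithTop ℕ∞) = 0 + 1 from rfl, contDiffOn_succ_iff_deriv_of_isOpen isOpen_Ioi]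
  refine ⟨fun s hs => (hasDerivAt_psi hs).differentiableAt.differentiableWithinAt, by simp, ?_⟩
  rw [contDiffOn_zero]
  exact continuousOn_psi'.congr fun s hs => (hasDerivAt_psi hs).deriv

/-- The integrand of the left-hand side is the derivative of a rational function of `x`. -/
lemma psi_ode {s : ℝ} (hs : 0 < s) : s * psi s + (s ^ 2 - 1) * psi' s = 1 := by
  have h1 : ∀ x ∈ Set.uIcc (0 : ℝ) 1, HasDerivAt (fun x => -(2 * s * x + 2) /
      (x ^ 2 + 2 * s * x + 1)) (s * (2 / (x ^ 2 + 2 * s * x + 1)) +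
        (s ^ 2 - 1) * (-(4 * x) / (x ^ 2 + 2 * s * x + 1) ^ 2)) x := fun x hx => by
    rw [Set.uIcc_of_le zero_le_one] at hx
    have hq := one_le_quad hs hx.1
    have hq' : x ^ 2 + 2 * s * x + 1 ≠ 0 := by positivity
    have d1 : HasDerivAt (fun x : ℝ => -(2 * s * x + 2)) (-(2 * s)) x := by
      exact (((hasDerivAt_id x).const_mul (2 * s)).add_const 2).neg.congr_deriv (by ring)
    have d2 : HasDerivAt (fun x : ℝ => x ^ 2 + 2 * s * x + 1) (2 * x + 2 * s) x := by
      simpa using (((hasDerivAt_id x).pow 2).add ((hasDerivAt_id x).const_mul (2 * s))).add_const 1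
    refine (d1.div d2 hq').congr_deriv ?_
    field_simp
    ring
  have c1 : ContinuousOn (fun x : ℝ => 2 / (x ^ 2 + 2 * s * x + 1)) (Set.uIcc 0 1) := by
    simpa using continuousOn_quad hs (continuous_const (y := (2 : ℝ))) 1
  have c2 : ContinuousOn (fun x : ℝ => -(4 * x) / (x ^ 2 + 2 * s * x + 1) ^ 2) (Set.uIcc 0 1) :=
    continuousOn_quad hs (by fun_prop) 2
  have i1 : ContinuousOn (fun x : ℝ => s * (2 / (x ^ 2 + 2 * s * x + 1))) (Set.uIcc 0 1) :=
    continuousOn_const.mul c1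
  have i2 : ContinuousOn (fun x : ℝ => (s ^ 2 - 1) * (-(4 * x) / (x ^ 2 + 2 * s * x + 1) ^ 2))
      (Set.uIcc 0 1) := continuousOn_const.mul c2
  have h2 := intervalIntegral.integral_eq_sub_of_hasDerivAt h1 (i1.add i2).intervalIntegrable
  rw [psi, psi', ← intervalIntegral.integral_const_mul, ← intervalIntegral.integral_const_mul,
    ← intervalIntegral.integral_add i1.intervalIntegrable i2.intervalIntegrable, h2]
  have : (1 : ℝ) + s ≠ 0 := by positivity
  field_simp
  ring

lemma psi'_nonpos {s : ℝ} : psi' s ≤ 0 := by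
  rw [psi']
  have : 0 ≤ ∫ x in (0 : ℝ)..1, (4 * x) / (x ^ 2 + 2 * s * x + 1) ^ 2 :=
    intervalIntegral.integral_nonneg zero_le_one fun x hx =>
      div_nonneg (by linarith [hx.1]) (by positivity)
  simp only [neg_div, intervalIntegral.integral_neg]
  linarith

lemma psi_nonneg {s : ℝ} (hs : 0 < s) : 0 ≤ psi s :=
  intervalIntegral.integral_nonneg zero_le_one fun x hx => by
    have := one_le_quad hs hx.1
    positivity

lemma psi_le_one {s : ℝ} (hs : 1 ≤ s) : psi s ≤ 1 := by
  have h1 : psi 1 = 1 := by simpa using psi_ode one_pos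
  rw [← h1]
  refine antitoneOn_of_deriv_nonpos (convex_Ici 1) ?_ ?_ ?_ Set.self_mem_Ici hs hs
  · exact fun r hr => (hasDerivAt_psi (one_pos.trans_le hr)).continuousAt.continuousWithinAt
  · intro r hr
    rw [interior_Ici] at hr
    exact (hasDerivAt_psi (one_pos.trans hr)).differentiableAt.differentiableWithinAt
  · intro r hr
    rw [interior_Ici] at hr
    rw [(hasDerivAt_psi (one_pos.trans hr)).deriv]
    exact psi'_nonpos

/-- The hyperbolic cosine of the distance between two points of the upper half-plane. -/
def coshDist (z₁ z₂ : ℂ) : ℝ := 1 + ‖z₂ - z₁‖ ^ 2 / (2 * z₁.im * z₂.im)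

/-- The initial velocity, in the frame `y ∂`, of the geodesic which goes from `z₁` to `z₂` in unit
time. -/
def logField (z₁ z₂ : ℂ) : ℂ :=
  Complex.I * psi (coshDist z₁ z₂) * ((z₂ - z₁) * (conj z₂ - z₁)) / (2 * z₁.im * z₂.im)

lemma one_le_coshDist {z₁ z₂ : ℂ} (h₁ : z₁ ∈ U) (h₂ : z₂ ∈ U) : 1 ≤ coshDist z₁ z₂ := by
  have h₁' : 0 < z₁.im := h₁
  have h₂' : 0 < z₂.im := h₂
  rw [coshDist]
  have : 0 ≤ ‖z₂ - z₁‖ ^ 2 / (2 * z₁.im * z₂.im) := by positivity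
  linarith

lemma two_mul_im_mul_im (z₁ z₂ : ℂ) :
    (2 * z₁.im * z₂.im : ℂ) = -((z₁ - conj z₁) * (z₂ - conj z₂)) / 2 := by
  rw [two_I_im, two_I_im]
  linear_combination (2 * (z₁.im : ℂ) * z₂.im) * Complex.I_sq

lemma coshDist_eq (z₁ z₂ : ℂ) : (coshDist z₁ z₂ : ℂ) =
    1 - 2 * ((z₂ - z₁) * (conj z₂ - conj z₁)) / ((z₁ - conj z₁) * (z₂ - conj z₂)) := by
  rw [coshDist]
  push_cast
  rw [← Complex.mul_conj', two_mul_im_mul_im, map_sub, neg_div, div_neg, div_div_eq_mul_div]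
  ring

lemma logField_eq (z₁ z₂ : ℂ) : logField z₁ z₂ = -2 * Complex.I * psi (coshDist z₁ z₂) *
    ((z₂ - z₁) * (conj z₂ - z₁)) / ((z₁ - conj z₁) * (z₂ - conj z₂)) := by
  rw [logField, two_mul_im_mul_im, neg_div, div_neg, div_div_eq_mul_div]
  ring

/-- Transformation of the differences which build the hyperbolic distance. -/
lemma smul_sub_smul (k : SL(2, ℝ)) {z₁ z₂ a₁ a₂ d₁ d₂ : ℂ} (ha₁ : a₁ = k 0 0 * z₁ + k 0 1)
    (ha₂ : a₂ = k 0 0 * z₂ + k 0 1) (hd₁ : d₁ = k 1 0 * z₁ + k 1 1) (hd₂ : d₂ = k 1 0 * z₂ + k 1 1)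
    (h₁ : d₁ ≠ 0) (h₂ : d₂ ≠ 0) : a₂ / d₂ - a₁ / d₁ = (z₂ - z₁) / (d₁ * d₂) := by
  have := det_eq k
  field_simp
  rw [ha₁, ha₂, hd₁, hd₂]
  linear_combination (z₂ - z₁) * this

lemma coe_smul_sub (k : SL(2, ℝ)) (p q : ℍ) : ((k • q : ℍ) : ℂ) - ((k • p : ℍ) : ℂ) =
    ((q : ℂ) - p) / (den k p * den k q) := by
  rw [coe_smul_eq, coe_smul_eq]
  exact smul_sub_smul k rfl rfl rfl rfl (den_ne_zero k (coe_mem_U p)) (den_ne_zero k (coe_mem_U q))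

lemma conj_smul_sub (k : SL(2, ℝ)) (p q : ℍ) : conj ((k • q : ℍ) : ℂ) - ((k • p : ℍ) : ℂ) =
    (conj (q : ℂ) - p) / (den k p * conj (den k q)) := by
  rw [coe_smul_eq, coe_smul_eq, map_div₀]
  refine smul_sub_smul k rfl ?_ rfl ?_ (den_ne_zero k (coe_mem_U p))
    (by simpa using den_ne_zero k (coe_mem_U q))
  · simp
  · simp [den]

lemma coshDist_smul (k : SL(2, ℝ)) (p q : ℍ) :
    coshDist ((k • p : ℍ) : ℂ) ((k • q : ℍ) : ℂ) = coshDist p q := by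
  have h1 := den_ne_zero k (coe_mem_U p)
  have h2 := den_ne_zero k (coe_mem_U q)
  have h1' : conj (den k p) ≠ 0 := by simpa using h1
  have h2' : conj (den k q) ≠ 0 := by simpa using h2
  have e1 := im_ne (coe_mem_U p)
  have e2 := im_ne (coe_mem_U q)
  rw [← Complex.ofReal_inj]
  simp only [coshDist]
  push_cast
  rw [← Complex.mul_conj', ← Complex.mul_conj', coe_smul_sub, im_smul_eq, im_smul_eq, map_div₀,
    map_mul]
  field_simp

lemma logField_smul (k : SL(2, ℝ)) (p q : ℍ) :
    logField ((k • p : ℍ) : ℂ) ((k • q : ℍ) : ℂ) = rot k p * logField p q := by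
  have h1 := den_ne_zero k (coe_mem_U p)
  have h2 := den_ne_zero k (coe_mem_U q)
  have h1' : conj (den k p) ≠ 0 := by simpa using h1
  have h2' : conj (den k q) ≠ 0 := by simpa using h2
  have e1 := im_ne (coe_mem_U p)
  have e2 := im_ne (coe_mem_U q)
  simp only [logField]
  rw [coshDist_smul, coe_smul_sub, conj_smul_sub, im_smul_eq, im_smul_eq, rot]
  field_simp

section

variable {z₁ z₂ : ℂ → ℂ} {a₁ b₁ a₂ b₂ w : ℂ} (h₁ : HasWirt z₁ a₁ b₁ w) (h₂ : HasWirt z₂ a₂ b₂ w)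
  (m₁ : z₁ w ∈ U) (m₂ : z₂ w ∈ U)
include h₁ h₂ m₁ m₂

set_option maxHeartbeats 2000000 in
/-- The derivative of the field along a pair of maps: the terms are grouped by the Wirtinger
derivatives of `z₁` and `z₂`. -/
lemma dz_logField : dz (fun w => logField (z₁ w) (z₂ w)) w =
    2 * Complex.I * (
      a₁ / (z₁ w - conj (z₁ w)) * (
        -2 * psi' (coshDist (z₁ w) (z₂ w)) * ((z₂ w - z₁ w) * (conj (z₂ w) - conj (z₁ w)) *
          (conj (z₂ w) - z₁ w) * (z₂ w - conj (z₁ w))) /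
          ((z₁ w - conj (z₁ w)) * (z₂ w - conj (z₂ w))) ^ 2 + psi (coshDist (z₁ w) (z₂ w)) *
          ((conj (z₂ w) - z₁ w + (z₂ w - z₁ w)) * (z₁ w - conj (z₁ w)) +
            (z₂ w - z₁ w) * (conj (z₂ w) - z₁ w)) /
          ((z₁ w - conj (z₁ w)) * (z₂ w - conj (z₂ w)))) +
      conj b₁ / (z₁ w - conj (z₁ w)) * (
        2 * psi' (coshDist (z₁ w) (z₂ w)) * ((z₂ w - z₁ w) * (conj (z₂ w) - z₁ w)) ^ 2 /
          ((z₁ w - conj (z₁ w)) * (z₂ w - conj (z₂ w))) ^ 2 - psi (coshDist (z₁ w) (z₂ w)) *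
          ((z₂ w - z₁ w) * (conj (z₂ w) - z₁ w)) /
          ((z₁ w - conj (z₁ w)) * (z₂ w - conj (z₂ w)))) +
      a₂ / (z₂ w - conj (z₂ w)) * (
        (conj (z₂ w) - z₁ w) ^ 2 / ((z₁ w - conj (z₁ w)) * (z₂ w - conj (z₂ w))) *
        (psi (coshDist (z₁ w) (z₂ w)) + psi' (coshDist (z₁ w) (z₂ w)) *
          (coshDist (z₁ w) (z₂ w) - 1))) -
      conj b₂ / (z₂ w - conj (z₂ w)) * (
        (z₂ w - z₁ w) ^ 2 / ((z₁ w - conj (z₁ w)) * (z₂ w - conj (z₂ w))) *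
        (psi (coshDist (z₁ w) (z₂ w)) + psi' (coshDist (z₁ w) (z₂ w)) *
          (coshDist (z₁ w) (z₂ w) + 1)))) := by
  have e1 := sub_conj_ne m₁
  have e2 := sub_conj_ne m₂
  have hp := h₂.sub h₁
  have hq := h₂.conj.sub h₁
  have hp' := h₂.conj.sub h₁.conj
  have hD := (h₁.sub h₁.conj).mul (h₂.sub h₂.conj)
  have hC := (hasWirt_const 1 w).sub (((hp.mul hp').const_mul 2).div hD (mul_ne_zero e1 e2))
  have hs := HasWirt.comp_re (S := psi) (S' := psi' (coshDist (z₁ w) (z₂ w))) hC (by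
    rw [← coshDist_eq, Complex.ofReal_re]
    exact hasDerivAt_psi (one_pos.trans_le (one_le_coshDist m₁ m₂)))
  have hW := ((hs.const_mul (-2 * Complex.I)).mul (hp.mul hq)).div hD (mul_ne_zero e1 e2)
  have hW' : HasWirt (fun w => logField (z₁ w) (z₂ w)) _ _ w :=
    hW.congr_of_eventuallyEq (Filter.Eventually.of_forall fun z => by
      simp only [logField_eq]
      rw [← coshDist_eq, Complex.ofReal_re])
  rw [hW'.dz_eq, coshDist_eq (z₁ w), ← coshDist_eq (z₁ w), Complex.ofReal_re, coshDist_eq (z₁ w)]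
  generalize psi' (coshDist (z₁ w) (z₂ w)) = P' at *
  generalize psi (coshDist (z₁ w) (z₂ w)) = P at *
  have e3 : conj (z₁ w) - z₁ w ≠ 0 := fun h => e1 (by rw [← neg_sub, h, neg_zero])
  have e4 : conj (z₂ w) - z₂ w ≠ 0 := fun h => e2 (by rw [← neg_sub, h, neg_zero])
  simp only [map_sub, map_mul, map_div₀, Complex.conj_conj, map_pow, map_zero, map_ofNat, map_add]
  field_simp
  ring

end

/-! ### Solutions of the Euler–Lagrange equation minimize -/

lemma norm_sq_conj_sub (z₁ z₂ : ℂ) :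
    ‖conj z₂ - z₁‖ ^ 2 = ‖z₂ - z₁‖ ^ 2 + 4 * z₁.im * z₂.im := by
  rw [norm_sq_eq, norm_sq_eq]
  simp
  ring

section

variable {z₁ z₂ : ℂ} (m₁ : z₁ ∈ U) (m₂ : z₂ ∈ U)
include m₁ m₂

lemma norm_sq_sub_eq : ‖z₂ - z₁‖ ^ 2 = 2 * z₁.im * z₂.im * (coshDist z₁ z₂ - 1) ∧
    ‖conj z₂ - z₁‖ ^ 2 = 2 * z₁.im * z₂.im * (coshDist z₁ z₂ + 1) := by
  have h₁ : 0 < z₁.im := m₁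
  have h₂ : 0 < z₂.im := m₂
  have e : ‖z₂ - z₁‖ ^ 2 = 2 * z₁.im * z₂.im * (coshDist z₁ z₂ - 1) := by
    rw [coshDist]
    field_simp
    ring
  refine ⟨e, ?_⟩
  rw [norm_sq_conj_sub, e]
  ring

omit m₁ m₂ in
lemma norm_DD : ‖(z₁ - conj z₁) * (z₂ - conj z₂)‖ = 4 * (|z₁.im| * |z₂.im|) := by
  rw [two_I_im, two_I_im]
  simp
  ring

/-- The coefficient with which the `(1, 0)`-derivative of the endpoint enters the derivative of
`logField`. Together with `norm_logField_coeff_anti` it shows that the two coefficients have total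
modulus one. -/
lemma norm_logField_coeff_holo :
    ‖(conj z₂ - z₁) ^ 2 / ((z₁ - conj z₁) * (z₂ - conj z₂)) *
      (psi (coshDist z₁ z₂) + psi' (coshDist z₁ z₂) * (coshDist z₁ z₂ - 1))‖ =
    (1 + psi (coshDist z₁ z₂)) / 2 := by
  have h₁ : 0 < z₁.im := m₁
  have h₂ : 0 < z₂.im := m₂
  have hs := one_le_coshDist m₁ m₂
  have hode := psi_ode (one_pos.trans_le hs)
  have hn := psi_nonneg (one_pos.trans_le hs)
  have h := (norm_sq_sub_eq m₁ m₂).2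
  generalize coshDist z₁ z₂ = s at *
  have e : ((psi s : ℂ) + psi' s * (s - 1)) = ((psi s + psi' s * (s - 1) : ℝ) : ℂ) := by
    push_cast; rfl
  rw [e, norm_mul, norm_div, norm_pow, norm_DD, h, Complex.norm_real, Real.norm_eq_abs,
    abs_of_pos h₁, abs_of_pos h₂]
  have e2 : (s + 1) * |psi s + psi' s * (s - 1)| = 1 + psi s := by
    rw [← abs_of_pos (show 0 < s + 1 by linarith), ← abs_mul,
      show (s + 1) * (psi s + psi' s * (s - 1)) = 1 + psi s by linear_combination hode]
    exact abs_of_nonneg (by linarith)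
  rw [← e2]
  field_simp
  ring

lemma norm_logField_coeff_anti :
    ‖(z₂ - z₁) ^ 2 / ((z₁ - conj z₁) * (z₂ - conj z₂)) *
      (psi (coshDist z₁ z₂) + psi' (coshDist z₁ z₂) * (coshDist z₁ z₂ + 1))‖ =
    (1 - psi (coshDist z₁ z₂)) / 2 := by
  have h₁ : 0 < z₁.im := m₁
  have h₂ : 0 < z₂.im := m₂
  have hs := one_le_coshDist m₁ m₂
  have hode := psi_ode (one_pos.trans_le hs)
  have hn := psi_le_one hs
  have h := (norm_sq_sub_eq m₁ m₂).1
  generalize coshDist z₁ z₂ = s at *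
  have e : ((psi s : ℂ) + psi' s * (s + 1)) = ((psi s + psi' s * (s + 1) : ℝ) : ℂ) := by
    push_cast; rfl
  rw [e, norm_mul, norm_div, norm_pow, norm_DD, h, Complex.norm_real, Real.norm_eq_abs,
    abs_of_pos h₁, abs_of_pos h₂]
  have e2 : (s - 1) * |psi s + psi' s * (s + 1)| = 1 - psi s := by
    rw [← abs_of_nonneg (show 0 ≤ s - 1 by linarith), ← abs_mul,
      show (s - 1) * (psi s + psi' s * (s + 1)) = 1 - psi s by linear_combination hode]
    exact abs_of_nonneg (by linarith)
  rw [← e2]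
  field_simp
  ring

/-- The coefficient with which the `(0, 1)`-derivative of the starting point enters the covariant
derivative of `logField`. -/
lemma norm_logField_coeff_source :
    ‖2 * psi' (coshDist z₁ z₂) * ((z₂ - z₁) * (conj z₂ - z₁)) ^ 2 /
      ((z₁ - conj z₁) * (z₂ - conj z₂)) ^ 2‖ = (coshDist z₁ z₂ * psi (coshDist z₁ z₂) - 1) / 2 := by
  have h₁ : 0 < z₁.im := m₁
  have h₂ : 0 < z₂.im := m₂
  have hs := one_le_coshDist m₁ m₂
  have hode := psi_ode (one_pos.trans_le hs)
  obtain ⟨hp, hq⟩ := norm_sq_sub_eq m₁ m₂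
  rw [norm_div, norm_mul, norm_pow, norm_pow, norm_DD, norm_mul, norm_mul, mul_pow, hp, hq,
    Complex.norm_real, Real.norm_eq_abs, abs_of_pos h₁, abs_of_pos h₂, abs_of_nonpos psi'_nonpos,
    Complex.norm_ofNat]
  generalize coshDist z₁ z₂ = s at *
  field_simp
  linear_combination (-16) * hode

/-- The coefficient with which the `(1, 0)`-derivative of the starting point enters the covariant
derivative of `logField`. Its distance below `-1` is exactly the modulus in
`norm_logField_coeff_source`. -/
lemma re_logField_coeff_source :
    (-2 * psi' (coshDist z₁ z₂) * ((z₂ - z₁) * (conj z₂ - conj z₁) * (conj z₂ - z₁) *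
      (z₂ - conj z₁)) / ((z₁ - conj z₁) * (z₂ - conj z₂)) ^ 2 + psi (coshDist z₁ z₂) *
      ((conj z₂ - z₁ + (z₂ - z₁)) * (z₁ - conj z₁) + (z₂ - z₁) * (conj z₂ - z₁)) /
      ((z₁ - conj z₁) * (z₂ - conj z₂)) + conj (logField z₁ z₂) / (2 * Complex.I)).re =
    -(1 + coshDist z₁ z₂ * psi (coshDist z₁ z₂)) / 2 := by
  have hs := one_le_coshDist m₁ m₂
  have hode := psi_ode (one_pos.trans_le hs)
  have e1 := sub_conj_ne m₁
  have e2 := sub_conj_ne m₂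
  have hval : -(1 + coshDist z₁ z₂ * psi (coshDist z₁ z₂)) / 2 =
    -((coshDist z₁ z₂ ^ 2 - 1) * psi' (coshDist z₁ z₂) + 2 * coshDist z₁ z₂ *
      psi (coshDist z₁ z₂)) / 2 := by linear_combination (1 / 2) * hode
  rw [hval, ← Complex.ofReal_inj, ofReal_re_eq, logField_eq]
  push_cast
  simp only [map_add, map_mul, map_div₀, map_sub, map_pow, map_neg, Complex.conj_conj,
    Complex.conj_ofReal, map_ofNat, Complex.conj_I]
  generalize psi' (coshDist z₁ z₂) = P' at *
  generalize psi (coshDist z₁ z₂) = P at *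
  rw [coshDist_eq]
  have e3 : conj z₁ - z₁ ≠ 0 := fun h => e1 (by rw [← neg_sub, h, neg_zero])
  have e4 : conj z₂ - z₂ ≠ 0 := fun h => e2 (by rw [← neg_sub, h, neg_zero])
  field_simp
  ring

end

/-- The calibration inequality. In the parentheses on the left is the covariant derivative of the
field along `f` which points to `g`. The derivative of `g` enters it with coefficients of total
modulus one; that of `f` enters through `α` and `β`, and since `|β| ≤ |α|` its contribution is at
most `-|α|`. -/
lemma calibration {f g : ℍ → ℍ} (hf : IsSmoothH2 f) (hg : IsSmoothH2 g) (hpos : Pos f) {w : ℂ}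
    (hw : w ∈ U) : (conj (nn (hat f) w) * (w.im * dz (fun w => logField (hat f w) (hat g w)) w +
      (al (hat f) w * conj (logField (hat f w) (hat g w)) - conj (be (hat f) w) *
        logField (hat f w) (hat g w)) / (2 * Complex.I))).re ≤
      max ‖al (hat g) w‖ ‖be (hat g) w‖ - ‖al (hat f) w‖ := by
  have m₁ := hat_mem_U f w
  have m₂ := hat_mem_U g w
  have hs := one_le_coshDist m₁ m₂
  have hode := psi_ode (one_pos.trans_le hs)
  have hP0 := psi_nonneg (one_pos.trans_le hs)
  have hP1 := psi_le_one hs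
  have hP' := psi'_nonpos (s := coshDist (hat f w) (hat g w))
  have n1 := re_logField_coeff_source m₁ m₂
  have n2 := norm_logField_coeff_source m₁ m₂
  have n3 := norm_logField_coeff_holo m₁ m₂
  have n4 := norm_logField_coeff_anti m₁ m₂
  have hn1 : ‖conj (nn (hat f) w)‖ = 1 := by
    rw [Complex.norm_conj, nn, norm_div, Complex.norm_real, norm_norm]
    exact div_self (hpos.norm_al_pos hw).ne'
  have hna := hpos.conj_nn_mul_al hw
  have hle := hpos w hw
  rw [dz_logField (hasWirt_hat hf hw) (hasWirt_hat hg hw) m₁ m₂]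
  generalize hX1 : -2 * (psi' (coshDist (hat f w) (hat g w)) : ℂ) * ((hat g w - hat f w) *
    (conj (hat g w) - conj (hat f w)) * (conj (hat g w) - hat f w) *
      (hat g w - conj (hat f w))) / ((hat f w - conj (hat f w)) * (hat g w - conj (hat g w))) ^ 2 +
      psi (coshDist (hat f w) (hat g w)) *
      ((conj (hat g w) - hat f w + (hat g w - hat f w)) * (hat f w - conj (hat f w)) +
        (hat g w - hat f w) * (conj (hat g w) - hat f w)) /
      ((hat f w - conj (hat f w)) * (hat g w - conj (hat g w))) = X1 at *
  generalize hX3 : (conj (hat g w) - hat f w) ^ 2 / ((hat f w - conj (hat f w)) *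
    (hat g w - conj (hat g w))) * ((psi (coshDist (hat f w) (hat g w)) : ℂ) +
      psi' (coshDist (hat f w) (hat g w)) * (coshDist (hat f w) (hat g w) - 1)) = X3 at *
  generalize hX4 : (hat g w - hat f w) ^ 2 / ((hat f w - conj (hat f w)) *
    (hat g w - conj (hat g w))) * ((psi (coshDist (hat f w) (hat g w)) : ℂ) +
      psi' (coshDist (hat f w) (hat g w)) * (coshDist (hat f w) (hat g w) + 1)) = X4 at *
  generalize hX2 : 2 * (psi' (coshDist (hat f w) (hat g w)) : ℂ) *
      ((hat g w - hat f w) * (conj (hat g w) - hat f w)) ^ 2 /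
      ((hat f w - conj (hat f w)) * (hat g w - conj (hat g w))) ^ 2 = X2 at *
  have hβ : ∀ F : ℂ → ℂ, conj (be F w) = (w - conj w) * (conj (dzb F w) / (F w - conj (F w))) :=
    fun F => by
      have h1 : ∀ z : ℂ, conj z - z = -(z - conj z) := fun z => by ring
      rw [be_eq]
      simp only [map_div₀, map_mul, map_sub, Complex.conj_conj, h1]
      rw [neg_mul, neg_div_neg_eq]
      ring
  have hα : ∀ F : ℂ → ℂ, al F w = (w - conj w) * (dz F w / (F w - conj (F w))) := fun F => by
    rw [al_eq]; ring
  have hL : logField (hat f w) (hat g w) / (2 * Complex.I) = -((psi (coshDist (hat f w) (hat g w)) *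
      ((hat g w - hat f w) * (conj (hat g w) - hat f w)) /
      ((hat f w - conj (hat f w)) * (hat g w - conj (hat g w))))) := by
    rw [logField_eq]
    have e1 := sub_conj_ne m₁
    have e2 := sub_conj_ne m₂
    field_simp
  have key : w.im * (2 * Complex.I * (
      dz (hat f) w / (hat f w - conj (hat f w)) * X1 +
      conj (dzb (hat f) w) / (hat f w - conj (hat f w)) *
        (X2 - (psi (coshDist (hat f w) (hat g w)) *
        ((hat g w - hat f w) * (conj (hat g w) - hat f w)) /
        ((hat f w - conj (hat f w)) * (hat g w - conj (hat g w))))) +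
      dz (hat g) w / (hat g w - conj (hat g w)) * X3 -
      conj (dzb (hat g) w) / (hat g w - conj (hat g w)) * X4)) +
      (al (hat f) w * conj (logField (hat f w) (hat g w)) - conj (be (hat f) w) *
        logField (hat f w) (hat g w)) / (2 * Complex.I) =
      al (hat f) w * (X1 + conj (logField (hat f w) (hat g w)) / (2 * Complex.I)) +
      conj (be (hat f) w) * X2 + al (hat g) w * X3 - conj (be (hat g) w) * X4 := by
    have h2 : (2 * Complex.I * w.im : ℂ) = w - conj w := (two_I_im w).symm
    rw [sub_div, mul_div_assoc _ (logField _ _), hL, hα, hα, hβ, hβ, ← h2]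
    ring
  rw [key]
  have hre : (conj (nn (hat f) w) * (al (hat f) w * (X1 + conj (logField (hat f w) (hat g w)) /
      (2 * Complex.I)) + conj (be (hat f) w) * X2 + al (hat g) w * X3 -
      conj (be (hat g) w) * X4)) =
      (‖al (hat f) w‖ : ℂ) * (X1 + conj (logField (hat f w) (hat g w)) / (2 * Complex.I)) +
      conj (nn (hat f) w) * (conj (be (hat f) w) * X2) + conj (nn (hat f) w) * (al (hat g) w * X3) -
      conj (nn (hat f) w) * (conj (be (hat g) w) * X4) := by
    rw [← hna]; ring
  have b2 := Complex.re_le_norm (conj (nn (hat f) w) * (conj (be (hat f) w) * X2))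
  have b3 := Complex.re_le_norm (conj (nn (hat f) w) * (al (hat g) w * X3))
  have b4 := Complex.abs_re_le_norm (conj (nn (hat f) w) * (conj (be (hat g) w) * X4))
  rw [norm_mul, norm_mul, hn1, Complex.norm_conj, n2] at b2
  rw [norm_mul, norm_mul, hn1, n3] at b3
  rw [norm_mul, norm_mul, hn1, Complex.norm_conj, n4] at b4
  have b4' := (abs_le.1 b4).1
  rw [hre, Complex.sub_re, Complex.add_re, Complex.add_re, Complex.re_ofReal_mul, n1]
  have hsP : 1 ≤ coshDist (hat f w) (hat g w) * psi (coshDist (hat f w) (hat g w)) := by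
    have := mul_nonneg (show 0 ≤ coshDist (hat f w) (hat g w) ^ 2 - 1 by nlinarith)
      (neg_nonneg.2 hP')
    linarith
  have l1 := le_max_left ‖al (hat g) w‖ ‖be (hat g) w‖
  have l2 := le_max_right ‖al (hat g) w‖ ‖be (hat g) w‖
  generalize max ‖al (hat g) w‖ ‖be (hat g) w‖ = M at *
  generalize psi (coshDist (hat f w) (hat g w)) = P at *
  generalize coshDist (hat f w) (hat g w) = s at *
  nlinarith [mul_le_mul_of_nonneg_right l1 (show 0 ≤ 1 + P by linarith),
    mul_le_mul_of_nonneg_right l2 (show 0 ≤ 1 - P by linarith),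
    mul_le_mul_of_nonneg_right hle.le (show 0 ≤ s * P - 1 by linarith)]

/-- An orientation preserving solution of the Euler–Lagrange equation minimizes `F` among the maps
with the same equivariance. -/
theorem energyH2_le {Γ : Subgroup PSL(2, ℝ)} (hΓ : IsSurfaceGroup Γ) {D : Set ℍ}
    (hD : IsFundamentalDomain Γ D (volume : Measure ℍ)) {f g : ℍ → ℍ} (hf : IsSmoothH2 f)
    (hg : IsSmoothH2 g) (hpos : Pos f) (hel : ∀ w ∈ U, el (hat f) w = 0)
    (he : ∀ γ : SL(2, ℝ), (γ : PSL(2, ℝ)) ∈ Γ → ∃ k : SL(2, ℝ), (∀ p, f (γ • p) = k • f p) ∧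
      ∀ p, g (γ • p) = k • g p) : energyH2 D f ≤ energyH2 D g := by
  obtain ⟨φ, hφ⟩ := hΓ.exists_isCutoff
  have hc : ContDiff ℝ ∞ (fun z : ℂ => conj z) := Complex.conjCLE.contDiff
  have hfe : Equivariant Γ f := fun γ hγ => (he γ hγ).imp fun k hk => hk.1
  have hge : Equivariant Γ g := fun γ hγ => (he γ hγ).imp fun k hk => hk.2
  let W : ℂ → ℂ := fun w => logField (hat f w) (hat g w)
  have hF := (contDiffOn_hat hf).of_le (m := 1) ENat.LEInfty.out
  have hG := (contDiffOn_hat hg).of_le (m := 1) ENat.LEInfty.out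
  have hden : ContDiffOn ℝ 1 (fun w => 2 * (hat f w).im * (hat g w).im) U :=
    (contDiffOn_const.mul (Complex.imCLM.contDiff.comp_contDiffOn hF)).mul
      (Complex.imCLM.contDiff.comp_contDiffOn hG)
  have hden0 : ∀ w, 2 * (hat f w).im * (hat g w).im ≠ 0 := fun w =>
    (mul_pos (mul_pos two_pos (hat_im_pos f w)) (hat_im_pos g w)).ne'
  have hs : ContDiffOn ℝ 1 (fun w => coshDist (hat f w) (hat g w)) U :=
    contDiffOn_const.add (((hG.sub hF).norm_sq ℂ).div hden fun w _ => hden0 w)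
  have hW : ContDiffOn ℝ 1 W U := by
    refine contDiffOn_div ((contDiffOn_const.mul (Complex.ofRealCLM.contDiff.comp_contDiffOn
      (contDiffOn_psi.comp hs fun w _ => one_pos.trans_le (one_le_coshDist (hat_mem_U f w)
        (hat_mem_U g w))))).mul ((hG.sub hF).mul (((hc.of_le ENat.LEInfty.out).comp_contDiffOn
          hG).sub hF))) ((contDiffOn_const.mul (contDiffOn_im hF)).mul (contDiffOn_im hG))
        fun w _ => ?_
    exact_mod_cast hden0 w
  have hmain := integral_first_variation hΓ hD hφ hf hpos hW fun γ hγ => by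
    obtain ⟨k, hkf, hkg⟩ := he γ hγ
    refine ⟨k, hkf, fun p => ?_⟩
    simp only [W, hat_coe, hkf, hkg, logField_smul]
  have hzero :
      ∫ w in U, φ w * (2 * (el (hat f) w * (conj (nn (hat f) w) * W w)).re / w.im ^ 2) = 0 :=
    setIntegral_eq_zero_of_forall_eq_zero fun w hw => by simp [hel w hw]
  rw [hzero] at hmain
  have hinv : ContinuousOn (fun w : ℂ => w.im ^ 2) U := (Complex.continuous_im.pow 2).continuousOn
  have hinv0 : ∀ w ∈ U, w.im ^ 2 ≠ 0 := fun w hw => pow_ne_zero 2 (show 0 < w.im from hw).ne'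
  have hcont : ∀ h : ℍ → ℍ, IsSmoothH2 h →
      ContinuousOn (fun w => 2 * max ‖al (hat h) w‖ ‖be (hat h) w‖ / w.im ^ 2) U := fun h hh =>
    (continuousOn_const.mul ((contDiffOn_al hh).continuousOn.norm.sup
      (contDiffOn_be hh).continuousOn.norm)).div hinv hinv0
  have hcal : ContinuousOn (fun w => 2 * (conj (nn (hat f) w) * (w.im * dz W w +
      (al (hat f) w * conj (W w) - conj (be (hat f) w) * W w) / (2 * Complex.I))).re /
        w.im ^ 2) U := by
    refine (continuousOn_const.mul (Complex.continuous_re.comp_continuousOn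
      ((hc.comp_contDiffOn (contDiffOn_nn hf hpos)).continuousOn.mul
        (ContinuousOn.add ?_ (ContinuousOn.div_const (ContinuousOn.sub ?_ ?_) _))))).div hinv hinv0
    · exact (contDiffOn_im (n := ∞) contDiffOn_id).continuousOn.mul
        (contDiffOn_dz isOpen_U hW (m := 0) (by simp)).continuousOn
    · exact (contDiffOn_al hf).continuousOn.mul (hc.continuous.comp_continuousOn hW.continuousOn)
    · exact (hc.comp_contDiffOn (contDiffOn_be hf)).continuousOn.mul hW.continuousOn
  rw [energyH2_eq hΓ hD hφ hf hfe, energyH2_eq hΓ hD hφ hg hge, ← add_zero (∫ w in U, _), ← hmain,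
    ← integral_add (hφ.integrable_mul (hcont f hf)).integrableOn
      (hφ.integrable_mul hcal).integrableOn]
  refine setIntegral_mono_on ((hφ.integrable_mul (hcont f hf)).add
    (hφ.integrable_mul hcal)).integrableOn (hφ.integrable_mul (hcont g hg)).integrableOn
    isOpen_U.measurableSet fun w hw => ?_
  have hy : 0 < w.im := hw
  have h := calibration hf hg hpos hw
  rw [← mul_add, ← add_div, max_eq_left (hpos w hw).le]
  refine mul_le_mul_of_nonneg_left ?_ (hφ.nonneg w)
  gcongr
  simp only [W]
  linarith

/-! ### Projection of hyperbolic space to the invariant plane -/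

/-- The height over the vertical plane `im z = 0` divided by `t`; it is `sinh` of the signed
distance to this plane. -/
def H3.slope (x : H3) : ℝ := x.z.im / x.t

lemma H3.radius_pos (x : H3) : 0 < √(x.t ^ 2 + x.z.im ^ 2) :=
  Real.sqrt_pos.2 (by have := x.t_pos; positivity)

/-- The nearest-point projection to the totally geodesic plane `im z = 0`. -/
def H3.proj (x : H3) : ℍ := ⟨⟨x.z.re, √(x.t ^ 2 + x.z.im ^ 2)⟩, x.radius_pos⟩

lemma proj_toH3 (p : ℍ) : (toH3 p).proj = p := by
  apply UpperHalfPlane.ext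
  apply Complex.ext
  · simp [H3.proj, toH3]
  · simp [H3.proj, toH3, Real.sqrt_sq p.im_pos.le]

lemma H3.den_real (k : SL(2, ℝ)) (x : H3) :
    H3.den (toSL2C k) x = (k 1 0 * x.z.re + k 1 1) ^ 2 + (k 1 0) ^ 2 * (x.t ^ 2 + x.z.im ^ 2) := by
  simp [H3.den, toSL2C, Complex.normSq_apply]
  ring

/-- Isometries preserving the plane and its two sides preserve the signed distance to it. -/
lemma slope_act (k : SL(2, ℝ)) (x : H3) : (H3.act (toSL2C k) x).slope = x.slope := by
  have hd := H3.den_pos (toSL2C k) x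
  have ht := x.t_pos
  have hdet := Matrix.SpecialLinearGroup.det_coe k
  rw [Matrix.det_fin_two] at hdet
  have h1 : (H3.act (toSL2C k) x).z.im = x.z.im / H3.den (toSL2C k) x := by
    simp only [H3.act]
    rw [Complex.div_ofReal_im]
    congr 1
    simp [toSL2C, ← Complex.ofReal_pow]
    linear_combination x.z.im * hdet
  have h2 : (H3.act (toSL2C k) x).t = x.t / H3.den (toSL2C k) x := rfl
  rw [H3.slope, H3.slope, h1, h2]
  field_simp

lemma proj_act (k : SL(2, ℝ)) (x : H3) : (H3.act (toSL2C k) x).proj = k • x.proj := by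
  have hd := H3.den_pos (toSL2C k) x
  have hdet := Matrix.SpecialLinearGroup.det_coe k
  rw [Matrix.det_fin_two] at hdet
  have hr : √(x.t ^ 2 + x.z.im ^ 2) ^ 2 = x.t ^ 2 + x.z.im ^ 2 := Real.sq_sqrt (by positivity)
  have h1 : (H3.act (toSL2C k) x).z.im = x.z.im / H3.den (toSL2C k) x := by
    simp only [H3.act]
    rw [Complex.div_ofReal_im]
    congr 1
    simp [toSL2C, ← Complex.ofReal_pow]
    linear_combination x.z.im * hdet
  have h2 : (H3.act (toSL2C k) x).t = x.t / H3.den (toSL2C k) x := rfl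
  have h3 : √((H3.act (toSL2C k) x).t ^ 2 + (H3.act (toSL2C k) x).z.im ^ 2) =
      √(x.t ^ 2 + x.z.im ^ 2) / H3.den (toSL2C k) x := by
    rw [h1, h2, div_pow, div_pow, ← add_div, Real.sqrt_div (by positivity), Real.sqrt_sq hd.le]
  have hP : ((x.proj : ℍ) : ℂ) = ⟨x.z.re, √(x.t ^ 2 + x.z.im ^ 2)⟩ := rfl
  have hden : Complex.normSq (den k x.proj) = H3.den (toSL2C k) x := by
    rw [H3.den_real, ← hr, hP, den, Complex.normSq_apply]
    simp
    ring
  apply UpperHalfPlane.ext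
  rw [coe_smul_eq]
  apply Complex.ext
  · have e : ((H3.act (toSL2C k) x).proj : ℂ).re = (H3.act (toSL2C k) x).z.re := rfl
    rw [e, Complex.div_re, ← add_div, hden]
    simp only [H3.act]
    rw [Complex.div_ofReal_re]
    congr 1
    simp [toSL2C, ← Complex.ofReal_pow, hP, den]
    linear_combination (-k 0 0 * k 1 0) * hr
  · have e : ((H3.act (toSL2C k) x).proj : ℂ).im =
      √((H3.act (toSL2C k) x).t ^ 2 + (H3.act (toSL2C k) x).z.im ^ 2) := rfl
    rw [e, h3, Complex.div_im, ← sub_div, hden]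
    congr 1
    simp [hP, den]
    linear_combination (-√(x.t ^ 2 + x.z.im ^ 2)) * hdet

section

variable {g : ℍ → H3} (hg : IsSmoothH3 g)
include hg

lemma differentiableAt_H3 (p : ℍ) : DifferentiableAt ℝ (fun w => (g (ofComplex w)).z) (p : ℂ) ∧
    DifferentiableAt ℝ (fun w => (g (ofComplex w)).t) (p : ℂ) :=
  ⟨(hg.1.differentiableOn (by simp)).differentiableAt (U_mem_nhds (coe_mem_U p)),
    (hg.2.differentiableOn (by simp)).differentiableAt (U_mem_nhds (coe_mem_U p))⟩

lemma contDiffOn_slope : ContDiffOn ℝ ∞ (fun w => (g (ofComplex w)).slope) U :=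
  (Complex.imCLM.contDiff.comp_contDiffOn hg.1).div hg.2 fun w _ => (g (ofComplex w)).t_pos.ne'

lemma isSmoothH2_proj : IsSmoothH2 fun p => (g p).proj := by
  have h1 : ContDiffOn ℝ ∞ (fun w => √((g (ofComplex w)).t ^ 2 + (g (ofComplex w)).z.im ^ 2)) U :=
    ((ContDiffOn.pow hg.2 2).add ((Complex.imCLM.contDiff.comp_contDiffOn hg.1).pow 2)).sqrt
      fun w _ => by
        have := (g (ofComplex w)).t_pos
        change (g (ofComplex w)).t ^ 2 + (g (ofComplex w)).z.im ^ 2 ≠ 0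
        positivity
  have h2 : ContDiffOn ℝ ∞ (fun w => (((g (ofComplex w)).z.re : ℂ) +
      (√((g (ofComplex w)).t ^ 2 + (g (ofComplex w)).z.im ^ 2) : ℝ) * Complex.I)) U :=
    ((Complex.ofRealCLM.contDiff.comp Complex.reCLM.contDiff).comp_contDiffOn hg.1).add
      ((Complex.ofRealCLM.contDiff.comp_contDiffOn h1).mul contDiffOn_const)
  refine h2.congr fun w _ => ?_
  apply Complex.ext <;> simp [H3.proj]

lemma diff_proj (p : ℍ) (h : ℂ) : diffH2 (fun p => (g p).proj) p h =
    ⟨(diff (fun q => (g q).z) p h).re, ((g p).t * diff (fun q => (g q).t) p h +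
      (g p).z.im * (diff (fun q => (g q).z) p h).im) / √((g p).t ^ 2 + (g p).z.im ^ 2)⟩ := by
  obtain ⟨hz, ht⟩ := differentiableAt_H3 hg p
  have hp := (contDiffOn_hat (isSmoothH2_proj hg)).differentiableOn (by simp)
  have hd := (hp.differentiableAt (U_mem_nhds (coe_mem_U p))).hasFDerivAt
  have hz' := hz.hasFDerivAt
  have ht' := ht.hasFDerivAt
  have hne : (g (ofComplex (p : ℂ))).t ^ 2 + (g (ofComplex (p : ℂ))).z.im ^ 2 ≠ 0 := by
    have := (g (ofComplex (p : ℂ))).t_pos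
    positivity
  have r1 := Complex.reCLM.hasFDerivAt.comp (p : ℂ) hd
  have r2 := Complex.reCLM.hasFDerivAt.comp (p : ℂ) hz'
  have i1 := Complex.imCLM.hasFDerivAt.comp (p : ℂ) hd
  have i0 := Complex.imCLM.hasFDerivAt.comp (p : ℂ) hz'
  have i2 := ((ht'.pow 2).add (i0.pow 2)).sqrt (by simpa using hne)
  have e1 := DFunLike.congr_fun (HasFDerivAt.unique r1 r2) h
  have e2 := DFunLike.congr_fun (HasFDerivAt.unique i1 i2) h
  apply Complex.ext
  · exact e1
  · refine Eq.trans e2 ?_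
    simp [diff]
    ring

lemma diff_slope (p : ℍ) (h : ℂ) : diff (fun q => (g q).slope) p h =
    ((diff (fun q => (g q).z) p h).im * (g p).t - (g p).z.im * diff (fun q => (g q).t) p h) /
      (g p).t ^ 2 := by
  obtain ⟨hz, ht⟩ := differentiableAt_H3 hg p
  have i0 := Complex.imCLM.hasFDerivAt.comp (p : ℂ) hz.hasFDerivAt
  have ht0 : (g (ofComplex (p : ℂ))).t ≠ 0 := (g (ofComplex (p : ℂ))).t_pos.ne'
  have i1 : HasFDerivAt (fun w => ((g (ofComplex w)).t)⁻¹) _ (p : ℂ) :=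
    (hasDerivAt_inv ht0).comp_hasFDerivAt (p : ℂ) ht.hasFDerivAt
  have h1 := (i0.mul i1).fderiv
  have h2 := DFunLike.congr_fun h1 h
  rw [ofComplex_apply] at ht0
  refine Eq.trans h2 ?_
  simp [diff]
  field_simp
  ring

/-- The metric of hyperbolic 3-space in Fermi coordinates about the plane: with `s = sinh d` it is
`(1 + s²) · (metric of the plane) + ds² / (1 + s²)`. -/
lemma pullH3_eq (p : ℍ) (h k : ℂ) : pullH3 g p h k =
    (1 + (g p).slope ^ 2) * pullH2 (fun q => (g q).proj) p h k +
      1 / (1 + (g p).slope ^ 2) * (diff (fun q => (g q).slope) p h *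
        diff (fun q => (g q).slope) p k) := by
  have ht := (g p).t_pos
  have hr : √((g p).t ^ 2 + (g p).z.im ^ 2) ^ 2 = (g p).t ^ 2 + (g p).z.im ^ 2 :=
    Real.sq_sqrt (by positivity)
  have him : (g p).proj.im = √((g p).t ^ 2 + (g p).z.im ^ 2) := rfl
  have hr0 := (g p).radius_pos
  rw [pullH2_apply, diff_proj hg, diff_proj hg, diff_slope hg, diff_slope hg, him, hr, H3.slope]
  generalize √((g p).t ^ 2 + (g p).z.im ^ 2) = R at *
  have hl : pullH3 g p h k = ((diff (fun q => (g q).z) p h).re * (diff (fun q => (g q).z) p k).re +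
      (diff (fun q => (g q).z) p h).im * (diff (fun q => (g q).z) p k).im +
      diff (fun q => (g q).t) p h * diff (fun q => (g q).t) p k) / (g p).t ^ 2 := by
    simp [pullH3, pullInner, innerₗ_apply_apply, Complex.inner]
    ring
  rw [hl]
  generalize diff (fun q => (g q).z) p h = z1
  generalize diff (fun q => (g q).z) p k = z2
  generalize diff (fun q => (g q).t) p h = t1
  generalize diff (fun q => (g q).t) p k = t2
  generalize (g p).t = T at *
  generalize (g p).z.im = Y at *
  have e : (T ^ 2 + Y ^ 2) ≠ 0 := by positivity
  simp only [Complex.mul_re, Complex.conj_re, Complex.conj_im]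
  have e2 : (T * t1 + Y * z1.im) / R * -((T * t2 + Y * z2.im) / R) =
      -((T * t1 + Y * z1.im) * (T * t2 + Y * z2.im)) / (T ^ 2 + Y ^ 2) := by
    rw [← hr]; field_simp
  rw [e2]
  field_simp
  ring

end

/-! ### Projection to the invariant plane decreases the functional -/

lemma form_det_nonneg {G : Form} (hsymm : ∀ v w, G v w = G w v) (hnn : ∀ v, 0 ≤ G v v) :
    G 1 Complex.I * G Complex.I 1 ≤ G 1 1 * G Complex.I Complex.I := by
  have h : ∀ x : ℝ, 0 ≤ G 1 1 * (x * x) + (2 * G 1 Complex.I) * x + G Complex.I Complex.I :=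
    fun x => by
      have := hnn (x • (1 : ℂ) + Complex.I)
      simp only [map_add, map_smul, LinearMap.add_apply, LinearMap.smul_apply, smul_eq_mul,
        hsymm Complex.I 1] at this
      linarith
  have := discrim_le_zero h
  rw [discrim] at this
  rw [hsymm Complex.I 1]
  linarith

/-- The trace of the root is monotone in the form. -/
lemma traceRoot_mono (p : ℍ) {G H : Form} (hG : ∀ v w, G v w = G w v) (hG0 : ∀ v, 0 ≤ G v v)
    (hH : ∀ v w, H v w = H w v) (hle : ∀ v, G v v ≤ H v v) : traceRoot p G ≤ traceRoot p H := by
  have hH0 : ∀ v, 0 ≤ H v v := fun v => (hG0 v).trans (hle v)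
  have hN : ∀ v w, (H - G) v w = (H - G) w v := fun v w => by
    simp only [LinearMap.sub_apply, hG v w, hH v w]
  have hN0 : ∀ v, 0 ≤ (H - G) v v := fun v => by
    simpa only [LinearMap.sub_apply] using sub_nonneg.2 (hle v)
  have d1 := form_det_nonneg hG hG0
  have d2 := form_det_nonneg hN hN0
  have a1 := hN0 1
  have a2 := hN0 Complex.I
  have b1 := hG0 1
  have b2 := hG0 Complex.I
  rw [traceRoot_eq_sqrt p G hG hG0, traceRoot_eq_sqrt p H hH hH0]
  simp only [LinearMap.sub_apply] at d2 a1 a2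
  rw [hG Complex.I 1] at d1 d2 ⊢
  rw [hH Complex.I 1] at d2 ⊢
  have l1 := hle 1
  have l2 := hle Complex.I
  have hdet : G 1 1 * G Complex.I Complex.I - G 1 Complex.I * G 1 Complex.I ≤
      H 1 1 * H Complex.I Complex.I - H 1 Complex.I * H 1 Complex.I := by
    generalize G 1 1 = A at *
    generalize G Complex.I Complex.I = C at *
    generalize G 1 Complex.I = B at *
    obtain ⟨A', hA'⟩ : ∃ A', A' = H 1 1 - A := ⟨_, rfl⟩
    obtain ⟨C', hC'⟩ : ∃ C', C' = H Complex.I Complex.I - C := ⟨_, rfl⟩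
    obtain ⟨B', hB'⟩ : ∃ B', B' = H 1 Complex.I - B := ⟨_, rfl⟩
    rw [← hA', ← hB', ← hC'] at d2
    rw [← hA'] at a1
    rw [← hC'] at a2
    -- the mixed discriminant of two non-negative forms is non-negative
    have hmix : 2 * (B * B') ≤ A * C' + C * A' := by
      have hsq : (2 * (B * B')) ^ 2 ≤ (A * C' + C * A') ^ 2 := by
        have h1 : (B * B) * (B' * B') ≤ (A * C) * (A' * C') :=
          mul_le_mul d1 d2 (mul_self_nonneg _) (mul_nonneg b1 b2)
        nlinarith [sq_nonneg (A * C' - C * A')]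
      exact (le_abs_self _).trans (abs_le_of_sq_le_sq hsq (by positivity))
    have e1 : H 1 1 = A + A' := by linarith
    have e2 : H Complex.I Complex.I = C + C' := by linarith
    have e3 : H 1 Complex.I = B + B' := by linarith
    rw [e1, e2, e3]
    nlinarith
  have hs := Real.sqrt_le_sqrt hdet
  refine Real.sqrt_le_sqrt (mul_le_mul_of_nonneg_left ?_ (sq_nonneg _))
  linarith

/-- The gradient of `slope` along the map, in the frame `y ∂`. -/
def slopeGrad (g : ℍ → H3) (w : ℂ) : ℂ := w.im * dzb (fun z => ((g (ofComplex z)).slope : ℂ)) w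

section

variable {g : ℍ → H3} (hg : IsSmoothH3 g)
include hg

lemma contDiffOn_slopeC : ContDiffOn ℝ ∞ (fun w => ((g (ofComplex w)).slope : ℂ)) U :=
  Complex.ofRealCLM.contDiff.comp_contDiffOn (contDiffOn_slope hg)

lemma contDiffOn_slopeGrad : ContDiffOn ℝ ∞ (slopeGrad g) U :=
  (contDiffOn_im contDiffOn_id).mul (contDiffOn_dzb isOpen_U (contDiffOn_slopeC hg) (by simp))

lemma diff_slope_frame (p : ℍ) (h : ℂ) :
    diff (fun q => (g q).slope) p (p.im * h) = 2 * (conj (slopeGrad g p) * h).re := by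
  have hd := ((contDiffOn_slope hg).differentiableOn (by simp)).differentiableAt
    (U_mem_nhds (coe_mem_U p))
  have h1 := (Complex.ofRealCLM.hasFDerivAt.comp (p : ℂ) hd.hasFDerivAt).fderiv
  have h2 : fderiv ℝ (fun w => ((g (ofComplex w)).slope : ℂ)) (p : ℂ) =
    Complex.ofRealCLM.comp (diff (fun q => (g q).slope) p) := h1
  have h4 : ∀ h : ℂ, diff (fun q => (g q).slope) p h = h.re * diff (fun q => (g q).slope) p 1 +
      h.im * diff (fun q => (g q).slope) p Complex.I := fun h => by
    rw [← smul_eq_mul, ← smul_eq_mul, ← map_smul, ← map_smul, ← map_add]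
    congr 1
    apply Complex.ext <;> simp
  have h5 : dzb (fun w => ((g (ofComplex w)).slope : ℂ)) p =
      ⟨diff (fun q => (g q).slope) p 1 / 2, diff (fun q => (g q).slope) p Complex.I / 2⟩ := by
    rw [dzb, h2]
    apply Complex.ext <;> simp
  rw [slopeGrad, h5, h4]
  simp
  ring

lemma traceRoot_pullH3 (p : ℍ) : traceRoot p (pullH3 g p) =
    √(2 * (1 + (g p).slope ^ 2) * (‖al (hat fun q => (g q).proj) p‖ ^ 2 +
        ‖be (hat fun q => (g q).proj) p‖ ^ 2) +
      4 / (1 + (g p).slope ^ 2) * ‖slopeGrad g p‖ ^ 2 +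
      2 * √((1 + (g p).slope ^ 2) ^ 2 * (‖al (hat fun q => (g q).proj) p‖ ^ 2 -
        ‖be (hat fun q => (g q).proj) p‖ ^ 2) ^ 2 +
        4 * ‖al (hat fun q => (g q).proj) p * slopeGrad g p -
          be (hat fun q => (g q).proj) p * conj (slopeGrad g p)‖ ^ 2)) := by
  have hy : 0 < p.im := p.im_pos
  have hc : 0 < 1 + (g p).slope ^ 2 := by positivity
  have hsymm : ∀ v w, pullH3 g p v w = pullH3 g p w v := fun v w => by
    rw [pullH3_eq hg, pullH3_eq hg, pullH2_symm]; ring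
  have hnn : ∀ v, 0 ≤ pullH3 g p v v := fun v => by
    rw [pullH3_eq hg]
    have := pullH2_nonneg (fun q => (g q).proj) p v
    have := mul_self_nonneg (diff (fun q => (g q).slope) p v)
    positivity
  have e : ∀ v w, p.im ^ 2 * pullH3 g p v w = _ := fun v w => by
    rw [form_one_one, pullH3_eq hg, pullH2_frame, diff_slope_frame hg, diff_slope_frame hg]
  have hroot : ∀ d : ℝ, p.im ^ 2 * (2 * √d) = 2 * √((p.im ^ 2) ^ 2 * d) := fun d => by
    rw [Real.sqrt_mul (by positivity), Real.sqrt_sq (by positivity)]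
    ring
  rw [traceRoot_eq_sqrt p _ hsymm hnn, mul_add, mul_add, e, e, hroot]
  have hdet : (p.im ^ 2) ^ 2 * (pullH3 g p 1 1 * pullH3 g p Complex.I Complex.I -
      pullH3 g p 1 Complex.I * pullH3 g p Complex.I 1) =
      (p.im ^ 2 * pullH3 g p 1 1) * (p.im ^ 2 * pullH3 g p Complex.I Complex.I) -
      (p.im ^ 2 * pullH3 g p 1 Complex.I) * (p.im ^ 2 * pullH3 g p Complex.I 1) := by ring
  rw [hdet, e, e, e, e]
  generalize al (hat fun q => (g q).proj) p = α
  generalize be (hat fun q => (g q).proj) p = β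
  generalize slopeGrad g p = σ
  generalize (g p).slope = s at *
  congr 2
  · simp only [norm_sq_eq]
    simp
    field_simp
    ring
  · congr 2
    simp only [norm_sq_eq]
    simp
    field_simp
    ring

variable {γ k : SL(2, ℝ)} (hk : ∀ p, g (γ • p) = H3.act (toSL2C k) (g p))
include hk

/-- `slopeGrad` transforms like a tangent vector of the source. -/
lemma slopeGrad_smul (p : ℍ) : slopeGrad g ((γ • p : ℍ) : ℂ) = rot γ p * slopeGrad g p := by
  have hp := coe_mem_U p
  have h1 : HasWirt (fun z => ((g (ofComplex z)).slope : ℂ)) _ _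
      ((γ • ofComplex (p : ℂ) : ℍ) : ℂ) :=
    hasWirt_of_differentiableAt (((contDiffOn_slopeC hg).differentiableOn
        (by simp)).differentiableAt
      (U_mem_nhds (coe_mem_U _)))
  have h2 := HasWirt.comp_holo (g := fun w => ((γ • ofComplex w : ℍ) : ℂ)) h1 (hasDerivAt_smul γ hp)
  have he : (fun w => ((g (ofComplex ((γ • ofComplex w : ℍ) : ℂ))).slope : ℂ)) =
      fun w => ((g (ofComplex w)).slope : ℂ) := by
    funext w
    rw [ofComplex_apply, hk, slope_act]
  rw [he] at h2
  have i2 := h2.dzb_eq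
  have d1 := den_ne_zero γ hp
  have d1' : conj (den γ p) ≠ 0 := by simpa using d1
  rw [slopeGrad, slopeGrad, i2, im_smul_eq, rot]
  simp only [ofComplex_apply, map_div₀, map_one, map_pow]
  field_simp

omit hg in
lemma proj_smul (p : ℍ) : (g (γ • p)).proj = k • (g p).proj := by rw [hk, proj_act]

lemma traceRoot_pullH3_smul (p : ℍ) :
    traceRoot (γ • p) (pullH3 g (γ • p)) = traceRoot p (pullH3 g p) := by
  have hs : (g (γ • p)).slope = (g p).slope := by rw [hk, slope_act]
  have hπ := isSmoothH2_proj hg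
  have h2 := rot_mul_conj γ (coe_mem_U p)
  have e : al (hat fun q => (g q).proj) ((γ • p : ℍ) : ℂ) * slopeGrad g ((γ • p : ℍ) : ℂ) -
      be (hat fun q => (g q).proj) ((γ • p : ℍ) : ℂ) * conj (slopeGrad g ((γ • p : ℍ) : ℂ)) =
      rot k (g p).proj * (al (hat fun q => (g q).proj) p * slopeGrad g p -
        be (hat fun q => (g q).proj) p * conj (slopeGrad g p)) := by
    rw [al_smul hπ (proj_smul hk), be_smul hπ (proj_smul hk), slopeGrad_smul hg hk, map_mul]
    linear_combination (rot k (g p).proj * (al (hat fun q => (g q).proj) p * slopeGrad g p -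
        be (hat fun q => (g q).proj) p * conj (slopeGrad g p))) * h2
  rw [traceRoot_pullH3 hg, traceRoot_pullH3 hg, e, norm_al_smul hπ (proj_smul hk),
    norm_be_smul hπ (proj_smul hk), hs, slopeGrad_smul hg hk, norm_mul, norm_mul, norm_rot k
      (coe_mem_U _), norm_rot γ (coe_mem_U _), one_mul, one_mul]

omit hk

lemma traceRoot_proj_le (p : ℍ) :
    traceRoot p (pullH2 (fun q => (g q).proj) p) ≤ traceRoot p (pullH3 g p) := by
  refine traceRoot_mono p (pullH2_symm _ p) (pullH2_nonneg _ p) (fun v w => ?_) fun v => ?_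
  · rw [pullH3_eq hg, pullH3_eq hg, pullH2_symm]; ring
  · rw [pullH3_eq hg]
    have h1 := pullH2_nonneg (fun q => (g q).proj) p v
    have h2 := mul_self_nonneg (diff (fun q => (g q).slope) p v)
    have h3 : 0 ≤ 1 / (1 + (g p).slope ^ 2) * (diff (fun q => (g q).slope) p v *
      diff (fun q => (g q).slope) p v) := by positivity
    nlinarith [sq_nonneg (g p).slope]

lemma continuous_traceRoot_pullH3 : Continuous fun p => traceRoot p (pullH3 g p) := by
  have hπ := isSmoothH2_proj hg
  have h1 := (contDiffOn_al hπ).continuousOn.comp_continuous UpperHalfPlane.continuous_coe coe_mem_U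
  have h2 := (contDiffOn_be hπ).continuousOn.comp_continuous UpperHalfPlane.continuous_coe coe_mem_U
  have h3 := (contDiffOn_slopeGrad hg).continuousOn.comp_continuous UpperHalfPlane.continuous_coe
    coe_mem_U
  have h4 : Continuous fun p => (g p).slope := by
    have := (contDiffOn_slope hg).continuousOn.comp_continuous UpperHalfPlane.continuous_coe
        coe_mem_U
    exact this.congr fun p => by simp
  have h5 : Continuous fun p => 1 + (g p).slope ^ 2 := continuous_const.add (h4.pow 2)
  simp only [traceRoot_pullH3 hg]
  refine Continuous.sqrt (((((continuous_const.mul h5).mul ((h1.norm.pow 2).add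
    (h2.norm.pow 2))).add ((continuous_const.div h5 fun p => ?_).mul (h3.norm.pow 2))).add
    (continuous_const.mul (Continuous.sqrt (((h5.pow 2).mul (((h1.norm.pow 2).sub
      (h2.norm.pow 2)).pow 2)).add (continuous_const.mul
        (((h1.mul h3).sub (h2.mul (Complex.continuous_conj.comp h3))).norm.pow 2)))))))
  positivity

end

/-- The projection to the invariant plane does not increase the functional. -/
theorem energyH2_proj_le {Γ : Subgroup PSL(2, ℝ)} (hΓ : IsSurfaceGroup Γ) {D : Set ℍ}
    (hD : IsFundamentalDomain Γ D (volume : Measure ℍ)) {g : ℍ → H3} (hg : IsSmoothH3 g)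
    (he : ∀ γ : SL(2, ℝ), (γ : PSL(2, ℝ)) ∈ Γ → ∃ k : SL(2, ℝ),
      ∀ p, g (γ • p) = H3.act (toSL2C k) (g p)) :
    energyH2 D (fun p => (g p).proj) ≤ energyH3 D g := by
  obtain ⟨φ, hφ⟩ := hΓ.exists_isCutoff
  have := hΓ.countable
  have hπ := isSmoothH2_proj hg
  have hπe : Equivariant Γ fun p => (g p).proj := fun γ hγ =>
    (he γ hγ).imp fun k hk => proj_smul hk
  have hy : ContinuousOn (fun w : ℂ => w.im ^ 2) U := (Complex.continuous_im.pow 2).continuousOn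
  have hy0 : ∀ w ∈ U, w.im ^ 2 ≠ 0 := fun w hw => pow_ne_zero 2 (show 0 < w.im from hw).ne'
  have hcont := continuous_traceRoot_pullH3 hg
  rw [energyH2_eq hΓ hD hφ hπ hπe, energyH3, hφ.setIntegral_eq hD
    (h := fun p => traceRoot p (pullH3 g p)) hcont fun γ p => by
      obtain ⟨c, hc⟩ := exists_rep (γ : PSL(2, ℝ))
      obtain ⟨k, hk⟩ := he c (by rw [hc]; exact γ.2)
      have hs : γ • p = c • p := by
        change (γ : PSL(2, ℝ)) • p = _
        rw [← hc, mk_smul]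
      rw [hs, traceRoot_pullH3_smul hg hk]]
  refine setIntegral_mono_on (hφ.integrable_mul (ContinuousOn.div ?_ hy hy0)).integrableOn
    (hφ.integrable_mul ((continuousOn_ofComplex hcont).div hy hy0)).integrableOn
    isOpen_U.measurableSet fun w hw => ?_
  · exact continuousOn_const.mul ((contDiffOn_al hπ).continuousOn.norm.sup
      (contDiffOn_be hπ).continuousOn.norm)
  · have h := traceRoot_proj_le hg (ofComplex w)
    rw [traceRoot_pullH2, coe_ofComplex hw] at h
    exact mul_le_mul_of_nonneg_left (div_le_div_of_nonneg_right h (sq_nonneg _)) (hφ.nonneg w)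

lemma isSmoothH3_toH3 {f : ℍ → ℍ} (hf : IsSmoothH2 f) : IsSmoothH3 fun p => toH3 (f p) :=
  ⟨(Complex.ofRealCLM.contDiff.comp Complex.reCLM.contDiff).comp_contDiffOn hf,
    Complex.imCLM.contDiff.comp_contDiffOn hf⟩

lemma energyH3_toH3 {f : ℍ → ℍ} (hf : IsSmoothH2 f) (D : Set ℍ) :
    energyH3 D (fun p => toH3 (f p)) = energyH2 D f := by
  have h : ∀ p, pullH3 (fun p => toH3 (f p)) p = pullH2 f p := fun p => by
    have hs : ∀ q, (toH3 (f q)).slope = 0 := fun q => by simp [H3.slope, toH3]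
    refine LinearMap.ext₂ fun v w => ?_
    rw [pullH3_eq (isSmoothH3_toH3 hf)]
    simp only [hs, proj_toH3]
    simp [diff]
  simp only [energyH3, energyH2, h]

/-! ### Equivariant local diffeomorphisms are diffeomorphisms -/

section Covering
variable {E X : Type*} [TopologicalSpace E] [MetricSpace X] {f : E → X}

/-- A local section of `f` through `p`, defined on the ball of radius `r` about `f p`. -/
def HasSection (f : E → X) (r : ℝ) (p : E) : Prop :=
  ∃ s : X → E, ContinuousOn s (Metric.ball (f p) r) ∧ s (f p) = p ∧
    ∀ q ∈ Metric.ball (f p) r, f (s q) = q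

lemma HasSection.mono {r r' : ℝ} {p : E} (h : HasSection f r p) (hr : r' ≤ r) :
    HasSection f r' p := by
  obtain ⟨s, h1, h2, h3⟩ := h
  have hb := Metric.ball_subset_ball hr (x := f p)
  exact ⟨s, h1.mono hb, h2, fun q hq => h3 q (hb hq)⟩

lemma exists_hasSection_of_isCompact (hf : IsLocalHomeomorph f) {K : Set E} (hK : IsCompact K) :
    ∃ r > 0, ∀ p ∈ K, HasSection f r p := by
  refine hK.induction_on (p := fun S => ∃ r > 0, ∀ p ∈ S, HasSection f r p)
    ⟨1, one_pos, by simp⟩ ?_ ?_ ?_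
  · rintro S T hST ⟨r, hr, h⟩
    exact ⟨r, hr, fun p hp => h p (hST hp)⟩
  · rintro S T ⟨r, hr, h⟩ ⟨r', hr', h'⟩
    refine ⟨min r r', lt_min hr hr', ?_⟩
    rintro p (hp | hp)
    · exact (h p hp).mono (min_le_left _ _)
    · exact (h' p hp).mono (min_le_right _ _)
  · intro p _
    obtain ⟨e, hp, rfl⟩ := hf p
    obtain ⟨r, hr, hball⟩ := Metric.isOpen_iff.1 e.open_target (e p) (e.map_source hp)
    refine ⟨e.source ∩ e ⁻¹' Metric.ball (e p) (r / 2), mem_nhdsWithin_of_mem_nhds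
      (Filter.inter_mem (e.open_source.mem_nhds hp)
      (hf.continuous.continuousAt.preimage_mem_nhds (Metric.ball_mem_nhds _ (half_pos hr)))),
      r / 2, half_pos hr, ?_⟩
    rintro q ⟨hq, hq'⟩
    have hsub : Metric.ball (e q) (r / 2) ⊆ e.target := by
      refine (Metric.ball_subset_ball' ?_).trans hball
      have := Metric.mem_ball.1 hq'
      linarith
    exact ⟨e.symm, e.continuousOn_symm.mono hsub, e.left_inv hq, fun x hx => e.right_inv (hsub hx)⟩

/-- Paths lift along a map which has local sections on balls of a uniform radius. -/
lemma exists_path_lift {r : ℝ} (hr : 0 < r) (hs : ∀ p, HasSection f r p) {γ : ℝ → X}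
    (hγ : Continuous γ) {p : E} (hp : f p = γ 0) :
    ∃ g : ℝ → E, ContinuousOn g (Set.Icc 0 1) ∧ g 0 = p ∧
        ∀ t ∈ Set.Icc (0 : ℝ) 1, f (g t) = γ t := by
  have hu := (isCompact_Icc (a := (0 : ℝ)) (b := 1)).uniformContinuousOn_of_continuous
    hγ.continuousOn
  obtain ⟨δ, hδ, hd⟩ := Metric.uniformContinuousOn_iff.1 hu r hr
  obtain ⟨N, hN⟩ := exists_nat_one_div_lt hδ
  set h : ℝ := 1 / ((N : ℝ) + 1) with hh
  have hh0 : 0 < h := by positivity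
  have key : ∀ n : ℕ, n * h ≤ 1 → ∃ g : ℝ → E, ContinuousOn g (Set.Icc 0 (n * h)) ∧ g 0 = p ∧
      ∀ t ∈ Set.Icc (0 : ℝ) (n * h), f (g t) = γ t := by
    intro n
    induction n with
    | zero =>
      intro _
      refine ⟨fun _ => p, continuousOn_const, rfl, fun t ht => ?_⟩
      simp at ht
      rw [ht, hp]
    | succ n ih =>
      intro hn
      push_cast at hn ⊢
      have hn0 : (0 : ℝ) ≤ n * h := by positivity
      have hn1 : n * h ≤ 1 := by nlinarith
      obtain ⟨g, hg, hg0, hgl⟩ := ih hn1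
      obtain ⟨s, hsc, hs0, hsl⟩ := hs (g (n * h))
      have hgn := hgl (n * h) ⟨hn0, le_rfl⟩
      rw [hgn] at hsc hs0 hsl
      have hball : ∀ t ∈ Set.Icc (n * h) ((n + 1) * h), γ t ∈ Metric.ball (γ (n * h)) r := by
        rintro t ⟨ht1, ht2⟩
        refine hd t ⟨by linarith, by linarith⟩ _ ⟨hn0, hn1⟩ ?_
        rw [Real.dist_eq, abs_of_nonneg (by linarith)]
        linarith
      refine ⟨fun t => if t ≤ n * h then g t else s (γ t), ?_, ?_, ?_⟩
      · have e : Set.Icc 0 ((n + 1) * h) = Set.Icc 0 (n * h) ∪ Set.Icc (n * h) ((n + 1) * h) :=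
          (Set.Icc_union_Icc_eq_Icc hn0 (by linarith)).symm
        rw [e]
        refine ContinuousOn.union_of_isClosed (hg.congr fun t ht => if_pos ht.2)
          ((hsc.comp hγ.continuousOn hball).congr fun t ht => ?_) isClosed_Icc isClosed_Icc
        by_cases h1 : t ≤ n * h
        · have : t = n * h := le_antisymm h1 ht.1
          subst this
          simp [hs0]
        · simp [h1]
      · simp [hn0, hg0]
      · rintro t ⟨ht1, ht2⟩
        by_cases h1 : t ≤ n * h
        · simp only [h1, if_true]
          exact hgl t ⟨ht1, h1⟩
        · simp only [h1, if_false]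
          exact hsl _ (hball t ⟨(not_le.1 h1).le, ht2⟩)
  have e : ((N + 1 : ℕ) : ℝ) * h = 1 := by
    rw [hh]
    push_cast
    field_simp
  have := key (N + 1) e.le
  rwa [e] at this

/-- A local homeomorphism onto a contractible metric space, with local sections on balls of a
uniform radius, is bijective. -/
theorem bijective_of_hasSection [T2Space E] [ConnectedSpace E]
    [ContractibleSpace X] (hf : IsLocalHomeomorph f) {r : ℝ} (hr : 0 < r)
    (hs : ∀ p, HasSection f r p) : Function.Bijective f := by
  have hsurj : Function.Surjective f := by
    intro y
    obtain ⟨p⟩ : Nonempty E := inferInstance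
    obtain ⟨γ⟩ : Joined (f p) y := PathConnectedSpace.joined _ _
    obtain ⟨g, -, -, hg⟩ := exists_path_lift hr hs (γ := γ.extend) γ.continuous_extend (p := p)
      (by simp)
    exact ⟨g 1, by rw [hg 1 ⟨zero_le_one, le_rfl⟩]; simp⟩
  obtain ⟨y, ⟨H⟩⟩ := id_nullhomotopic X
  obtain ⟨p, hp⟩ := hsurj y
  -- lifting the contraction of `X` to `y` gives a continuous section of `f`
  have hlift : ∀ x : X, ∃ g : unitInterval → E, Continuous g ∧ g 0 = p ∧
      ∀ t, f (g t) = H.symm (t, x) := by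
    intro x
    let γ : Path y x := (H.symm.evalAt x)
    obtain ⟨g, hg, hg0, hgl⟩ := exists_path_lift hr hs (γ := γ.extend) γ.continuous_extend (p := p)
      (by simp [hp])
    refine ⟨fun t => g t, hg.comp_continuous continuous_subtype_val fun t => t.2, hg0, fun t => ?_⟩
    rw [hgl t t.2, Path.extend_apply γ t.2]
    rfl
  choose g hgc hg0 hgl using hlift
  have hcont := hf.continuous_lift (T2Space.isSeparatedMap f) H.symm.toContinuousMap
    (g := fun q => g q.2 q.1) (by ext q; exact hgl q.2 q.1)
    (by simp only [hg0]; exact continuous_const) hgc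
  let s : X → E := fun x => g x 1
  have hsc : Continuous s := hcont.comp (Continuous.prodMk_right (1 : unitInterval))
  have hfs : ∀ x, f (s x) = x := fun x => by
    change f (g x 1) = x
    rw [hgl]
    simp
  have hsf : s ∘ f = id := (T2Space.isSeparatedMap f).eq_of_comp_eq hf.isLocallyInjective
    (hsc.comp hf.continuous) continuous_id (by ext x; simp [hfs]) (s y) (by simp [hfs])
  exact ⟨Function.LeftInverse.injective fun x => congrFun hsf x, hsurj⟩

end Covering

lemma IsSmoothH2.continuous {f : ℍ → ℍ} (hf : IsSmoothH2 f) : Continuous f := by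
  rw [UpperHalfPlane.isEmbedding_coe.continuous_iff]
  have h := (contDiffOn_hat hf).continuousOn.comp_continuous UpperHalfPlane.continuous_coe
    coe_mem_U
  exact h.congr fun p => hat_coe f p

/-- A smooth map of the hyperbolic plane with invertible differentials is a local
homeomorphism. -/
lemma isLocalHomeomorph_of_bijective {f : ℍ → ℍ} (hf : IsSmoothH2 f)
    (hb : ∀ p, Function.Bijective (diffH2 f p)) : IsLocalHomeomorph f := by
  have hc := hf.continuous
  have hF : IsLocalHomeomorphOn (hat f) U := by
    refine IsLocalHomeomorphOn.mk _ _ fun w hw => ?_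
    have hd : ContDiffAt ℝ ∞ (hat f) w := (contDiffOn_hat hf).contDiffAt (U_mem_nhds hw)
    have hbw : Function.Bijective (fderiv ℝ (hat f) w) := by
      have := hb ⟨w, hw⟩
      exact this
    let L : ℂ ≃L[ℝ] ℂ := (LinearEquiv.ofBijective (fderiv ℝ (hat f) w : ℂ →ₗ[ℝ] ℂ)
      hbw).toContinuousLinearEquiv
    have hL : HasFDerivAt (hat f) (L : ℂ →L[ℝ] ℂ) w :=
      (hd.differentiableAt (by simp)).hasFDerivAt
    exact ⟨hd.toOpenPartialHomeomorph (hat f) hL (by simp),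
      hd.mem_toOpenPartialHomeomorph_source hL (by simp), fun _ _ => rfl⟩
  refine IsLocalHomeomorph.of_comp (g := ((↑) : ℍ → ℂ)) ?_
    UpperHalfPlane.isOpenEmbedding_coe.isLocalHomeomorph hc
  have e : ((↑) : ℍ → ℂ) ∘ f = hat f ∘ ((↑) : ℍ → ℂ) := by
    ext p
    exact (hat_coe f p).symm
  rw [e, isLocalHomeomorph_iff_isLocalHomeomorphOn_univ]
  exact hF.comp UpperHalfPlane.isOpenEmbedding_coe.isLocalHomeomorph.isLocalHomeomorphOn
    fun p _ => coe_mem_U p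

lemma psl_dist (g : PSL(2, ℝ)) (p q : ℍ) : dist (g • p) (g • q) = dist p q := by
  obtain ⟨k, rfl⟩ := exists_rep g
  exact dist_smul k p q

/-- Sections are moved around by the deck transformations. -/
lemma HasSection.smul {f : ℍ → ℍ} {r : ℝ} {p : ℍ} (h : HasSection f r p) {γ k : PSL(2, ℝ)}
    (hk : ∀ q, f (γ • q) = k • f q) : HasSection f r (γ • p) := by
  obtain ⟨s, h1, h2, h3⟩ := h
  have hm : ∀ q ∈ Metric.ball (f (γ • p)) r, k⁻¹ • q ∈ Metric.ball (f p) r := by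
    intro q hq
    rw [hk, Metric.mem_ball] at hq
    rw [Metric.mem_ball, ← psl_dist k, smul_inv_smul]
    exact hq
  refine ⟨fun q => γ • s (k⁻¹ • q), ?_, ?_, ?_⟩
  · exact (h1.comp (continuous_const_smul _).continuousOn hm).const_smul γ
  · simp [hk, h2]
  · intro q hq
    rw [hk, h3 _ (hm q hq), smul_inv_smul]

/-- A smooth map with invertible differentials which is equivariant under a cocompact group is
bijective. -/
theorem IsSurfaceGroup.bijective {Γ : Subgroup PSL(2, ℝ)} (hΓ : IsSurfaceGroup Γ) {f : ℍ → ℍ}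
    (hf : IsSmoothH2 f) (hb : ∀ p, Function.Bijective (diffH2 f p))
    (he : ∀ γ ∈ Γ, ∃ k : PSL(2, ℝ), ∀ p, f (γ • p) = k • f p) : Function.Bijective f := by
  have hl := isLocalHomeomorph_of_bijective hf hb
  obtain ⟨K, hK, hcov⟩ := hΓ.cocompact
  obtain ⟨r, hr, hs⟩ := exists_hasSection_of_isCompact hl hK
  refine bijective_of_hasSection hl hr fun p => ?_
  obtain ⟨γ, hγ, hp⟩ := hcov p
  obtain ⟨k, hk⟩ := he γ⁻¹ (Γ.inv_mem hγ)
  simpa using (hs _ hp).smul hk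

/-- The inverse of a smooth bijection with invertible differentials is smooth. -/
lemma isSmoothH2_of_inverse {f g : ℍ → ℍ} (hf : IsSmoothH2 f)
    (hb : ∀ p, Function.Bijective (diffH2 f p)) (hgf : Function.LeftInverse g f)
    (hfg : Function.RightInverse g f) : IsSmoothH2 g := by
  have hl := isLocalHomeomorph_of_bijective hf hb
  have hgc : Continuous g := by
    let e := hl.toHomeomorphOfBijective ⟨hgf.injective, hfg.surjective⟩
    have : g = e.symm := by
      ext1 q
      rw [Homeomorph.eq_symm_apply]
      exact hfg q
    rw [this]
    exact e.symm.continuous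
  intro w hw
  refine ContDiffAt.contDiffWithinAt ?_
  -- on the upper half-plane, `hat g` is the inverse of the homeomorphism `hat f`
  let e : OpenPartialHomeomorph ℂ ℂ :=
    { toFun := hat f, invFun := hat g, source := U, target := U
      map_source' := fun w _ => hat_mem_U f w
      map_target' := fun w _ => hat_mem_U g w
      left_inv' := fun w hw => by simp [hat, hgf _, coe_ofComplex hw]
      right_inv' := fun w hw => by simp [hat, hfg _, coe_ofComplex hw]
      open_source := isOpen_U
      open_target := isOpen_U
      continuousOn_toFun := (contDiffOn_hat hf).continuousOn
      continuousOn_invFun := fun w hw => ((UpperHalfPlane.continuous_coe.comp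
        hgc).continuousAt.comp (ofComplex_tendsto hw)).continuousWithinAt }
  have hw' : hat g w ∈ U := hat_mem_U g w
  have hd : ContDiffAt ℝ ∞ (hat f) (hat g w) := (contDiffOn_hat hf).contDiffAt (U_mem_nhds hw')
  have hbw : Function.Bijective (fderiv ℝ (hat f) (hat g w)) := hb (g (ofComplex w))
  let L : ℂ ≃L[ℝ] ℂ := (LinearEquiv.ofBijective (fderiv ℝ (hat f) (hat g w) : ℂ →ₗ[ℝ] ℂ)
    hbw).toContinuousLinearEquiv
  exact e.contDiffAt_symm (f₀' := L) hw (hd.differentiableAt (by simp)).hasFDerivAt hd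

/-- The image of a surface group under an isomorphism intertwined by a homeomorphism is a surface
group. -/
lemma IsSurfaceGroup.range {Γ : Subgroup PSL(2, ℝ)} (hΓ : IsSurfaceGroup Γ)
    (ρ : Γ →* PSL(2, ℝ)) {f g : ℍ → ℍ} (hf : Continuous f) (hg : Continuous g)
    (hfg : Function.RightInverse g f) (hgf : Function.LeftInverse g f)
    (he : ∀ (γ : Γ) (p : ℍ), f ((γ : PSL(2, ℝ)) • p) = ρ γ • f p) : IsSurfaceGroup ρ.range where
  properlyDiscontinuous K L hK hL := by
    have h := hΓ.properlyDiscontinuous _ _ (hK.image hg) (hL.image hg)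
    refine (h.preimage (f := fun γ : Γ => (γ : PSL(2, ℝ))) Subtype.val_injective.injOn |>.image
      ρ).subset ?_
    rintro _ ⟨⟨γ, rfl⟩, _, ⟨p, hp, rfl⟩, hq⟩
    refine ⟨γ, ⟨γ.2, g (ρ γ • p), ⟨g p, ⟨p, hp, rfl⟩, ?_⟩, ⟨_, hq, rfl⟩⟩, rfl⟩
    apply hgf.injective
    change f ((γ : PSL(2, ℝ)) • g p) = f (g (ρ γ • p))
    rw [he, hfg, hfg]
  free := by
    rintro _ ⟨γ, rfl⟩ q hq
    have : (γ : PSL(2, ℝ)) • g q = g q := by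
      apply hgf.injective
      rw [he, hfg]
      exact hq
    have h1 : γ = 1 := Subtype.ext (hΓ.free γ γ.2 _ this)
    rw [h1, map_one]
  cocompact := by
    obtain ⟨K, hK, h⟩ := hΓ.cocompact
    refine ⟨f '' K, hK.image hf, fun q => ?_⟩
    obtain ⟨γ, hγ, hp⟩ := h (g q)
    refine ⟨ρ ⟨γ, hγ⟩, ⟨_, rfl⟩, γ • g q, hp, ?_⟩
    rw [he ⟨γ, hγ⟩, hfg]

/-! ### Lifts of maps between surfaces are equivariant -/

/-- Two continuous maps which agree pointwise up to a surface group agree up to one of its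
elements: the sets of points where a given element works form a locally finite partition into
closed sets. -/
lemma IsSurfaceGroup.exists_const {Γ : Subgroup PSL(2, ℝ)} (hΓ : IsSurfaceGroup Γ) {X : Type*}
    [TopologicalSpace X] [PreconnectedSpace X] {F G : X → ℍ} (hF : Continuous F)
    (hG : Continuous G) (h : ∀ x, ∃ γ ∈ Γ, F x = γ • G x) : ∃ γ ∈ Γ, ∀ x, F x = γ • G x := by
  rcases isEmpty_or_nonempty X with hX | ⟨⟨x₀⟩⟩
  · exact ⟨1, Γ.one_mem, fun x => isEmptyElim x⟩
  obtain ⟨γ₀, hγ₀, hx₀⟩ := h x₀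
  let A : Γ → Set X := fun γ => {x | F x = (γ : PSL(2, ℝ)) • G x}
  have hclosed : ∀ γ, IsClosed (A γ) := fun γ =>
    isClosed_eq hF (hG.const_smul (γ : PSL(2, ℝ)))
  have hfin : LocallyFinite A := by
    intro x
    refine ⟨F ⁻¹' Metric.closedBall (F x) 1 ∩ G ⁻¹' Metric.closedBall (G x) 1, Filter.inter_mem
      (hF.continuousAt.preimage_mem_nhds (Metric.closedBall_mem_nhds _ one_pos))
      (hG.continuousAt.preimage_mem_nhds (Metric.closedBall_mem_nhds _ one_pos)), ?_⟩
    refine ((hΓ.properlyDiscontinuous _ _ (isCompact_closedBall (G x) 1)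
      (isCompact_closedBall (F x) 1)).preimage Subtype.val_injective.injOn).subset ?_
    rintro γ ⟨y, hy, hyF, hyG⟩
    have hy' : F y = (γ : PSL(2, ℝ)) • G y := hy
    exact ⟨γ.2, F y, ⟨G y, hyG, hy'.symm⟩, hyF⟩
  have hcompl : (A ⟨γ₀, hγ₀⟩)ᶜ = ⋃ γ : {γ : Γ // γ ≠ ⟨γ₀, hγ₀⟩}, A γ := by
    ext x
    constructor
    · intro hx
      obtain ⟨γ, hγ, hxγ⟩ := h x
      refine Set.mem_iUnion.2 ⟨⟨⟨γ, hγ⟩, ?_⟩, hxγ⟩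
      rintro heq
      apply hx
      rw [← heq]
      exact hxγ
    · rintro hx hx'
      obtain ⟨⟨γ, hne⟩, hγ⟩ := Set.mem_iUnion.1 hx
      have h1 : F x = (γ : PSL(2, ℝ)) • G x := hγ
      have h2 : F x = γ₀ • G x := hx'
      apply hne
      refine Subtype.ext ?_
      have h3 := hΓ.free (γ₀⁻¹ * γ) (Γ.mul_mem (Γ.inv_mem hγ₀) γ.2) (G x) (by
        rw [mul_smul, ← h1, h2, inv_smul_smul])
      exact (inv_mul_eq_one.1 h3).symm
  have hopen : IsOpen (A ⟨γ₀, hγ₀⟩) := by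
    rw [← isClosed_compl_iff, hcompl]
    exact (hfin.comp_injective Subtype.val_injective).isClosed_iUnion fun γ => hclosed γ
  have huniv := IsClopen.eq_univ ⟨hclosed _, hopen⟩ ⟨x₀, hx₀⟩
  exact ⟨γ₀, hγ₀, fun x => (huniv.symm ▸ Set.mem_univ x : x ∈ A ⟨γ₀, hγ₀⟩)⟩

section

variable {Γ Γ' : Subgroup PSL(2, ℝ)} (hΓ' : IsSurfaceGroup Γ')
include hΓ'

lemma Descends.exists_const {f : ℍ → ℍ} (hf : Descends Γ Γ' f) (hc : Continuous f)
    {γ : PSL(2, ℝ)} (hγ : γ ∈ Γ) : ∃ γ' ∈ Γ', ∀ p, f (γ • p) = γ' • f p :=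
  hΓ'.exists_const (hc.comp (continuous_const_smul γ)) hc (hf γ hγ)

/-- In a continuous family of maps between surfaces all the maps are equivariant for the same
homomorphism of deck groups. -/
lemma equivariantFam_of_descends {ε : ℝ} {u : ℝ → ℍ → ℍ} (hu : IsSmoothFamilyH2 ε u)
    (hd : ∀ t ∈ Set.Ioo (-ε) ε, Descends Γ Γ' (u t)) : EquivariantFam Γ ε u := by
  intro γ hγ
  have : PreconnectedSpace (Set.Ioo (-ε) ε) := Subtype.preconnectedSpace isPreconnected_Ioo
  have hc : Continuous fun q : Set.Ioo (-ε) ε × ℍ => u q.1 q.2 := by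
    rw [UpperHalfPlane.isEmbedding_coe.continuous_iff]
    have h := (contDiffOn_hatFam hu).continuousOn.comp_continuous
      (f := fun q : Set.Ioo (-ε) ε × ℍ => ((q.1 : ℝ), (q.2 : ℂ)))
      ((continuous_subtype_val.comp continuous_fst).prodMk
        (UpperHalfPlane.continuous_coe.comp continuous_snd)) fun q => ⟨q.1.2, coe_mem_U q.2⟩
    exact h.congr fun q => hat_coe (u q.1) q.2
  obtain ⟨γ', -, h⟩ := hΓ'.exists_const (hc.comp (continuous_fst.prodMk
    ((continuous_const_smul (γ : PSL(2, ℝ))).comp continuous_snd))) hc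
    fun q => hd q.1 q.1.2 γ hγ q.2
  obtain ⟨k, rfl⟩ := exists_rep γ'
  exact ⟨k, fun t ht p => h (⟨t, ht⟩, p)⟩

end

/-! ### Orientation -/

/-- The reflection `w ↦ -conj w` of the hyperbolic plane. -/
def reflect (p : ℍ) : ℍ := ⟨-conj (p : ℂ), by simpa using p.im_pos⟩

lemma hat_reflect (f : ℍ → ℍ) : hat (fun p => reflect (f p)) = fun w => -conj (hat f w) := rfl

/-- Isometric involutions `σ` of the target, as far as they are needed to reverse the orientation
of a map: composition with `σ` preserves smoothness and pull-backs of the metric, and `σ`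
normalizes the isometry group. -/
structure IsTargetSymm (σ : ℍ → ℍ) : Prop where
  invol : ∀ p, σ (σ p) = p
  smooth : ∀ {f : ℍ → ℍ}, IsSmoothH2 f → IsSmoothH2 fun p => σ (f p)
  family : ∀ {ε : ℝ} {u : ℝ → ℍ → ℍ}, IsSmoothFamilyH2 ε u →
    IsSmoothFamilyH2 ε fun t p => σ (u t p)
  pull : ∀ {f : ℍ → ℍ}, IsSmoothH2 f → ∀ p, pullH2 (fun p => σ (f p)) p = pullH2 f p
  smul : ∀ k : SL(2, ℝ), ∃ k' : SL(2, ℝ), ∀ p, σ (k • p) = k' • σ p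

lemma isTargetSymm_id : IsTargetSymm id :=
  ⟨fun _ => rfl, fun h => h, fun h => h, fun _ _ => rfl, fun k => ⟨k, fun _ => rfl⟩⟩

lemma hasWirt_hat_reflect {f : ℍ → ℍ} (hf : IsSmoothH2 f) {w : ℂ} (hw : w ∈ U) :
    HasWirt (hat fun p => reflect (f p)) (-conj (dzb (hat f) w)) (-conj (dz (hat f) w)) w := by
  rw [hat_reflect]
  exact (hasWirt_hat hf hw).conj.neg

lemma al_reflect {f : ℍ → ℍ} (hf : IsSmoothH2 f) {w : ℂ} (hw : w ∈ U) :
    al (hat fun p => reflect (f p)) w = -conj (be (hat f) w) := by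
  rw [al, be, (hasWirt_hat_reflect hf hw).dz_eq, hat_reflect]
  simp
  ring

lemma be_reflect {f : ℍ → ℍ} (hf : IsSmoothH2 f) {w : ℂ} (hw : w ∈ U) :
    be (hat fun p => reflect (f p)) w = -conj (al (hat f) w) := by
  rw [al, be, (hasWirt_hat_reflect hf hw).dzb_eq, hat_reflect]
  simp
  ring

lemma isTargetSymm_reflect : IsTargetSymm reflect where
  invol p := by
    ext
    simp [reflect]
  smooth hf := (Complex.conjCLE.contDiff.comp_contDiffOn (contDiffOn_hat hf)).neg
  family hu := (Complex.conjCLE.contDiff.comp_contDiffOn (contDiffOn_hatFam hu)).neg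
  pull {f} hf p := by
    ext h k
    have hL : ∀ h, diffH2 (fun p => reflect (f p)) p h = -conj (diffH2 f p h) := fun h => by
      rw [diffH2_eq, diffH2_eq, (hasWirt_hat_reflect hf (coe_mem_U p)).dz_eq,
        (hasWirt_hat_reflect hf (coe_mem_U p)).dzb_eq, wirt_apply, wirt_apply]
      simp
    have him : (reflect (f p)).im = (f p).im := by
      change (-conj (f p : ℂ)).im = _
      simp
    rw [pullH2_apply, pullH2_apply, hL, hL, him]
    simp
  smul k := by
    let k' : SL(2, ℝ) := ⟨!![k 0 0, -k 0 1; -k 1 0, k 1 1], by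
      have := Matrix.SpecialLinearGroup.det_coe k
      rw [Matrix.det_fin_two] at this ⊢
      simpa using this⟩
    have h00 : k' 0 0 = k 0 0 := rfl
    have h01 : k' 0 1 = -k 0 1 := rfl
    have h10 : k' 1 0 = -k 1 0 := rfl
    have h11 : k' 1 1 = k 1 1 := rfl
    refine ⟨k', fun p => ?_⟩
    ext
    change -conj ((k • p : ℍ) : ℂ) = _
    rw [coe_smul_eq, coe_smul_eq, den, den, h00, h01, h10, h11]
    simp [reflect, ← neg_div]
    ring

lemma norm_al_ne_norm_be {f : ℍ → ℍ} {p : ℍ} (hb : Function.Injective (diffH2 f p)) :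
    ‖al (hat f) p‖ ≠ ‖be (hat f) p‖ := by
  intro h
  set a := dz (hat f) p with ha
  set b := dzb (hat f) p with hbb
  have hn : a * conj a = b * conj b := by
    have hy : (0 : ℝ) < p.im := p.im_pos
    have hv := (f p).im_pos
    rw [al, be, hat_coe, norm_div, norm_mul, norm_div, norm_mul, ← ha, ← hbb] at h
    have hn : ‖a‖ = ‖b‖ := by
      simpa [hy.ne', hv.ne'] using h
    rw [Complex.mul_conj, Complex.mul_conj, Complex.normSq_eq_norm_sq, Complex.normSq_eq_norm_sq,
      hn]
  have hL : ∀ z, diffH2 f p z = a * z + b * conj z := fun z => by rw [diffH2_eq, wirt_apply]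
  -- the vectors `conj a z - b conj z` are in the kernel
  have hker : ∀ z, conj a * z - b * conj z = 0 := fun z => by
    apply hb
    rw [map_zero, hL]
    simp only [map_sub, map_mul, Complex.conj_conj]
    linear_combination z * hn
  have h1 := hker 1
  have h2 := hker Complex.I
  simp only [map_one, mul_one, Complex.conj_I] at h1 h2
  have h3 : conj a + b = 0 := by
    have : Complex.I * (conj a + b) = 0 := by linear_combination h2
    exact (mul_eq_zero.1 this).resolve_left Complex.I_ne_zero
  have hb0 : b = 0 := by linear_combination (h3 - h1) / 2
  have ha0 : a = 0 := by
    have : conj a = 0 := by linear_combination (h3 + h1) / 2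
    simpa using this
  have : (1 : ℂ) = 0 := hb (by rw [hL, hL, ha0, hb0]; simp)
  exact one_ne_zero this

/-- A local diffeomorphism preserves orientation, possibly after composition with a reflection. -/
lemma exists_pos {f : ℍ → ℍ} (hf : IsSmoothH2 f) (hb : ∀ p, Function.Bijective (diffH2 f p)) :
    ∃ σ, IsTargetSymm σ ∧ Pos fun p => σ (f p) := by
  have hne : ∀ w ∈ U, ‖al (hat f) w‖ ≠ ‖be (hat f) w‖ := fun w hw =>
    norm_al_ne_norm_be (p := ⟨w, hw⟩) (hb _).injective
  by_cases hpos : Pos f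
  · exact ⟨id, isTargetSymm_id, hpos⟩
  refine ⟨reflect, isTargetSymm_reflect, fun w hw => ?_⟩
  rw [al_reflect hf hw, be_reflect hf hw, norm_neg, norm_neg, RCLike.norm_conj, RCLike.norm_conj]
  by_contra hw'
  have hconn : IsPreconnected U := (convex_halfSpace_im_gt 0).isPreconnected
  simp only [Pos, not_forall, not_lt] at hpos
  obtain ⟨z, hz, hz'⟩ := hpos
  obtain ⟨y, hy, hy'⟩ := hconn.intermediate_value₂ hz hw (contDiffOn_al hf).continuousOn.norm
    (contDiffOn_be hf).continuousOn.norm hz' (not_lt.1 hw')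
  exact hne y hy hy'

lemma bijective_diffH2_of_inverse {f g : ℍ → ℍ} (hf : IsSmoothH2 f) (hg : IsSmoothH2 g)
    (hgf : Function.LeftInverse g f) (p : ℍ) : Function.Bijective (diffH2 f p) := by
  have h1 := (hasWirt_hat hf (coe_mem_U p)).differentiableAt.hasFDerivAt
  have h2 : HasFDerivAt (hat g) (fderiv ℝ (hat g) (hat f p)) (hat f p) :=
    (hasWirt_hat hg (hat_mem_U f p)).differentiableAt.hasFDerivAt
  have h3 := h2.comp (p : ℂ) h1
  have h4 : hat g ∘ hat f =ᶠ[nhds (p : ℂ)] id := by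
    filter_upwards [U_mem_nhds (coe_mem_U p)] with w hw
    simp [hat, hgf _, coe_ofComplex hw]
  have h5 := h3.unique ((hasFDerivAt_id (p : ℂ)).congr_of_eventuallyEq h4)
  have hinj : Function.Injective (diffH2 f p) := by
    refine Function.LeftInverse.injective (g := fderiv ℝ (hat g) (hat f p)) fun v => ?_
    exact congrArg (fun L : ℂ →L[ℝ] ℂ => L v) h5
  exact ⟨hinj, (LinearMap.injective_iff_surjective (f := (diffH2 f p : ℂ →ₗ[ℝ] ℂ))).1 hinj⟩

namespace IsTargetSymm
variable {σ : ℍ → ℍ} (hσ : IsTargetSymm σ) {f g : ℍ → ℍ}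
include hσ

lemma energyH2_eq (hf : IsSmoothH2 f) (D : Set ℍ) :
    energyH2 D (fun p => σ (f p)) = energyH2 D f := by
  simp only [energyH2, hσ.pull hf]

lemma areaProd_eq (hg : IsSmoothH2 g) (D : Set ℍ) :
    areaProd D f (fun p => σ (g p)) = areaProd D f g := by
  simp only [areaProd, hσ.pull hg]

lemma equivariantFam {Γ : Subgroup PSL(2, ℝ)} {ε : ℝ} {u : ℝ → ℍ → ℍ}
    (h : EquivariantFam Γ ε u) : EquivariantFam Γ ε fun t p => σ (u t p) := by
  intro γ hγ
  obtain ⟨k, hk⟩ := h γ hγ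
  obtain ⟨k', hk'⟩ := hσ.smul k
  exact ⟨k', fun t ht p => by simp only [hk t ht, hk']⟩

lemma equivariant {Γ : Subgroup PSL(2, ℝ)} (h : Equivariant Γ f) :
    Equivariant Γ fun p => σ (f p) := by
  intro γ hγ
  obtain ⟨k, hk⟩ := h γ hγ
  obtain ⟨k', hk'⟩ := hσ.smul k
  exact ⟨k', fun p => by simp only [hk, hk']⟩

end IsTargetSymm

/-! ### The Euler–Lagrange equation characterizes the maps in question -/

lemma equivariant_of_forall {Γ Γ' : Subgroup PSL(2, ℝ)} {f : ℍ → ℍ}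
    (hf : ∀ γ ∈ Γ, ∃ γ' ∈ Γ', ∀ p, f (γ • p) = γ' • f p) : Equivariant Γ f := by
  intro γ hγ
  obtain ⟨γ', -, h⟩ := hf γ hγ
  obtain ⟨k, rfl⟩ := exists_rep γ'
  exact ⟨k, h⟩

section

variable {Γ : Subgroup PSL(2, ℝ)} (hΓ : IsSurfaceGroup Γ) {D : Set ℍ}
  (hD : IsFundamentalDomain Γ D (volume : Measure ℍ)) {φ : ℂ → ℝ} (hφ : IsCutoff Γ φ)
  {σ : ℍ → ℍ} (hσ : IsTargetSymm σ)

section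
include hΓ hσ

/-- A variation with the symmetries of `f` whose composition with `σ` is the variation of `σ ∘ f` in
the direction of the Euler–Lagrange operator. -/
lemma exists_symm_variation {f : ℍ → ℍ} (hf : IsSmoothH2 f) (hpos : Pos fun p => σ (f p))
    (he : Equivariant Γ f) :
    ∃ ε > 0, ∃ u : ℝ → ℍ → ℍ, IsSmoothFamilyH2 ε u ∧ u 0 = f ∧
      (∀ w ∈ U, velFrame (fun t p => σ (u t p)) w =
        nn (hat fun p => σ (f p)) w * conj (el (hat fun p => σ (f p)) w)) ∧
      ∀ γ k : PSL(2, ℝ), (∀ p, f (γ • p) = k • f p) →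
        ∀ t ∈ Set.Ioo (-ε) ε, ∀ p, u t (γ • p) = k • u t p := by
  obtain ⟨ε, hε, u, hu, hu0, hvel, hsymm⟩ :=
    exists_el_variation hΓ (hσ.smooth hf) hpos (hσ.equivariant he)
  refine ⟨ε, hε, fun t p => σ (u t p), hσ.family hu, ?_, ?_, ?_⟩
  · ext1 p
    simp only [hu0, hσ.invol]
  · simpa only [hσ.invol] using hvel
  · intro γ k hk t ht p
    obtain ⟨γ, rfl⟩ := exists_rep γ
    obtain ⟨k, rfl⟩ := exists_rep k
    obtain ⟨k', hk'⟩ := hσ.smul k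
    have h := hsymm γ k' (fun p => by
      have := hk p
      rw [mk_smul, mk_smul] at this
      simp only [this, hk']) t ht p
    have h2 := hk' (σ (u t p))
    rw [hσ.invol] at h2
    simp only [mk_smul, h, ← h2, hσ.invol]

end

lemma equivariantFam_of_forall {ε : ℝ} {u : ℝ → ℍ → ℍ} {f : ℍ → ℍ} (he : Equivariant Γ f)
    (hs : ∀ γ k : PSL(2, ℝ), (∀ p, f (γ • p) = k • f p) →
      ∀ t ∈ Set.Ioo (-ε) ε, ∀ p, u t (γ • p) = k • u t p) : EquivariantFam Γ ε u := by
  intro γ hγ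
  obtain ⟨k, hk⟩ := he γ hγ
  exact ⟨k, hs γ k hk⟩

include hΓ hD hφ hσ

/-- The first variation of `F` at a map which `σ` makes orientation preserving. -/
lemma hasDerivAt_energyH2_symm {ε : ℝ} (hε : 0 < ε) {u : ℝ → ℍ → ℍ} (hu : IsSmoothFamilyH2 ε u)
    (he : EquivariantFam Γ ε u) (hpos : Pos fun p => σ (u 0 p)) :
    HasDerivAt (fun t => energyH2 D (u t))
      (∫ w in U, φ w * (2 * (el (hat fun p => σ (u 0 p)) w * (conj (nn (hat fun p => σ (u 0 p)) w) *
        velFrame (fun t p => σ (u t p)) w)).re / w.im ^ 2)) 0 := by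
  refine (hasDerivAt_energyH2 hΓ hD hφ hε (hσ.family hu) (hσ.equivariantFam he)
    hpos).congr_of_eventuallyEq ?_
  filter_upwards [isOpen_Ioo.mem_nhds (show (0 : ℝ) ∈ Set.Ioo (-ε) ε from ⟨by simpa using hε, hε⟩)]
    with t ht
  exact (hσ.energyH2_eq (isSmoothH2_fam hu ht) D).symm

/-- A map is critical for `F` among the maps with the same symmetries only if it satisfies the
Euler–Lagrange equation. -/
lemma el_eq_zero_of_hasDerivAt {f : ℍ → ℍ} (hf : IsSmoothH2 f) (hpos : Pos fun p => σ (f p))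
    (he : Equivariant Γ f)
    (h : ∀ ε > 0, ∀ u : ℝ → ℍ → ℍ, IsSmoothFamilyH2 ε u → u 0 = f →
      (∀ γ k : PSL(2, ℝ), (∀ p, f (γ • p) = k • f p) →
        ∀ t ∈ Set.Ioo (-ε) ε, ∀ p, u t (γ • p) = k • u t p) →
      ∀ d, HasDerivAt (fun t => energyH2 D (u t)) d 0 → d = 0) :
    ∀ w ∈ U, el (hat fun p => σ (f p)) w = 0 := by
  obtain ⟨ε, hε, u, hu, rfl, hvel, hsymm⟩ := exists_symm_variation hΓ hσ hf hpos he
  have hd := h ε hε u hu rfl hsymm _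
    (hasDerivAt_energyH2_symm hΓ hD hφ hσ hε hu (equivariantFam_of_forall he hsymm) hpos)
  refine el_eq_zero_of_integral hφ (hσ.smooth hf) hpos (hσ.equivariant he) ?_
  refine Eq.trans ?_ hd
  refine setIntegral_congr_fun isOpen_U.measurableSet fun w hw => ?_
  simp only [hvel w hw]

omit hΓ hD hφ hσ in
lemma integral_el_eq_zero {F X : ℂ → ℂ} (hel : ∀ w ∈ U, el F w = 0) :
    ∫ w in U, φ w * (2 * (el F w * X w).re / w.im ^ 2) = 0 := by
  rw [setIntegral_congr_fun isOpen_U.measurableSet (g := fun _ => (0 : ℝ)) fun w hw => by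
    simp [hel w hw]]
  simp

lemma isCritical_of_el {Γ' : Subgroup PSL(2, ℝ)} (hΓ' : IsSurfaceGroup Γ') {f : ℍ → ℍ}
    (hpos : Pos fun p => σ (f p))
    (hel : ∀ w ∈ U, el (hat fun p => σ (f p)) w = 0) : IsCritical Γ Γ' D f := by
  rintro ε hε u hu hd rfl
  have h := hasDerivAt_energyH2_symm hΓ hD hφ hσ hε hu (equivariantFam_of_descends hΓ' hu hd) hpos
  rwa [integral_el_eq_zero hel] at h

omit hΓ hD hφ hσ in
lemma EquivariantFam.equivariant {ε : ℝ} (hε : 0 < ε) {u : ℝ → ℍ → ℍ}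
    (h : EquivariantFam Γ ε u) : Equivariant Γ (u 0) := by
  intro γ hγ
  obtain ⟨k, hk⟩ := h γ hγ
  exact ⟨k, hk 0 ⟨by simpa using hε, hε⟩⟩

lemma hasDerivAt_areaProd_symm {ε : ℝ} (hε : 0 < ε) {u v : ℝ → ℍ → ℍ} (hu : IsSmoothFamilyH2 ε u)
    (hue : EquivariantFam Γ ε u) (hu0 : u 0 = id) (hv : IsSmoothFamilyH2 ε v)
    (hve : EquivariantFam Γ ε v) {f : ℍ → ℍ} (hv0 : (fun p => σ (v 0 p)) = f) (hpos : Pos f)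
    (hdet : ∀ w ∈ U, ‖al (hat f) w‖ ^ 2 - ‖be (hat f) w‖ ^ 2 = 1) :
    HasDerivAt (fun t => areaProd D (u t) (v t))
      ((∫ w in U, φ w * (2 * (el (hat f) w * (conj (nn (hat f) w) *
        velFrame (fun t p => σ (v t p)) w)).re / w.im ^ 2)) +
        ∫ w in U, φ w * (2 * (‖al (hat f) w‖ * (w.im * dz (velFrame u) w +
          conj (velFrame u w) / (2 * Complex.I)) - conj (conj (nn (hat f) w) *
          be (hat f) w) * (w.im * dzb (velFrame u) w - velFrame u w / (2 * Complex.I))).re /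
        w.im ^ 2)) 0 := by
  subst hv0
  refine (hasDerivAt_areaProd hΓ hD hφ hε hu hue hu0 (hσ.family hv) (hσ.equivariantFam hve) hpos
    hdet).congr_of_eventuallyEq ?_
  filter_upwards [isOpen_Ioo.mem_nhds (show (0 : ℝ) ∈ Set.Ioo (-ε) ε from ⟨by simpa using hε, hε⟩)]
    with t ht
  exact (hσ.areaProd_eq (isSmoothH2_fam hv ht) D).symm

/-- A solution of the Euler–Lagrange equation has Jacobian one and a minimal graph. -/
lemma isMinimalLagrangian_of_el {Γ' : Subgroup PSL(2, ℝ)} (hΓ' : IsSurfaceGroup Γ') {f : ℍ → ℍ}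
    (hf : IsLiftOfDiffeo Γ Γ' f) (hpos : Pos fun p => σ (f p))
    (hel : ∀ w ∈ U, el (hat fun p => σ (f p)) w = 0) : IsMinimalLagrangian Γ Γ' D f := by
  have hdet : ∀ w ∈ U, ‖al (hat fun p => σ (f p)) w‖ ^ 2 - ‖be (hat fun p => σ (f p)) w‖ ^ 2 = 1 :=
    fun w hw => det_eq_one (hσ.smooth hf.1) hpos hel hw
  refine ⟨hf, fun p => ?_, ?_⟩
  · rw [← hσ.pull hf.1, areaDensity_pullH2, hdet _ (coe_mem_U p), abs_one]
  rintro ε hε u v hu hv hd hu0 rfl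
  have hue := equivariantFam_of_descends hΓ hu fun t ht => (hd t ht).1
  have hve := equivariantFam_of_descends hΓ' hv fun t ht => (hd t ht).2
  have h := hasDerivAt_areaProd_symm hΓ hD hφ hσ hε hu hue hu0 hv hve rfl hpos hdet
  rw [integral_el_eq_zero hel, integral_source_eq_zero hΓ hD hφ (hσ.smooth hf.1) hpos hel
    (hσ.equivariant (hve.equivariant hε)) (contDiffOn_velFrame hu hε), add_zero] at h
  · exact h
  intro γ hγ p
  obtain ⟨k, hk⟩ := hue γ hγ
  -- `u 0` is the identity, so that `k` and `γ` have the same rotation at `p`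
  have h1 := al_smul (isSmoothH2_fam hu ⟨by simpa using hε, hε⟩)
    (hk 0 ⟨by simpa using hε, hε⟩) p
  rw [al_id hu0 (coe_mem_U _), al_id hu0 (coe_mem_U _), mul_one] at h1
  have h2 := rot_mul_conj γ (coe_mem_U p)
  have h3 : rot k (u 0 p) = rot γ p := by linear_combination rot γ p * (-h1) - rot k (u 0 p) * h2
  rw [velFrame_smul hu hε hk, h3]

/-- A minimal Lagrangian map satisfies the Euler–Lagrange equation. -/
lemma el_eq_zero_of_isMinimalLagrangian {Γ' : Subgroup PSL(2, ℝ)} {f : ℍ → ℍ}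
    (h : IsMinimalLagrangian Γ Γ' D f) (he : ∀ γ ∈ Γ, ∃ γ' ∈ Γ', ∀ p, f (γ • p) = γ' • f p)
    (hpos : Pos fun p => σ (f p)) : ∀ w ∈ U, el (hat fun p => σ (f p)) w = 0 := by
  obtain ⟨⟨hf, -⟩, harea, hmin⟩ := h
  have heq := equivariant_of_forall he
  have hdet : ∀ w ∈ U, ‖al (hat fun p => σ (f p)) w‖ ^ 2 -
      ‖be (hat fun p => σ (f p)) w‖ ^ 2 = 1 := by
    intro w hw
    have h1 := harea ⟨w, hw⟩
    rw [← hσ.pull hf, areaDensity_pullH2, abs_of_pos] at h1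
    · exact h1
    · have := hpos w hw
      exact sub_pos.2 (pow_lt_pow_left₀ this (norm_nonneg _) two_ne_zero)
  obtain ⟨ε, hε, v, hv, hv0, hvel, hsymm⟩ := exists_symm_variation hΓ hσ hf hpos heq
  let u : ℝ → ℍ → ℍ := fun _ => id
  have hu : IsSmoothFamilyH2 ε u :=
    contDiff_snd.contDiffOn.congr fun q hq => coe_ofComplex hq.2
  have hue : EquivariantFam Γ ε u := fun γ _ => ⟨γ, fun _ _ _ => rfl⟩
  have hd := (hmin ε hε u v hu hv (fun t ht => ⟨fun γ hγ p => ⟨γ, hγ, rfl⟩, fun γ hγ p => by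
    obtain ⟨γ', hγ', hk⟩ := he γ hγ
    exact ⟨γ', hγ', hsymm γ γ' hk t ht p⟩⟩) rfl hv0).unique
    (hasDerivAt_areaProd_symm hΓ hD hφ hσ hε hu hue rfl hv (equivariantFam_of_forall heq hsymm)
      (by simp only [hv0]) hpos hdet)
  have hvelu : ∀ w ∈ U, velFrame u w = 0 := fun w hw => by
    have h1 := (hasDerivAt_hat hu hε hw).unique (hasDerivAt_const (0 : ℝ) (hat id w))
    rw [velFrame, h1, zero_div]
  have hev : ∀ w ∈ U, velFrame u =ᶠ[nhds w] fun _ => 0 := fun w hw => by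
    filter_upwards [U_mem_nhds hw] with z hz using hvelu z hz
  rw [setIntegral_congr_fun (f := fun w => φ w * (2 * (‖al (hat fun p => σ (f p)) w‖ *
    (w.im * dz (velFrame u) w + conj (velFrame u w) / (2 * Complex.I)) -
    conj (conj (nn (hat fun p => σ (f p)) w) * be (hat fun p => σ (f p)) w) *
    (w.im * dzb (velFrame u) w - velFrame u w / (2 * Complex.I))).re / w.im ^ 2))
    isOpen_U.measurableSet (g := fun _ => (0 : ℝ)) fun w hw => by
      simp [hvelu w hw, dz_congr (hev w hw), dzb_congr (hev w hw), (hasWirt_const 0 w).dz_eq,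
        (hasWirt_const 0 w).dzb_eq], integral_zero, add_zero] at hd
  refine el_eq_zero_of_integral hφ (hσ.smooth hf) hpos (hσ.equivariant heq) ?_
  rw [hd]
  refine setIntegral_congr_fun isOpen_U.measurableSet fun w hw => ?_
  simp only [hvel w hw]

end

/-- Solutions of the Euler–Lagrange equation minimize `F` among the equivariant maps to
hyperbolic 3-space. -/
lemma isMinimizing_of_el {Γ : Subgroup PSL(2, ℝ)} (hΓ : IsSurfaceGroup Γ) {D : Set ℍ}
    (hD : IsFundamentalDomain Γ D (volume : Measure ℍ)) {σ : ℍ → ℍ} (hσ : IsTargetSymm σ)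
    (ρ : Γ →* PSL(2, ℝ)) {f : ℍ → ℍ} (hf : IsSmoothH2 f)
    (he : ∀ (γ : Γ) (p : ℍ), f ((γ : PSL(2, ℝ)) • p) = ρ γ • f p) (hpos : Pos fun p => σ (f p))
    (hel : ∀ w ∈ U, el (hat fun p => σ (f p)) w = 0) :
    IsMinimizing D ρ fun p => toH3 (f p) := by
  refine ⟨⟨isSmoothH3_toH3 hf, fun γ p => by simp only [he, toH3_smul]⟩, ?_⟩
  rintro g ⟨hg, hge⟩
  have hk : ∀ γ : SL(2, ℝ), (γ : PSL(2, ℝ)) ∈ Γ → ∃ k : SL(2, ℝ), (∀ p, f (γ • p) = k • f p) ∧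
      ∀ p, g (γ • p) = H3.act (toSL2C k) (g p) := by
    intro γ hγ
    obtain ⟨k, hk⟩ := exists_rep (ρ ⟨γ, hγ⟩)
    refine ⟨k, fun p => ?_, fun p => ?_⟩
    · rw [← mk_smul, ← mk_smul, hk]
      exact he ⟨γ, hγ⟩ p
    · rw [← mk_smul, ← mk_smul_H3, hk]
      exact hge ⟨γ, hγ⟩ p
  calc energyH3 D (fun p => toH3 (f p)) = energyH2 D fun p => σ (f p) := by
        rw [energyH3_toH3 hf, hσ.energyH2_eq hf]
    _ ≤ energyH2 D fun p => σ (g p).proj := by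
        refine energyH2_le hΓ hD (hσ.smooth hf) (hσ.smooth (isSmoothH2_proj hg)) hpos hel ?_
        intro γ hγ
        obtain ⟨k, hkf, hkg⟩ := hk γ hγ
        obtain ⟨k', hk'⟩ := hσ.smul k
        exact ⟨k', fun p => by rw [hkf, hk'], fun p => by rw [hkg, proj_act, hk']⟩
    _ = energyH2 D fun p => (g p).proj := hσ.energyH2_eq (isSmoothH2_proj hg) D
    _ ≤ energyH3 D g := energyH2_proj_le hΓ hD hg fun γ hγ => by
        obtain ⟨k, -, hkg⟩ := hk γ hγ
        exact ⟨k, hkg⟩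

end MinLag

end

theorem mainTheorem7
    (Γ : Subgroup PSL(2, ℝ)) (hΓ : MinLag.IsSurfaceGroup Γ)
    (D : Set ℍ) (hD : IsFundamentalDomain Γ D (volume : Measure ℍ)) :
    (∀ ρ : Γ →* PSL(2, ℝ), MinLag.IsFuchsian ρ →
      ∀ f : ℍ → ℍ, MinLag.IsSmoothH2 f → (∀ p, Function.Bijective (MinLag.diffH2 f p)) →
        (∀ (γ : Γ) (p : ℍ), f ((γ : PSL(2, ℝ)) • p) = ρ γ • f p) →
        (MinLag.IsMinimizing D ρ (fun p => MinLag.toH3 (f p)) ↔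
          MinLag.IsMinimalLagrangian Γ ρ.range D f)) ∧
    (∀ Γ' : Subgroup PSL(2, ℝ), MinLag.IsSurfaceGroup Γ' →
      ∀ f : ℍ → ℍ, MinLag.IsLiftOfDiffeo Γ Γ' f →
        (MinLag.IsMinimalLagrangian Γ Γ' D f ↔ MinLag.IsCritical Γ Γ' D f)) := by
  obtain ⟨φ, hφ⟩ := hΓ.exists_isCutoff
  constructor
  · intro ρ _ f hf hb he
    have heρ : ∀ γ ∈ Γ, ∃ γ' ∈ ρ.range, ∀ p, f (γ • p) = γ' • f p :=
      fun γ hγ => ⟨ρ ⟨γ, hγ⟩, ⟨_, rfl⟩, he ⟨γ, hγ⟩⟩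
    have heq := MinLag.equivariant_of_forall heρ
    obtain ⟨σ, hσ, hpos⟩ := MinLag.exists_pos hf hb
    constructor
    · intro hmin
      have hel := MinLag.el_eq_zero_of_hasDerivAt hΓ hD hφ hσ hf hpos heq
        fun ε hε u hu hu0 hsymm d hd => by
          refine IsLocalMin.hasDerivAt_eq_zero ?_ hd
          filter_upwards [isOpen_Ioo.mem_nhds
            (show (0 : ℝ) ∈ Set.Ioo (-ε) ε from ⟨by simpa using hε, hε⟩)] with t ht
          have hut := MinLag.isSmoothH2_fam hu ht
          have h := hmin.2 (fun p => MinLag.toH3 (u t p)) ⟨MinLag.isSmoothH3_toH3 hut,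
            fun γ p => by
              simp only [hsymm γ (ρ γ) (he γ) t ht, MinLag.toH3_smul]⟩
          rwa [MinLag.energyH3_toH3 hf, MinLag.energyH3_toH3 hut, ← hu0] at h
      -- `f` is the lift of a diffeomorphism, and `ρ` is the action on the target
      have hbij := hΓ.bijective hf hb fun γ hγ => ⟨_, he ⟨γ, hγ⟩⟩
      obtain ⟨g, hgf, hfg⟩ := Function.bijective_iff_has_inverse.1 hbij
      have hg := MinLag.isSmoothH2_of_inverse hf hb hgf hfg
      have hΓ' := hΓ.range ρ hf.continuous hg.continuous hfg hgf he
      refine MinLag.isMinimalLagrangian_of_el hΓ hD hφ hσ hΓ' ⟨hf, fun γ hγ p => ?_, g, hg, ?_, hgf,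
        hfg⟩ hpos hel
      · obtain ⟨γ', hγ', h⟩ := heρ γ hγ
        exact ⟨γ', hγ', h p⟩
      · rintro _ ⟨γ, rfl⟩ q
        refine ⟨γ, γ.2, hbij.injective ?_⟩
        rw [hfg, he, hfg]
    · intro h
      exact MinLag.isMinimizing_of_el hΓ hD hσ ρ hf he hpos
        (MinLag.el_eq_zero_of_isMinimalLagrangian hΓ hD hφ hσ h heρ hpos)
  · intro Γ' hΓ' f hf
    obtain ⟨hfs, hdesc, g, hg, -, hgf, -⟩ := id hf
    have hconst : ∀ γ ∈ Γ, ∃ γ' ∈ Γ', ∀ p, f (γ • p) = γ' • f p :=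
      fun γ hγ => hdesc.exists_const hΓ' hfs.continuous hγ
    obtain ⟨σ, hσ, hpos⟩ :=
      MinLag.exists_pos hfs (MinLag.bijective_diffH2_of_inverse hfs hg hgf)
    constructor
    · intro h
      exact MinLag.isCritical_of_el hΓ hD hφ hσ hΓ' hpos
        (MinLag.el_eq_zero_of_isMinimalLagrangian hΓ hD hφ hσ h hconst hpos)
    · intro hcrit
      refine MinLag.isMinimalLagrangian_of_el hΓ hD hφ hσ hΓ' hf hpos
        (MinLag.el_eq_zero_of_hasDerivAt hΓ hD hφ hσ hfs hpos
          (MinLag.equivariant_of_forall hconst) fun ε hε u hu hu0 hsymm d hd => ?_)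
      refine hd.unique (hcrit ε hε u hu (fun t ht γ hγ p => ?_) hu0)
      obtain ⟨γ', hγ', hk⟩ := hconst γ hγ
      exact ⟨γ', hγ', hsymm γ γ' hk t ht p⟩
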